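/- Let $k$ be a $\mathfrak p$-adic field (a non-archimedean local field of characteristic $0$) of odd residual characteristic, with ring of integers $\mathfrak o$, prime element $\pi$, residue field of $q$ elements, and normalized absolute value $|\ |$ ($|\pi|=q^{-1}$). Let $D$ be the division quaternion algebra over $k$, with $k$-basis $1,\varepsilon,\varPi,\varPi\varepsilon$, where $\varepsilon^2\in\mathfrak o^\times$ is a non-square unit, $\varPi^2=\pi$, $\varPi\varepsilon=-\varepsilon\varPi$, with involution $(a+b\varepsilon+c\varPi+d\varPi\varepsilon)^*=a-b\varepsilon-c\varPi-d\varPi\varepsilon$, maximal order $\mathcal O=\mathfrak o+\mathfrak o\varepsilon+\mathfrak o\varPi+\mathfrak o\varPi\varepsilon$, and reduced norm $N_{rd}$ on matrices over $D$. For $n\ge 1$ put $G=GL_n(D)$, $K=GL_n(\mathcal O)$, let $B\subset G$ be the subgroup of lower triangular matrices, and $X=\{x\in G: x^*=x\}$ (where $(a_{ij})^*=(a_{ji}^*)$), on which $G$ acts by $g\cdot x=gxg^*$. For a matrix $g$ let $g^{(i)}$ be its upper left $i\times i$ block. Let $\psi_i(p)=N_{rd}(p^{(i)})$ for $p\in B$,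 and let $d_i(x)\in k$ satisfy $d_i(x)^2=N_{rd}(x^{(i)})$ for $x\in X$. For $s\in\mathbb C^n$ put $|\mathbf d(x)|^s=\prod_{i=1}^n|d_i(x)|^{s_i}$ if all $d_i(x)\neq0$, and $|\mathbf d(x)|^s=0$ otherwise. Let $dg$, $dk$ be the Haar measures on $G$, $K$ for which $K$ has volume $1$, $dp$ the left Haar measure on $B$ for which $B\cap K$ has volume $1$, $\delta$ the modulus character of $B$ ($d(pp')=\delta(p')^{-1}dp$), and $dx$ a nonzero $G$-invariant measure on $X$, finite on compact sets. Let $\mathcal H$ be the Hecke algebra of compactly supported $K$-bi-invariant functions $G\to\mathbb C$, and $\mathcal S(K\backslash X)$ the space of compactly supported $K$-invariant functions $X\to\mathbb C$. Put $$\omega(x;s)=\int_K|\mathbf d(\kappa\cdot x)|^s\,d\kappa,\qquad \lambda_s(f)=\int_B f(p)\prod_{i=1}^n|\psi_i(p)|^{-s_i}\,\delta(p)\,dp,$$ $$(f*\varphi)(x)=\int_G f(g)\varphi(g^{-1}\cdot x)\,dg,\qquad F_0(\varphi)(s)=\int_X\varphi(x)\,\omega(x^{-1};s)\,dx$$ for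 $x\in X$, $f\in\mathcal H$, $\varphi\in\mathcal S(K\backslash X)$. Let $\Lambda_n$ be the set of $\alpha\in\mathbb Z^n$ with $\alpha_1\ge\cdots\ge\alpha_n$ in which every odd entry occurs an even number of times, and for $\alpha\in\Lambda_n$ let $\pi^\alpha\in X$ be the block-diagonal matrix with, in the order of the entries of $\alpha$, a $1\times1$ block $\pi^e$ for every entry $2e$ and a block $\begin{pmatrix}0&\pi^e\varPi\\-\pi^e\varPi&0\end{pmatrix}$ for every successive pair of entries $2e+1,2e+1$. Then the integrals defining $\omega(x;s)$ and $F_0(\varphi)(s)$ converge absolutely for $\mathrm{Re}(s_i)\ge0$ $(1\le i\le n-1)$ and continue to elements of $\mathbb C(q^{s_1},\dots,q^{s_n})$, again denoted $\omega(x;s)$ and $F_0(\varphi)$; the integral $\lambda_s(f)$ converges absolutely for all $s\in\mathbb C^n$ and defines an element of $\mathbb C(q^{s_1},\dots,q^{s_n})$; the integral defining $f*\varphi$ converges absolutely, and $f*\varphi\in\mathcal S(K\backslash X)$. Moreover: 1. for all $f\in\mathcal H$ and $\varphi\in\mathcal S(K\backslash X)$, $F_0(f*\varphi)=\lambda_s(f)\,F_0(\varphi)$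 in $\mathbb C(q^{s_1},\dots,q^{s_n})$; 2. $F_0:\mathcal S(K\backslash X)\to\mathbb C(q^{s_1},\dots,q^{s_n})$ is injective; and 3. equivalently, the functions $\omega(\pi^\alpha;s)$, $\alpha\in\Lambda_n$, are linearly independent over $\mathbb C$. -/

import Mathlib

open MeasureTheory
open scoped Matrix Quaternion

noncomputable section

set_option linter.unusedSectionVars false

namespace QHerm

/-- In a finite-dimensional algebra, a multiplicatively closed subspace containing `1` is closed
under inverses. -/
theorem inv_mem_of_finite {k R : Type*} [Field k] [Ring R] [Algebra k R] [Module.Finite k R]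
    (S : Submodule k R) (h1 : (1 : R) ∈ S) (hm : ∀ a b, a ∈ S → b ∈ S → a * b ∈ S) (g : Rˣ)
    (hg : (g : R) ∈ S) : ((g⁻¹ : Rˣ) : R) ∈ S := by
  let T : S →ₗ[k] S := (LinearMap.mulLeft k (g : R)).restrict fun c hc => hm _ _ hg hc
  have hT : Function.Injective T := by
    intro c c' h
    have h' : (g : R) * c = g * c' := congrArg Subtype.val h
    exact Subtype.ext ((Units.mul_right_inj g).1 h')
  obtain ⟨c, hc⟩ := LinearMap.injective_iff_surjective.1 hT ⟨1, h1⟩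
  have h2 : (g : R) * c = 1 := congrArg Subtype.val hc
  rw [show ((g⁻¹ : Rˣ) : R) = c from by
    rw [← mul_one ((g⁻¹ : Rˣ) : R), ← h2, Units.inv_mul_cancel_left]]
  exact c.2

/-! ### The local field and the division quaternion algebra -/

section Field

variable (k : Type*) [NontriviallyNormedField k] [IsUltrametricDist k]

/-- The ring of integers `{a | ‖a‖ ≤ 1}` of `k`. -/
def integers : ValuationSubring k := (NormedField.valuation (K := k)).valuationSubring

theorem mem_integers {k : Type*} [NontriviallyNormedField k] [IsUltrametricDist k] {a : k} :
    a ∈ integers k ↔ ‖a‖ ≤ 1 := Iff.rfl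

/-- The residue field of `k`. -/
abbrev ResidueField : Type _ := IsLocalRing.ResidueField (integers k)

/-- The cardinality `q` of the residue field of `k`. -/
def q : ℕ := Nat.card (ResidueField k)

/-- The data presenting the division quaternion algebra over `k` (of odd residual characteristic):
`u = ε²` is a unit which is not a square (so that `k(ε)` is the unramified quadratic extension),
and `π = Π²` is a prime element of `k`. -/
structure QuatData where
  u : k
  π : k
  norm_u : ‖u‖ = 1
  not_isSquare_u : ¬ IsSquare u
  π_ne_zero : π ≠ 0
  norm_π_lt_one : ‖π‖ < 1
  norm_le_norm_π : ∀ a : k, ‖a‖ < 1 → ‖a‖ ≤ ‖π‖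

end Field

namespace QuatData

variable {k : Type*} [NontriviallyNormedField k] [IsUltrametricDist k] (P : QuatData k)

/-- The quaternion algebra `D` with `k`-basis `1, ε, Π, εΠ`, where `ε² = u`, `Π² = π`,
`Πε = -εΠ`. Its `star` is the main involution
`a + bε + cΠ + dΠε ↦ a - bε - cΠ - dΠε`; note `Πε = -εΠ`, so that the coordinate `imK` of the
element `a + bε + cΠ + dΠε` is `-d`. -/
abbrev D : Type _ := ℍ[k, P.u, 0, P.π]

/-- The maximal order `𝒪 = 𝔬 + 𝔬ε + 𝔬Π + 𝔬Πε` of `D`. -/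
def maxOrder : Subring P.D where
  carrier := {x | x.re ∈ integers k ∧ x.imI ∈ integers k ∧ x.imJ ∈ integers k ∧
    x.imK ∈ integers k}
  mul_mem' := by
    have hu : P.u ∈ integers k := mem_integers.2 P.norm_u.le
    have hp : P.π ∈ integers k := mem_integers.2 P.norm_π_lt_one.le
    rintro x y ⟨hx1, hx2, hx3, hx4⟩ ⟨hy1, hy2, hy3, hy4⟩
    have key := fun {a b c d : k} (ha : a ∈ integers k) (hb : b ∈ integers k)
      (hc : c ∈ integers k) (hd : d ∈ integers k) =>
        (integers k).add_mem _ _ ((integers k).add_mem _ _ ha hb)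
          ((integers k).add_mem _ _ hc hd)
    have m := fun {a b : k} (ha : a ∈ integers k) (hb : b ∈ integers k) =>
        (integers k).mul_mem _ _ ha hb
    have ng := fun {a : k} (ha : a ∈ integers k) => (integers k).neg_mem _ ha
    refine ⟨?_, ?_, ?_, ?_⟩
    · convert key (m hx1 hy1) (m hu (m hx2 hy2)) (m hp (m hx3 hy3))
        (ng (m hu (m hp (m hx4 hy4)))) using 1
      simp [QuaternionAlgebra.re_mul]; ring
    · convert key (m hx1 hy2) (m hx2 hy1) (ng (m hp (m hx3 hy4)))
        (m hp (m hx4 hy3)) using 1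
      simp [QuaternionAlgebra.imI_mul]; ring
    · convert key (m hx1 hy3) (m hu (m hx2 hy4)) (m hx3 hy1)
        (ng (m hu (m hx4 hy2))) using 1
      simp [QuaternionAlgebra.imJ_mul]; ring
    · convert key (m hx1 hy4) (m hx2 hy3) (ng (m hx3 hy2)) (m hx4 hy1) using 1
      simp [QuaternionAlgebra.imK_mul]; ring
  one_mem' := by
    refine ⟨?_, ?_, ?_, ?_⟩ <;> simp [(integers k).one_mem, (integers k).zero_mem]
  add_mem' := by
    rintro x y ⟨hx1, hx2, hx3, hx4⟩ ⟨hy1, hy2, hy3, hy4⟩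
    exact ⟨(integers k).add_mem _ _ hx1 hy1, (integers k).add_mem _ _ hx2 hy2,
      (integers k).add_mem _ _ hx3 hy3, (integers k).add_mem _ _ hx4 hy4⟩
  zero_mem' := by
    refine ⟨?_, ?_, ?_, ?_⟩ <;> simp [(integers k).zero_mem]
  neg_mem' := by
    rintro x ⟨hx1, hx2, hx3, hx4⟩
    exact ⟨(integers k).neg_mem _ hx1, (integers k).neg_mem _ hx2,
      (integers k).neg_mem _ hx3, (integers k).neg_mem _ hx4⟩

/-- `D` carries the topology of `k⁴`. -/
instance : TopologicalSpace P.D :=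
  TopologicalSpace.induced (QuaternionAlgebra.equivTuple P.u 0 P.π) inferInstance

/-- The coordinates, as a homeomorphism `D ≃ k⁴`. -/
def coordHomeo : P.D ≃ₜ (Fin 4 → k) :=
  (QuaternionAlgebra.equivTuple P.u 0 P.π).toHomeomorphOfIsInducing ⟨rfl⟩

theorem continuous_re : Continuous fun x : P.D => x.re :=
  (continuous_apply 0).comp P.coordHomeo.continuous

theorem continuous_imI : Continuous fun x : P.D => x.imI :=
  (continuous_apply 1).comp P.coordHomeo.continuous

theorem continuous_imJ : Continuous fun x : P.D => x.imJ :=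
  (continuous_apply 2).comp P.coordHomeo.continuous

theorem continuous_imK : Continuous fun x : P.D => x.imK :=
  (continuous_apply 3).comp P.coordHomeo.continuous

theorem continuous_D_iff {T : Type*} [TopologicalSpace T] {f : T → P.D} :
    Continuous f ↔ Continuous (fun t => (f t).re) ∧ Continuous (fun t => (f t).imI) ∧
      Continuous (fun t => (f t).imJ) ∧ Continuous (fun t => (f t).imK) := by
  constructor
  · intro h
    exact ⟨P.continuous_re.comp h, P.continuous_imI.comp h, P.continuous_imJ.comp h,
      P.continuous_imK.comp h⟩
  · rintro ⟨h0, h1, h2, h3⟩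
    rw [← P.coordHomeo.comp_continuous_iff, continuous_pi_iff]
    intro i
    fin_cases i
    exacts [h0, h1, h2, h3]

instance : T2Space P.D := P.coordHomeo.symm.t2Space

instance [LocallyCompactSpace k] : LocallyCompactSpace P.D :=
  P.coordHomeo.isClosedEmbedding.locallyCompactSpace

instance : IsTopologicalRing P.D where
  continuous_add := by
    have h0 := P.continuous_re
    have h1 := P.continuous_imI
    have h2 := P.continuous_imJ
    have h3 := P.continuous_imK
    rw [continuous_D_iff]
    simp only [QuaternionAlgebra.re_add, QuaternionAlgebra.imI_add, QuaternionAlgebra.imJ_add,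
      QuaternionAlgebra.imK_add]
    refine ⟨?_, ?_, ?_, ?_⟩ <;> fun_prop
  continuous_mul := by
    have h0 := P.continuous_re
    have h1 := P.continuous_imI
    have h2 := P.continuous_imJ
    have h3 := P.continuous_imK
    rw [continuous_D_iff]
    simp only [QuaternionAlgebra.re_mul, QuaternionAlgebra.imI_mul, QuaternionAlgebra.imJ_mul,
      QuaternionAlgebra.imK_mul]
    refine ⟨?_, ?_, ?_, ?_⟩ <;> fun_prop
  continuous_neg := by
    have h0 := P.continuous_re
    have h1 := P.continuous_imI
    have h2 := P.continuous_imJ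
    have h3 := P.continuous_imK
    rw [continuous_D_iff]
    simp only [QuaternionAlgebra.re_neg, QuaternionAlgebra.imI_neg, QuaternionAlgebra.imJ_neg,
      QuaternionAlgebra.imK_neg]
    refine ⟨?_, ?_, ?_, ?_⟩ <;> fun_prop

/-! ### Reduced norm -/

/-- The unramified quadratic extension `k' = k(ε)`, `ε² = u`, as the algebra of pairs
`x.re + x.im * ε`. -/
abbrev K' : Type _ := QuadraticAlgebra k P.u 0

/-- The inclusion `φ : D → M₂(k')`, `φ(α) = !![a + bε, (c - dε)π; c + dε, a - bε]` for
`α = a + bε + cΠ + dΠε`. -/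
def phi (α : P.D) : Matrix (Fin 2) (Fin 2) P.K' :=
  let a := α.re
  let b := α.imI
  let c := α.imJ
  let d := -α.imK
  !![⟨a, b⟩, ⟨c * P.π, -d * P.π⟩; ⟨c, d⟩, ⟨a, -b⟩]

/-- The inclusion `φₙ : Mₙ(D) → M₂ₙ(k')`, applying `φ` to each entry. -/
def phiMatrix {m : ℕ} (A : Matrix (Fin m) (Fin m) P.D) :
    Matrix (Fin m × Fin 2) (Fin m × Fin 2) P.K' :=
  Matrix.of fun i j => P.phi (A i.1 j.1) i.2 j.2

/-- The reduced norm `N_rd(A) = det(φₙ(A))` of `A ∈ Mₙ(D)`. The determinant lies in `k`, i.e. it is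
equal to its `re`-coordinate. -/
def nrd {m : ℕ} (A : Matrix (Fin m) (Fin m) P.D) : k := (P.phiMatrix A).det.re

/-- The upper left `(i+1) × (i+1)`-block of a matrix (`i` is counted from `0`). -/
def block {n : ℕ} (A : Matrix (Fin n) (Fin n) P.D) (i : Fin n) :
    Matrix (Fin (i.val + 1)) (Fin (i.val + 1)) P.D :=
  A.submatrix (Fin.castLE i.isLt) (Fin.castLE i.isLt)

/-! ### The groups `G`, `K`, `B` and the space `X` -/

variable (n : ℕ)

/-- `G = GLₙ(D)`. -/
abbrev G : Type _ := (Matrix (Fin n) (Fin n) P.D)ˣ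

instance : MeasurableSpace (P.G n) := borel _

instance : BorelSpace (P.G n) := ⟨rfl⟩

/-- `K = GLₙ(𝒪)`. -/
def K : Subgroup (P.G n) where
  carrier := {g | (∀ i j, (g : Matrix (Fin n) (Fin n) P.D) i j ∈ P.maxOrder) ∧
    ∀ i j, ((g⁻¹ : P.G n) : Matrix (Fin n) (Fin n) P.D) i j ∈ P.maxOrder}
  mul_mem' := by
    rintro g h ⟨hg, hg'⟩ ⟨hh, hh'⟩
    refine ⟨fun i j => ?_, fun i j => ?_⟩
    · rw [Units.val_mul, Matrix.mul_apply]
      exact P.maxOrder.sum_mem fun l _ => P.maxOrder.mul_mem (hg i l) (hh l j)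
    · rw [mul_inv_rev, Units.val_mul, Matrix.mul_apply]
      exact P.maxOrder.sum_mem fun l _ => P.maxOrder.mul_mem (hh' i l) (hg' l j)
  one_mem' := by
    have h : ∀ i j, (1 : Matrix (Fin n) (Fin n) P.D) i j ∈ P.maxOrder := by
      intro i j
      rw [Matrix.one_apply]
      split_ifs
      exacts [P.maxOrder.one_mem, P.maxOrder.zero_mem]
    exact ⟨fun i j => by simpa using h i j, fun i j => by simpa using h i j⟩
  inv_mem' := by
    rintro g ⟨hg, hg'⟩
    exact ⟨hg', fun i j => by simpa using hg i j⟩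

/-- The `k`-space of lower triangular matrices. -/
def lowerTri : Submodule k (Matrix (Fin n) (Fin n) P.D) where
  carrier := {A | ∀ i j, i < j → A i j = 0}
  add_mem' := fun {A B} hA hB i j h => by simp [hA i j h, hB i j h]
  zero_mem' := fun i j _ => rfl
  smul_mem' := fun c A hA i j h => by simp [hA i j h]

variable {n} in
theorem lowerTri_mul {A C : Matrix (Fin n) (Fin n) P.D} (hA : A ∈ P.lowerTri n)
    (hC : C ∈ P.lowerTri n) : A * C ∈ P.lowerTri n := by
  intro i j h
  rw [Matrix.mul_apply]
  refine Finset.sum_eq_zero fun l _ => ?_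
  rcases lt_or_ge i l with hl | hl
  · rw [hA i l hl, zero_mul]
  · rw [hC l j (lt_of_le_of_lt hl h), mul_zero]

variable {n} in
theorem lowerTri_inv {g : P.G n} (hg : (g : Matrix (Fin n) (Fin n) P.D) ∈ P.lowerTri n) :
    ((g⁻¹ : P.G n) : Matrix (Fin n) (Fin n) P.D) ∈ P.lowerTri n := by
  have : Module.Finite k (Matrix (Fin n) (Fin n) P.D) := Module.Finite.matrix
  exact inv_mem_of_finite (P.lowerTri n) (fun i j h => Matrix.one_apply_ne h.ne)
    (fun A C hA hC => P.lowerTri_mul hA hC) g hg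

/-- The Borel subgroup `B` of lower triangular matrices in `G`. -/
def B : Subgroup (P.G n) where
  carrier := {g | ∀ i j, i < j → (g : Matrix (Fin n) (Fin n) P.D) i j = 0}
  mul_mem' := fun hg hh => P.lowerTri_mul hg hh
  one_mem' := fun _ _ h => Matrix.one_apply_ne h.ne
  inv_mem' := fun hg => P.lowerTri_inv hg

theorem isClosed_B : IsClosed (P.B n : Set (P.G n)) := by
  have h : (P.B n : Set (P.G n)) = ⋂ i, ⋂ j, ⋂ _ : i < j,
      {g : P.G n | (g : Matrix (Fin n) (Fin n) P.D) i j = 0} := by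
    ext g
    simp only [Set.mem_iInter, Set.mem_ofPred_eq]
    exact Iff.rfl
  rw [h]
  refine isClosed_iInter fun i => isClosed_iInter fun j => isClosed_iInter fun _ => ?_
  exact isClosed_eq (Units.continuous_val.matrix_elem i j) continuous_const

instance [LocallyCompactSpace k] : LocallyCompactSpace (P.G n) :=
  haveI : LocallyCompactSpace (Matrix (Fin n) (Fin n) P.D) :=
    inferInstanceAs (LocallyCompactSpace (Fin n → Fin n → P.D))
  inferInstance

instance [LocallyCompactSpace k] : LocallyCompactSpace (P.B n) :=
  (P.isClosed_B n).isClosedEmbedding_subtypeVal.locallyCompactSpace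

/-- The space `X = {A ∈ G | A* = A}` of quaternion hermitian forms of size `n`
(`star` is the conjugate transpose). -/
abbrev X : Type _ := {x : P.G n // star x = x}

/-- The action `g · A = g A g*` of `G` on `X`. -/
instance : MulAction (P.G n) (P.X n) where
  smul g x := ⟨g * x.1 * star g, by simp [x.2, mul_assoc]⟩
  one_smul x := Subtype.ext (by
    change 1 * x.1 * star 1 = x.1
    simp)
  mul_smul g h x := Subtype.ext (by
    change (g * h) * x.1 * star (g * h) = g * (h * x.1 * star h) * star g
    simp [mul_assoc])

/-- The inverse of a hermitian form, which is again in `X`. -/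
instance : Inv (P.X n) where
  inv x := ⟨x.1⁻¹, by rw [star_inv, x.2]⟩

variable {n}

/-- The matrix of a form `x ∈ X`. -/
def toMatrix (x : P.X n) : Matrix (Fin n) (Fin n) P.D := ((x : P.G n) : Matrix _ _ P.D)

/-! ### Representatives of the `K`-orbits -/

end QuatData

/-- The index set `Λₙ`: decreasing sequences of integers in which every odd entry occurs an even
number of times. -/
def Lam (n : ℕ) : Set (Fin n → ℤ) :=
  {α | Antitone α ∧ ∀ i, Odd (α i) → Even (Finset.univ.filter fun j => α j = α i).card}

/-- The number of entries equal to `αᵢ` which precede the `i`-th one. -/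
def rankBefore {n : ℕ} (α : Fin n → ℤ) (i : Fin n) : ℕ :=
  (Finset.univ.filter fun l => l < i ∧ α l = α i).card

theorem rankBefore_succ {n : ℕ} {α : Fin n → ℤ} {i j : Fin n} (hij : j.val = i.val + 1)
    (h : α j = α i) : rankBefore α j = rankBefore α i + 1 := by
  unfold rankBefore
  rw [← Finset.card_insert_of_notMem
    (s := Finset.univ.filter fun l => l < i ∧ α l = α i) (a := i) (by simp)]
  congr 1
  ext l
  simp only [Finset.mem_filter, Finset.mem_univ, true_and, Finset.mem_insert, h, Fin.lt_def]
  constructor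
  · rintro ⟨h1, h2⟩
    rcases Nat.lt_or_ge l.val i.val with h3 | h3
    · exact Or.inr ⟨h3, h2⟩
    · exact Or.inl (Fin.ext (by omega))
  · rintro (rfl | ⟨h1, h2⟩)
    · exact ⟨by omega, rfl⟩
    · exact ⟨by omega, h2⟩

theorem exists_next {n : ℕ} {α : Fin n → ℤ} (hα : α ∈ Lam n) {i : Fin n} (ho : ¬ Even (α i))
    (hr : Even (rankBefore α i)) : ∃ j : Fin n, j.val = i.val + 1 ∧ α j = α i := by
  have hc := hα.2 i (Int.not_even_iff_odd.1 ho)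
  by_cases hex : ∃ l, i < l ∧ α l = α i
  · obtain ⟨l, hl, hle⟩ := hex
    have hlt : i.val + 1 < n := lt_of_le_of_lt (Fin.lt_def.1 hl) l.isLt
    refine ⟨⟨i.val + 1, hlt⟩, rfl, le_antisymm (hα.1 (Fin.le_def.2 (Nat.le_succ _))) ?_⟩
    rw [← hle]
    exact hα.1 (Fin.le_def.2 (Fin.lt_def.1 hl))
  · exfalso
    have : (Finset.univ.filter fun j => α j = α i) =
        insert i (Finset.univ.filter fun l => l < i ∧ α l = α i) := by
      ext l
      simp only [Finset.mem_filter, Finset.mem_univ, true_and, Finset.mem_insert]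
      constructor
      · intro h
        rcases lt_trichotomy l i with h1 | h1 | h1
        · exact Or.inr ⟨h1, h⟩
        · exact Or.inl h1
        · exact absurd ⟨l, h1, h⟩ hex
      · rintro (rfl | h)
        · rfl
        · exact h.2
    rw [this, Finset.card_insert_of_notMem (by simp)] at hc
    exact (Nat.even_add_one.1 hc) hr

theorem exists_prev {n : ℕ} {α : Fin n → ℤ} (hα : α ∈ Lam n) {i : Fin n}
    (hr : ¬ Even (rankBefore α i)) : ∃ j : Fin n, i.val = j.val + 1 ∧ α i = α j := by
  have hne : (Finset.univ.filter fun l => l < i ∧ α l = α i).Nonempty := by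
    rw [← Finset.card_pos]
    rcases Nat.eq_zero_or_pos (rankBefore α i) with h | h
    · exact absurd (h ▸ Even.zero) hr
    · exact h
  obtain ⟨l, hl⟩ := hne
  simp only [Finset.mem_filter, Finset.mem_univ, true_and] at hl
  have hli : l.val < i.val := hl.1
  have hlt : i.val - 1 < n := by omega
  refine ⟨⟨i.val - 1, hlt⟩, by simp only; omega,
    le_antisymm (hα.1 (Fin.le_def.2 (Nat.sub_le _ _))) ?_⟩
  rw [← hl.2]
  exact hα.1 (Fin.le_def.2 (by simp only; omega))

namespace QuatData

variable {k : Type*} [NontriviallyNormedField k] [IsUltrametricDist k] (P : QuatData k) {n : ℕ}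

/-- The element `π^e Π` of `D`. -/
def piPrime (e : ℤ) : P.D := ⟨0, 0, P.π ^ e, 0⟩

/-- The element `π^e` of `D`. -/
def piCoe (e : ℤ) : P.D := ⟨P.π ^ e, 0, 0, 0⟩

/-- The matrix `π^α`, `α ∈ Λₙ`: the orthogonal sum of the `1 × 1`-blocks `π^e` for the even entries
`2e` of `α`, and of the `2 × 2`-blocks `!![0, π^e Π; -π^e Π, 0]` for the successive pairs of odd
entries `2e + 1, 2e + 1` of `α`, in the order of the entries. -/
def piMatrix (α : Fin n → ℤ) : Matrix (Fin n) (Fin n) P.D :=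
  Matrix.of fun i j =>
    if Even (α i) then (if j = i then P.piCoe (α i / 2) else 0)
    else if Even (rankBefore α i) then (if j.val = i.val + 1 then P.piPrime (α i / 2) else 0)
    else (if i.val = j.val + 1 then -P.piPrime (α i / 2) else 0)

theorem piMatrix_row {α : Fin n → ℤ} (hα : α ∈ Lam n) (i : Fin n) :
    ∃ (t : Fin n) (c : P.D) (z : k), z ≠ 0 ∧ c * star c = algebraMap k P.D z ∧
      (∀ j, P.piMatrix α i j = if j = t then c else 0) ∧
      (∀ j, P.piMatrix α t j = if j = i then star c else 0) := by
  by_cases he : Even (α i)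
  · refine ⟨i, P.piCoe (α i / 2), P.π ^ (α i / 2) * P.π ^ (α i / 2),
      mul_ne_zero (zpow_ne_zero _ P.π_ne_zero) (zpow_ne_zero _ P.π_ne_zero), ?_, ?_, ?_⟩
    · ext <;> simp [piCoe, QuaternionAlgebra.algebraMap_eq]
    · intro j
      simp [piMatrix, he]
    · intro j
      have : star (P.piCoe (α i / 2)) = P.piCoe (α i / 2) := by ext <;> simp [piCoe]
      simp [piMatrix, he, this]
  have hz : -(P.π * (P.π ^ (α i / 2) * P.π ^ (α i / 2))) ≠ 0 := neg_ne_zero.2 <|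
    mul_ne_zero P.π_ne_zero
      (mul_ne_zero (zpow_ne_zero _ P.π_ne_zero) (zpow_ne_zero _ P.π_ne_zero))
  have hs : star (P.piPrime (α i / 2)) = -P.piPrime (α i / 2) := by ext <;> simp [piPrime]
  have hm : P.piPrime (α i / 2) * -P.piPrime (α i / 2) =
      algebraMap k P.D (-(P.π * (P.π ^ (α i / 2) * P.π ^ (α i / 2)))) := by
    ext <;> simp [piPrime, QuaternionAlgebra.algebraMap_eq]
    ring
  by_cases hr : Even (rankBefore α i)
  · obtain ⟨t, ht, hα'⟩ := exists_next hα he hr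
    have hr' : ¬ Even (rankBefore α t) := by
      rw [rankBefore_succ ht hα', Nat.even_add_one]
      exact fun h => h hr
    refine ⟨t, P.piPrime (α i / 2), _, hz, by rw [hs, hm], fun j => ?_, fun j => ?_⟩
    · simp [piMatrix, he, hr, Fin.ext_iff, ht]
    · simp only [piMatrix, Matrix.of_apply, hα', he, hr', if_false, hs, Fin.ext_iff, ht,
        Nat.add_right_cancel_iff, eq_comm]
  · obtain ⟨t, ht, hα'⟩ := exists_prev hα hr
    have hr' : Even (rankBefore α t) := by
      rw [rankBefore_succ ht hα', Nat.even_add_one, not_not] at hr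
      exact hr
    refine ⟨t, -P.piPrime (α i / 2), _, hz, by rw [star_neg, hs, neg_neg, ← hm]; simp,
      fun j => ?_, fun j => ?_⟩
    · simp only [piMatrix, Matrix.of_apply, he, hr, if_false, Fin.ext_iff, ht,
        Nat.add_right_cancel_iff, eq_comm]
    · rw [star_neg, hs, neg_neg]
      simp only [piMatrix, Matrix.of_apply, ← hα', he, hr', if_false, if_true, Fin.ext_iff, ht]

theorem star_piMatrix {α : Fin n → ℤ} (hα : α ∈ Lam n) :
    star (P.piMatrix α) = P.piMatrix α := by
  ext1 i j
  rw [Matrix.star_apply]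
  obtain ⟨t, c, z, -, -, h1, h2⟩ := P.piMatrix_row hα j
  by_cases hi : i = t
  · rw [h1, if_pos hi, hi, h2, if_pos rfl]
  · rw [h1, if_neg hi, star_zero]
    obtain ⟨t', c', z', -, -, h1', h2'⟩ := P.piMatrix_row hα i
    rw [h1']
    split_ifs with hj
    · have h3 := h2' i
      rw [if_pos rfl, ← hj, h1, if_neg hi] at h3
      rw [← star_star c', ← h3, star_zero]
    · rfl

theorem isUnit_piMatrix {α : Fin n → ℤ} (hα : α ∈ Lam n) : IsUnit (P.piMatrix α) := by
  choose t c z hz hc h1 h2 using P.piMatrix_row hα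
  have hsq : P.piMatrix α * P.piMatrix α = Matrix.diagonal fun i => algebraMap k P.D (z i) := by
    ext1 i j
    rw [Matrix.mul_apply, Finset.sum_eq_single (t i), h1, if_pos rfl, h2, Matrix.diagonal_apply]
    · by_cases hij : j = i
      · rw [if_pos hij, if_pos hij.symm, hc]
      · rw [if_neg hij, if_neg (Ne.symm hij), mul_zero]
    · intro l _ hl
      rw [h1, if_neg hl, zero_mul]
    · intro h
      exact absurd (Finset.mem_univ _) h
  have hr : P.piMatrix α * (P.piMatrix α * Matrix.diagonal fun i => algebraMap k P.D (z i)⁻¹) =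
      1 := by
    rw [← mul_assoc, hsq, Matrix.diagonal_mul_diagonal, ← Matrix.diagonal_one]
    congr 1
    ext1 i
    rw [← map_mul, mul_inv_cancel₀ (hz i), map_one]
  have hl : (Matrix.diagonal (fun i => algebraMap k P.D (z i)⁻¹) * P.piMatrix α) *
      P.piMatrix α = 1 := by
    rw [mul_assoc, hsq, Matrix.diagonal_mul_diagonal, ← Matrix.diagonal_one]
    congr 1
    ext1 i
    rw [← map_mul, inv_mul_cancel₀ (hz i), map_one]
  refine ⟨⟨P.piMatrix α, _, hr, ?_⟩, rfl⟩
  rw [← left_inv_eq_right_inv hl hr, hl]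

/-- The hermitian form `π^α ∈ X`, `α ∈ Λₙ`. -/
def piX (α : Lam n) : P.X n :=
  ⟨(P.isUnit_piMatrix α.2).unit, Units.ext (by
    rw [Units.coe_star, IsUnit.unit_spec, P.star_piMatrix α.2])⟩

/-! ### Relative invariants and spherical functions -/

/-- The `k`-rational character `ψᵢ(p) = N_rd(p⁽ⁱ⁾)`. -/
def psi (i : Fin n) (p : P.B n) : k :=
  P.nrd (P.block ((p : P.G n) : Matrix (Fin n) (Fin n) P.D) i)

open Classical in
/-- The relative invariant `dᵢ(x) ∈ k`, `dᵢ(x)² = N_rd(x⁽ⁱ⁾)` (well-defined up to sign). -/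
def d (i : Fin n) (x : P.X n) : k :=
  if h : ∃ a : k, a ^ 2 = P.nrd (P.block (P.toMatrix x) i) then h.choose else 0

open Classical in
/-- `|𝐝(x)|^s = ∏ᵢ |dᵢ(x)|^{sᵢ}` if all `dᵢ(x) ≠ 0`, and `0` otherwise. -/
def absd (s : Fin n → ℂ) (x : P.X n) : ℂ :=
  if ∀ i, P.d i x ≠ 0 then ∏ i, ((‖P.d i x‖ : ℝ) : ℂ) ^ s i else 0

end QuatData

/-- The region `Re(sᵢ) ≥ 0`, `1 ≤ i ≤ n - 1` (indices start at `0` here; the last one is free). -/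
def region (n : ℕ) : Set (Fin n → ℂ) := {s | ∀ i : Fin n, i.val + 1 < n → 0 ≤ (s i).re}

/-- The field `ℂ(q^{s₁}, …, q^{sₙ})` of rational functions in `n` variables, the `i`-th variable
standing for `q^{sᵢ}`. -/
abbrev RatField (n : ℕ) : Type := FractionRing (MvPolynomial (Fin n) ℂ)

/-- The rational function `R` in `q^{s₁}, …, q^{sₙ}` agrees with the function `Φ(s)` for
`s ∈ S`. -/
def Represents {n : ℕ} (q : ℕ) (S : Set (Fin n → ℂ)) (Φ : (Fin n → ℂ) → ℂ) (R : RatField n) :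
    Prop :=
  ∃ N M : MvPolynomial (Fin n) ℂ, M ≠ 0 ∧
    R = algebraMap _ (RatField n) N / algebraMap _ (RatField n) M ∧
    ∀ s ∈ S, MvPolynomial.eval (fun i => (q : ℂ) ^ s i) M * Φ s =
      MvPolynomial.eval (fun i => (q : ℂ) ^ s i) N

/-- A rational function is determined by its values on any set containing the region. -/
theorem Represents.unique {n q : ℕ} (hq : 2 ≤ q) {S : Set (Fin n → ℂ)} (hS : region n ⊆ S)
    {Φ : (Fin n → ℂ) → ℂ} {R R' : RatField n} (h : Represents q S Φ R)
    (h' : Represents q S Φ R') : R = R' := by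
  obtain ⟨N, M, hM, rfl, h⟩ := h
  obtain ⟨N', M', hM', rfl, h'⟩ := h'
  rw [div_eq_div_iff (by simpa using hM) (by simpa using hM'), ← map_mul, ← map_mul]
  congr 1
  refine MvPolynomial.funext_set (fun _ => Set.range fun m : ℕ => (q : ℂ) ^ m)
    (fun _ => Set.infinite_range_of_injective ?_) ?_
  · intro a b hab
    have hab' : (q : ℂ) ^ a = (q : ℂ) ^ b := hab
    exact Nat.pow_right_injective hq (by exact_mod_cast hab')
  · intro x hx
    choose m hm using fun i => hx i trivial
    have hx' : x = fun i => (q : ℂ) ^ ((m i : ℕ) : ℂ) := by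
      ext i
      rw [Complex.cpow_natCast]
      exact (hm i).symm
    have hs : (fun i => ((m i : ℕ) : ℂ)) ∈ S := hS (fun i _ => by simp)
    have e1 := h _ hs
    have e2 := h' _ hs
    rw [← hx'] at e1 e2
    simp only [map_mul, ← e1, ← e2]
    ring

open Classical in
/-- The rational function in `q^{s₁}, …, q^{sₙ}` which continues the function `Φ` given on `S`. -/
def continuation {n : ℕ} (q : ℕ) (S : Set (Fin n → ℂ)) (Φ : (Fin n → ℂ) → ℂ) : RatField n :=
  if h : ∃ R, Represents q S Φ R then h.choose else 0

namespace QuatData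

variable {k : Type*} [NontriviallyNormedField k] [IsUltrametricDist k] (P : QuatData k) {n : ℕ}

/-- The integral `∫_K |𝐝(κ·x)|^s dκ`. -/
def omegaInt (dk : Measure (P.K n)) (x : P.X n) (s : Fin n → ℂ) : ℂ :=
  ∫ κ : P.K n, P.absd s ((κ : P.G n) • x) ∂dk

/-- The spherical function `ω(x; s)`, as an element of `ℂ(q^{s₁}, …, q^{sₙ})`. -/
def omega (dk : Measure (P.K n)) (x : P.X n) : RatField n :=
  continuation (q k) (region n) (P.omegaInt dk x)

/-! ### Hecke algebra, Schwartz space and Fourier transform -/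

/-- The (underlying space of the) Hecke algebra `ℋ(G, K)`: the compactly supported
`K`-bi-invariant functions on `G`. -/
def hecke (n : ℕ) : Submodule ℂ (P.G n → ℂ) where
  carrier := {f | (∀ κ ∈ P.K n, ∀ κ' ∈ P.K n, ∀ g, f (κ * g * κ') = f g) ∧ HasCompactSupport f}
  add_mem' := fun ha hb => ⟨fun κ hκ κ' hκ' g => by
    simp [ha.1 κ hκ κ' hκ' g, hb.1 κ hκ κ' hκ' g], ha.2.add hb.2⟩
  zero_mem' := ⟨fun _ _ _ _ _ => rfl, HasCompactSupport.zero⟩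
  smul_mem' := fun c f hf => ⟨fun κ hκ κ' hκ' g => by simp [hf.1 κ hκ κ' hκ' g],
    hf.2.comp_left (g := fun z => c * z) (by simp)⟩

/-- The Schwartz space `𝒮(K\X)`: the left `K`-invariant compactly supported functions on `X`. -/
def schwartz (n : ℕ) : Submodule ℂ (P.X n → ℂ) where
  carrier := {φ | (∀ κ ∈ P.K n, ∀ x, φ (κ • x) = φ x) ∧ HasCompactSupport φ}
  add_mem' := fun ha hb => ⟨fun κ hκ x => by simp [ha.1 κ hκ x, hb.1 κ hκ x], ha.2.add hb.2⟩
  zero_mem' := ⟨fun _ _ _ => rfl, HasCompactSupport.zero⟩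
  smul_mem' := fun c f hf => ⟨fun κ hκ x => by simp [hf.1 κ hκ x],
    hf.2.comp_left (g := fun z => c * z) (by simp)⟩

/-- The action `(f * Ψ)(x) = ∫_G f(g) Ψ(g⁻¹·x) dg`. -/
def heckeAct (dg : Measure (P.G n)) (f : P.G n → ℂ) (Ψ : P.X n → ℂ) (x : P.X n) : ℂ :=
  ∫ g : P.G n, f g * Ψ (g⁻¹ • x) ∂dg

/-- The integrand `f(p) ∏ᵢ |ψᵢ(p)|^{-sᵢ} δ(p)` on `B`, where `δ` is the modulus character of `B`,
with `d(p p') = δ(p')⁻¹ dp` for the left invariant measure `dp` on `B`. -/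
def lamIntegrand [LocallyCompactSpace k] (f : P.G n → ℂ) (s : Fin n → ℂ) (p : P.B n) : ℂ :=
  f p * (∏ i, ((‖P.psi i p‖ : ℝ) : ℂ) ^ (-s i)) *
    (((Measure.modularCharacter p : NNReal) : ℝ) : ℂ)

/-- `λ_s(f) = ∫_B f(p) ∏ᵢ |ψᵢ(p)|^{-sᵢ} δ(p) dp`, for given `s`. -/
def lamInt [LocallyCompactSpace k] (dp : Measure (P.B n)) (f : P.G n → ℂ) (s : Fin n → ℂ) : ℂ :=
  ∫ p : P.B n, P.lamIntegrand f s p ∂dp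

/-- `λ_s(f)` as an element of `ℂ(q^{s₁}, …, q^{sₙ})`. -/
def lam [LocallyCompactSpace k] (dp : Measure (P.B n)) (f : P.G n → ℂ) : RatField n :=
  continuation (q k) Set.univ (P.lamInt dp f)

/-- The integral `∫_X φ(x) ω(x⁻¹; s) dx`, for `s` in the region of convergence of `ω`. -/
def fourierInt (dk : Measure (P.K n)) (dx : Measure (P.X n)) (φ : P.X n → ℂ)
    (s : Fin n → ℂ) : ℂ :=
  ∫ x : P.X n, φ x * P.omegaInt dk x⁻¹ s ∂dx

/-- The spherical Fourier transform
`F₀(φ) = ∫_X φ(x) ω(x⁻¹; s) dx ∈ ℂ(q^{s₁}, …, q^{sₙ})`. -/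
def F0 (dk : Measure (P.K n)) (dx : Measure (P.X n)) (φ : P.X n → ℂ) : RatField n :=
  continuation (q k) (region n) (P.fourierInt dk dx φ)

end QuatData

end QHerm

end

/-!
The proof rests on the orbits of the lower triangular group `B` and of `K` on the space `X` of
nondegenerate Hermitian forms.

*Geometry.* Elimination with pivots chosen from the upper left corner shows that every `B`-orbit in
`X` contains the permutation matrix of an involution (`exists_B_smul_eq_permX`); hence there are
finitely many `B`-orbits, and `G` acts transitively (`exists_smul_one_eq`). Over `𝒪` the pivot is
chosen to be an entry of maximal absolute value, and elimination gives the Iwasawa decomposition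
(`exists_K_mul_mem_B`), the Cartan decomposition, and the fact that every `K`-orbit in `X` contains
one of the forms `π^α` (`exists_K_smul_eq_piX`).

*Rationality.* Up to the volume of the orbit, `ω(x; s)` is the zeta integral `∫ Φ(y) |𝐝(y)|^s dy` of
the characteristic function `Φ` of the `K`-orbit of `x` (`measure_mul_omegaInt`). All zeta integrals
of locally constant functions of compact support are rational in `q^s` (`hasRatZeta`), for the
following reason, which replaces resolution of singularities. Consider the bad set, which consists
of the points without a neighbourhood on whose test functions rationality holds; it is closed and
`B`-stable, and by compactness only the restriction of a test function to it matters. It contains no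
form with all `dᵢ ≠ 0`, since `|𝐝|^s` is locally constant there. If it were nonempty, then, as there
are only finitely many `B`-orbits, the Baire property would give a `B`-orbit which is open in it.
The form `z` on this orbit has some `dᵢ(z) = 0`, and the stabilizer of `z` in `B` contains an
element `h` for which the numbers `|ψᵢ(h)|` are powers of `q` that are not all `1`
(`exists_stabilizer`). Translation by `h` fixes `z` and, up to functions which vanish on the bad
set, multiplies the zeta integral near `z` by a nonzero constant; by the equivariance of `𝐝` it also
multiplies it by a nontrivial monomial in `q^s`. Hence the zeta integral is the quotient of a
rational function by a nonzero polynomial (`hasRatZeta_of_isOrbitFun`), and the bad set is empty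
(`badSet_eq_empty`).

*The Hecke algebra.* A bi-`K`-invariant function satisfies `f(g*) = f(g)` (`hecke_star`). By the
Iwasawa decomposition, `f * φ` and `λ_s(f)` become sums over the same finite set of cosets of
`B ∩ K` in `B` (`integral_hecke`, `integral_lamIntegrand`), and the substitution `x ↦ r* · x`, with
`(r* · x)⁻¹ = r⁻¹ · x⁻¹`, produces the factor `λ_s(f)` term by term (`fourierInt_heckeAct`). The identity
holds on the region of convergence, and a rational function of `q^s` is determined by its values
there.

*Linear independence.* On the `K`-orbit of `π^α`, the maximum of `|dᵢ|` is an explicit power of `q`.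
The upper bound comes from an estimate for the reduced norm of a product in terms of the row sizes
of one factor (`norm_nrd_mul_le`, `norm_d_smul_piX_le`), and the maxima are attained simultaneously
at one point (`exists_norm_d_smul_piX_eq`), hence on a set of positive measure. The exponents
determine `α` (`tailSum_injective`). Finitely many vectors of exponents are separated by a
functional with positive integral coefficients `N` (`exists_separating`), and for `s = m N`,
`m → ∞`, the functions `ω(π^α; s)` behave like geometric sequences with different ratios
(`exists_tendsto_omegaInt`, `eventually_sum_mul_zpow_pow_ne_zero`); this gives
`linearIndependent_omega`. As `F₀(φ)` is a combination of the functions `ω` with nonzero multiples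
of the values of `φ` on the `K`-orbits as coefficients, injectivity follows (`injOn_F0`); distinct
`K`-orbits contain distinct `π^α`.
-/

noncomputable section

set_option linter.unusedSectionVars false

namespace QHerm

namespace QuatData

variable {k : Type*} [NontriviallyNormedField k] [IsUltrametricDist k]

/-- The standing hypotheses on the base field: the residual characteristic is odd (`2` is a unit)
and the absolute value is the normalized one, `‖π‖ = q⁻¹`. -/
class IsOddLocal (P : QuatData k) : Prop where
  norm_two : ‖(2 : k)‖ = 1
  norm_pi : ‖P.π‖ = (q k : ℝ)⁻¹

/-! ### The base field -/

theorem norm_sub_le_max' (a b : k) : ‖a - b‖ ≤ max ‖a‖ ‖b‖ := by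
  rw [sub_eq_add_neg, ← norm_neg b]
  exact IsUltrametricDist.norm_add_le_max a (-b)

theorem norm_sub_eq_max' {a b : k} (h : ‖a‖ ≠ ‖b‖) : ‖a - b‖ = max ‖a‖ ‖b‖ := by
  rw [← norm_neg b] at h ⊢
  rw [sub_eq_add_neg]
  exact IsUltrametricDist.norm_add_eq_max_of_norm_ne_norm h

theorem norm_pi_pos (P : QuatData k) : 0 < ‖P.π‖ := norm_pos_iff.2 P.π_ne_zero

theorem norm_eq_zpow (P : QuatData k) {a : k} (ha : a ≠ 0) : ∃ m : ℤ, ‖a‖ = ‖P.π‖ ^ m := by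
  have hp := P.norm_pi_pos
  obtain ⟨m, hm1, hm2⟩ := exists_mem_Ico_zpow (norm_pos_iff.2 ha)
    ((one_lt_inv₀ hp).2 P.norm_π_lt_one)
  refine ⟨-m, ?_⟩
  rw [inv_zpow'] at hm1 hm2
  refine le_antisymm ?_ hm1
  -- otherwise `a π ^ (m + 1)` would have absolute value strictly between `‖π‖` and `1`
  have h1 : ‖a * P.π ^ (m + 1)‖ < 1 := by
    rw [norm_mul, norm_zpow]
    calc ‖a‖ * ‖P.π‖ ^ (m + 1) < ‖P.π‖ ^ (-(m + 1)) * ‖P.π‖ ^ (m + 1) := by gcongr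
      _ = 1 := by rw [← zpow_add₀ hp.ne']; simp
  have h2 := P.norm_le_norm_π _ h1
  rw [norm_mul, norm_zpow, zpow_add_one₀ hp.ne', ← mul_assoc] at h2
  have h3 : ‖a‖ * ‖P.π‖ ^ m ≤ 1 := by
    by_contra hc
    push Not at hc
    have := mul_lt_mul_of_pos_right hc hp
    linarith
  rw [zpow_neg, ← one_div, le_div_iff₀ (zpow_pos hp m)]
  exact h3

section Complete

variable [CompleteSpace k]

/-- The equation `t + b t² = c` with `b` integral and `c` in the maximal ideal is solved by
contraction. -/
theorem exists_quadratic_root {b c : k} (hb : ‖b‖ ≤ 1) (hc : ‖c‖ < 1) :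
    ∃ t, t + b * t ^ 2 = c ∧ ‖t‖ ≤ ‖c‖ := by
  let f : k → k := fun t => c - b * t ^ 2
  let s : Set k := Metric.closedBall 0 ‖c‖
  have hs : ∀ t, t ∈ s ↔ ‖t‖ ≤ ‖c‖ := fun t => by simp [s]
  have hmaps : Set.MapsTo f s s := by
    intro t ht
    rw [hs] at ht ⊢
    refine (norm_sub_le_max' _ _).trans (max_le le_rfl ?_)
    rw [norm_mul, norm_pow]
    calc ‖b‖ * ‖t‖ ^ 2 ≤ 1 * (‖c‖ * 1) := by
          rw [sq]
          gcongr
          exact ht.trans hc.le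
      _ = ‖c‖ := by ring
  have hcon : ContractingWith ‖c‖₊ (hmaps.restrict f s s) := by
    refine ⟨by exact_mod_cast hc, LipschitzWith.of_dist_le_mul ?_⟩
    rintro ⟨t, ht⟩ ⟨t', ht'⟩
    rw [hs] at ht ht'
    change dist (f t) (f t') ≤ ‖c‖ * dist t t'
    rw [dist_eq_norm, dist_eq_norm]
    have : f t - f t' = b * (t' + t) * (t' - t) := by simp only [f]; ring
    rw [this, norm_mul, norm_mul, norm_sub_rev t' t]
    gcongr
    calc ‖b‖ * ‖t' + t‖ ≤ 1 * ‖c‖ := by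
          gcongr
          exact (IsUltrametricDist.norm_add_le_max _ _).trans (max_le ht' ht)
      _ = ‖c‖ := one_mul _
  obtain ⟨t, ht, hfix, -⟩ := hcon.exists_fixedPoint' Metric.isClosed_closedBall.isComplete hmaps
    (x := 0) (by simp [s]) (edist_ne_top _ _)
  refine ⟨t, ?_, (hs t).1 ht⟩
  have : f t = t := hfix
  simp only [f] at this
  linear_combination -this

/-- Elements congruent to `1` modulo the maximal ideal are squares, as `2` is a unit. -/
theorem exists_sq_eq (P : QuatData k) [P.IsOddLocal] {a : k} (ha : ‖a - 1‖ < 1) :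
    ∃ b, b ^ 2 = a := by
  have h2 : ‖(2 : k)‖ = 1 := IsOddLocal.norm_two P
  have h20 : (2 : k) ≠ 0 := by
    intro h
    simp [h] at h2
  obtain ⟨t, ht, -⟩ := exists_quadratic_root (b := 2⁻¹) (c := (a - 1) / 2)
    (by rw [norm_inv, h2, inv_one]) (by rw [norm_div, h2, div_one]; exact ha)
  refine ⟨1 + t, ?_⟩
  field_simp at ht
  linear_combination ht

end Complete

theorem two_ne_zero' (P : QuatData k) [P.IsOddLocal] : (2 : k) ≠ 0 := by
  intro h
  have h2 : ‖(2 : k)‖ = 1 := IsOddLocal.norm_two P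
  simp [h] at h2

theorem two_le_q (P : QuatData k) [P.IsOddLocal] : 2 ≤ q k := by
  have h := IsOddLocal.norm_pi (P := P)
  have h1 := P.norm_pi_pos
  have h2 := P.norm_π_lt_one
  rw [h] at h1 h2
  by_contra hc
  have : q k = 0 ∨ q k = 1 := by omega
  rcases this with h | h <;> simp [h] at h1 h2

theorem finite_residueField (P : QuatData k) [P.IsOddLocal] : Finite (ResidueField k) := by
  have h := P.two_le_q
  exact Nat.finite_of_card_ne_zero (by unfold q at h; omega)

theorem residue_eq_zero_iff {a : integers k} :
    IsLocalRing.residue (integers k) a = 0 ↔ ‖(a : k)‖ < 1 := by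
  rw [IsLocalRing.residue_eq_zero_iff, IsLocalRing.mem_maximalIdeal, mem_nonunits_iff]
  have ha : ‖(a : k)‖ ≤ 1 := mem_integers.1 a.2
  rw [← not_iff_not, not_not, not_lt]
  constructor
  · rintro ⟨b, rfl⟩
    have h1 : ‖((b⁻¹ : (integers k)ˣ) : integers k).1‖ ≤ 1 := mem_integers.1 (Subtype.mem _)
    have h2 : (b : integers k).1 * ((b⁻¹ : (integers k)ˣ) : integers k).1 = 1 := by
      rw [← MulMemClass.coe_mul, Units.mul_inv]; rfl
    have h3 := congrArg norm h2
    rw [norm_mul, norm_one] at h3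
    by_contra hc
    push Not at hc
    nlinarith [norm_nonneg (b : integers k).1]
  · intro h
    have h1 : ‖(a : k)‖ = 1 := le_antisymm ha h
    have h0 : (a : k) ≠ 0 := by
      intro h0
      simp [h0] at h1
    refine IsUnit.of_mul_eq_one ⟨(a : k)⁻¹, mem_integers.2 (by rw [norm_inv, h1, inv_one])⟩ ?_
    exact Subtype.ext (mul_inv_cancel₀ h0)

/-- The norm form of the unramified quadratic extension is anisotropic modulo the maximal ideal,
since `u` is not a square. -/
theorem norm_sq_sub [CompleteSpace k] (P : QuatData k) [P.IsOddLocal] (a b : k) :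
    ‖a ^ 2 - P.u * b ^ 2‖ = max (‖a‖ ^ 2) (‖b‖ ^ 2) := by
  have hn : ‖P.u * b ^ 2‖ = ‖b‖ ^ 2 := by rw [norm_mul, P.norm_u, one_mul, norm_pow]
  by_cases hab : ‖a‖ = ‖b‖
  · rw [hab, max_self]
    by_cases hb : b = 0
    · have : a = 0 := by simpa [hb] using hab
      simp [hb, this]
    refine le_antisymm ?_ ?_
    · refine (norm_sub_le_max' _ _).trans (max_le ?_ hn.le)
      rw [norm_pow, hab]
    · -- otherwise `u` would be congruent to the square `(a / b) ^ 2`, hence a square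
      by_contra hc
      push Not at hc
      have hbn : 0 < ‖b‖ := norm_pos_iff.2 hb
      have ha : a ≠ 0 := by
        rw [← norm_pos_iff, hab]; exact hbn
      obtain ⟨c, hc⟩ := P.exists_sq_eq (a := P.u * b ^ 2 / a ^ 2) (by
        have : P.u * b ^ 2 / a ^ 2 - 1 = -(a ^ 2 - P.u * b ^ 2) / a ^ 2 := by
          field_simp
          ring
        rw [this, norm_div, norm_neg, norm_pow, hab, div_lt_one (by positivity)]
        exact hc)
      apply P.not_isSquare_u
      refine ⟨c * a / b, ?_⟩
      field_simp
      field_simp at hc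
      linear_combination -hc
  · rw [norm_sub_eq_max', hn, norm_pow]
    rw [hn, norm_pow]
    intro h
    exact hab ((pow_left_inj₀ (norm_nonneg _) (norm_nonneg _) two_ne_zero).1 h)

open Polynomial in
/-- Units are norms from the unramified quadratic extension: a solution in the residue field exists
by counting, and it is corrected by a square root of an element congruent to `1`. -/
theorem exists_norm_eq_of_unit [CompleteSpace k] (P : QuatData k) [P.IsOddLocal] {a : k}
    (ha : ‖a‖ = 1) : ∃ x y : k, x ^ 2 - P.u * y ^ 2 = a := by
  have := P.finite_residueField
  have := Fintype.ofFinite (ResidueField k)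
  let r := IsLocalRing.residue (integers k)
  let a' : integers k := ⟨a, mem_integers.2 ha.le⟩
  let u' : integers k := ⟨P.u, mem_integers.2 P.norm_u.le⟩
  have hu : r u' ≠ 0 := by
    intro h
    have := residue_eq_zero_iff.1 h
    simp [u', P.norm_u] at this
  have hchar : ringChar (ResidueField k) ≠ 2 := by
    intro h
    have h2 : ((2 : ℕ) : ResidueField k) = 0 := by
      rw [← h]; exact CharP.cast_eq_zero _ _
    have h3 : r (2 : integers k) = 0 := by
      rw [← h2, map_ofNat]; norm_num
    have := residue_eq_zero_iff.1 h3
    have h4 : ‖((2 : integers k) : k)‖ = 1 := IsOddLocal.norm_two P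
    rw [h4] at this
    exact lt_irrefl _ this
  obtain ⟨x, y, hxy⟩ := FiniteField.exists_root_sum_quadratic
    (f := Polynomial.X ^ 2 - C (r a')) (g := C (-r u') * Polynomial.X ^ 2) (by
      rw [degree_X_pow_sub_C two_pos]; rfl) (by
      rw [degree_C_mul_X_pow _ (neg_ne_zero.2 hu)]; rfl)
    (FiniteField.odd_card_of_char_ne_two hchar)
  obtain ⟨x, rfl⟩ := IsLocalRing.residue_surjective x
  obtain ⟨y, rfl⟩ := IsLocalRing.residue_surjective y
  have h1 : ‖((x : k) ^ 2 - P.u * (y : k) ^ 2) - a‖ < 1 := by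
    have h : r (x ^ 2 - u' * y ^ 2 - a') = 0 := by
      simp only [eval_sub, eval_mul, eval_pow, eval_X, eval_C] at hxy
      simp only [map_sub, map_mul, map_pow]
      linear_combination hxy
    exact residue_eq_zero_iff.1 h
  set c := (x : k) ^ 2 - P.u * (y : k) ^ 2 with hcdef
  have hc : ‖c‖ = 1 := by
    have : c = (c - a) + a := by ring
    rw [this, IsUltrametricDist.norm_add_eq_max_of_norm_ne_norm (by rw [ha]; exact h1.ne), ha]
    exact max_eq_right h1.le
  have hc0 : c ≠ 0 := by
    rw [← norm_pos_iff, hc]; exact one_pos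
  obtain ⟨b, hb⟩ := P.exists_sq_eq (a := a / c) (by
    have : a / c - 1 = -(c - a) / c := by
      field_simp
      ring
    rw [this, norm_div, norm_neg, hc, div_one]
    exact h1)
  refine ⟨b * x, b * y, ?_⟩
  have : a = b ^ 2 * c := by rw [hb]; field_simp
  rw [this, hcdef]
  ring

/-! ### The division algebra `D` -/

/-- The reduced norm `x x*` of an element of `D`. -/
def nm (P : QuatData k) (x : P.D) : k :=
  x.re ^ 2 - P.u * x.imI ^ 2 - P.π * (x.imJ ^ 2 - P.u * x.imK ^ 2)

/-- The absolute value `|N_rd(x)|` on `D`. It is multiplicative and ultrametric, with value `q⁻¹`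
at `Π`. -/
def dn (P : QuatData k) (x : P.D) : ℝ := ‖P.nm x‖

variable (P : QuatData k)

theorem mul_star_self (x : P.D) : x * star x = algebraMap k P.D (P.nm x) := by
  ext <;> simp [nm, QuaternionAlgebra.algebraMap_eq] <;> ring

theorem nm_mul (x y : P.D) : P.nm (x * y) = P.nm x * P.nm y := by
  simp [nm]
  ring

theorem nm_star (x : P.D) : P.nm (star x) = P.nm x := by
  simp [nm]

theorem nm_algebraMap (a : k) : P.nm (algebraMap k P.D a) = a ^ 2 := by
  simp [nm, QuaternionAlgebra.algebraMap_eq]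

@[simp] theorem nm_one : P.nm 1 = 1 := by simp [nm]

@[simp] theorem nm_zero : P.nm 0 = 0 := by simp [nm]

@[simp] theorem nm_neg (x : P.D) : P.nm (-x) = P.nm x := by simp [nm]

theorem dn_nonneg (x : P.D) : 0 ≤ P.dn x := norm_nonneg _

theorem dn_mul (x y : P.D) : P.dn (x * y) = P.dn x * P.dn y := by
  rw [dn, nm_mul, norm_mul, dn, dn]

@[simp] theorem dn_star (x : P.D) : P.dn (star x) = P.dn x := by rw [dn, nm_star, dn]

@[simp] theorem dn_one : P.dn 1 = 1 := by simp [dn]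

@[simp] theorem dn_zero : P.dn 0 = 0 := by simp [dn]

@[simp] theorem dn_neg (x : P.D) : P.dn (-x) = P.dn x := by simp [dn]

theorem dn_algebraMap (a : k) : P.dn (algebraMap k P.D a) = ‖a‖ ^ 2 := by
  rw [dn, nm_algebraMap, norm_pow]

theorem star_algebraMap (a : k) : star (algebraMap k P.D a) = algebraMap k P.D a := by
  ext <;> simp [QuaternionAlgebra.algebraMap_eq]

theorem eq_algebraMap_of_star {P : QuatData k} [P.IsOddLocal] {x : P.D} (h : star x = x) :
    x = algebraMap k P.D x.re := by
  have h2 := P.two_ne_zero'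
  have key : ∀ a : k, -a = a → a = 0 := fun a ha => by
    have : 2 * a = 0 := by linear_combination -ha
    simpa [h2] using this
  have h1 := congrArg QuaternionAlgebra.imI h
  have h3 := congrArg QuaternionAlgebra.imJ h
  have h4 := congrArg QuaternionAlgebra.imK h
  simp only [QuaternionAlgebra.imI_star, QuaternionAlgebra.imJ_star,
    QuaternionAlgebra.imK_star] at h1 h3 h4
  ext
  · simp [QuaternionAlgebra.algebraMap_eq]
  · simpa [QuaternionAlgebra.algebraMap_eq] using key _ h1
  · simpa [QuaternionAlgebra.algebraMap_eq] using key _ h3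
  · simpa [QuaternionAlgebra.algebraMap_eq] using key _ h4

/-- Odd and even powers of `π` have different absolute values. -/
theorem norm_sq_ne_norm_pi_mul_sq {a b : k} (h : a ≠ 0) : ‖a‖ ^ 2 ≠ ‖P.π‖ * ‖b‖ ^ 2 := by
  have hp := P.norm_pi_pos
  intro he
  have hb : b ≠ 0 := by
    rintro rfl
    simp [h] at he
  obtain ⟨m, hm⟩ := P.norm_eq_zpow h
  obtain ⟨l, hl⟩ := P.norm_eq_zpow hb
  rw [hm, hl, ← zpow_natCast, ← zpow_natCast, ← zpow_mul, ← zpow_mul, ← zpow_one_add₀ hp.ne'] at he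
  have := zpow_right_injective₀ hp P.norm_π_lt_one.ne he
  omega

section Norm

variable [CompleteSpace k] [P.IsOddLocal]

/-- The two parts of the reduced norm have valuations of different parity, so that no cancellation
occurs. -/
theorem dn_eq_max (x : P.D) : P.dn x = max (max (‖x.re‖ ^ 2) (‖x.imI‖ ^ 2))
    (‖P.π‖ * max (‖x.imJ‖ ^ 2) (‖x.imK‖ ^ 2)) := by
  have hA : ∃ a : k, max (‖x.re‖ ^ 2) (‖x.imI‖ ^ 2) = ‖a‖ ^ 2 := by
    rcases max_choice (‖x.re‖ ^ 2) (‖x.imI‖ ^ 2) with h | h <;> exact ⟨_, h⟩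
  have hB : ∃ b : k, max (‖x.imJ‖ ^ 2) (‖x.imK‖ ^ 2) = ‖b‖ ^ 2 := by
    rcases max_choice (‖x.imJ‖ ^ 2) (‖x.imK‖ ^ 2) with h | h <;> exact ⟨_, h⟩
  obtain ⟨a, ha⟩ := hA
  obtain ⟨b, hb⟩ := hB
  rw [dn, nm]
  have h1 := P.norm_sq_sub x.re x.imI
  have h2 := P.norm_sq_sub x.imJ x.imK
  rw [ha] at h1 ⊢
  rw [hb] at h2 ⊢
  by_cases h0 : a = 0
  · rw [h0, norm_zero, zero_pow two_ne_zero, norm_eq_zero] at h1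
    rw [h1, zero_sub, norm_neg, norm_mul, h2, h0, norm_zero, zero_pow two_ne_zero, max_eq_right]
    positivity
  · rw [norm_sub_eq_max', norm_mul, h1, h2]
    rw [norm_mul, h1, h2]
    exact P.norm_sq_ne_norm_pi_mul_sq h0

theorem dn_le_iff {x : P.D} {r : ℝ} : P.dn x ≤ r ↔ ‖x.re‖ ^ 2 ≤ r ∧ ‖x.imI‖ ^ 2 ≤ r ∧
    ‖P.π‖ * ‖x.imJ‖ ^ 2 ≤ r ∧ ‖P.π‖ * ‖x.imK‖ ^ 2 ≤ r := by
  rw [dn_eq_max, mul_max_of_nonneg _ _ P.norm_pi_pos.le]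
  simp only [max_le_iff, and_assoc]

theorem dn_add_le_max (x y : P.D) : P.dn (x + y) ≤ max (P.dn x) (P.dn y) := by
  have hx := P.dn_le_iff.1 (le_max_left (P.dn x) (P.dn y))
  have hy := P.dn_le_iff.1 (le_max_right (P.dn x) (P.dn y))
  have key : ∀ {a b : k} {c r : ℝ}, 0 ≤ c → c * ‖a‖ ^ 2 ≤ r → c * ‖b‖ ^ 2 ≤ r →
      c * ‖a + b‖ ^ 2 ≤ r := by
    intro a b c r hc ha hb
    rcases le_total ‖a‖ ‖b‖ with h | h
    · refine le_trans ?_ hb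
      gcongr
      exact (IsUltrametricDist.norm_add_le_max _ _).trans (max_le h le_rfl)
    · refine le_trans ?_ ha
      gcongr
      exact (IsUltrametricDist.norm_add_le_max _ _).trans (max_le le_rfl h)
  have key1 : ∀ {a b : k} {r : ℝ}, ‖a‖ ^ 2 ≤ r → ‖b‖ ^ 2 ≤ r → ‖a + b‖ ^ 2 ≤ r := by
    intro a b r ha hb
    have := key zero_le_one (a := a) (b := b) (r := r) (by simpa using ha) (by simpa using hb)
    simpa using this
  have hp := P.norm_pi_pos.le
  exact P.dn_le_iff.2 ⟨key1 hx.1 hy.1, key1 hx.2.1 hy.2.1, key hp hx.2.2.1 hy.2.2.1,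
    key hp hx.2.2.2 hy.2.2.2⟩

theorem dn_add_le {x y : P.D} {r : ℝ} (hx : P.dn x ≤ r) (hy : P.dn y ≤ r) : P.dn (x + y) ≤ r :=
  (P.dn_add_le_max x y).trans (max_le hx hy)

theorem dn_sum_le {ι : Type*} (s : Finset ι) {f : ι → P.D} {r : ℝ} (hr : 0 ≤ r)
    (h : ∀ i ∈ s, P.dn (f i) ≤ r) : P.dn (∑ i ∈ s, f i) ≤ r := by
  classical
  induction s using Finset.induction_on with
  | empty => simpa using hr
  | insert a s ha ih =>
    rw [Finset.sum_insert ha]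
    exact P.dn_add_le (h _ (Finset.mem_insert_self _ _))
      (ih fun i hi => h i (Finset.mem_insert_of_mem hi))

theorem dn_add_eq_left {x y : P.D} (h : P.dn y < P.dn x) : P.dn (x + y) = P.dn x := by
  refine le_antisymm (P.dn_add_le le_rfl h.le) ?_
  by_contra hc
  push Not at hc
  have h1 := P.dn_add_le_max (x + y) (-y)
  rw [add_neg_cancel_right, dn_neg] at h1
  exact absurd h1 (not_le.2 (max_lt hc h))

theorem mem_maxOrder_iff {x : P.D} : x ∈ P.maxOrder ↔ P.dn x ≤ 1 := by
  rw [dn_le_iff]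
  have hp := P.norm_pi_pos
  have h1 : ∀ a : k, ‖a‖ ^ 2 ≤ 1 ↔ ‖a‖ ≤ 1 := fun a => pow_le_one_iff_of_nonneg (norm_nonneg _)
    two_ne_zero
  have h2 : ∀ a : k, ‖P.π‖ * ‖a‖ ^ 2 ≤ 1 ↔ ‖a‖ ≤ 1 := by
    intro a
    constructor
    · intro h
      by_contra hc
      push Not at hc
      have h3 := P.norm_le_norm_π a⁻¹ (by rw [norm_inv]; exact inv_lt_one_of_one_lt₀ hc)
      rw [norm_inv, inv_le_iff_one_le_mul₀ (by linarith)] at h3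
      nlinarith
    · intro h
      have := (h1 a).2 h
      nlinarith [P.norm_π_lt_one, sq_nonneg ‖a‖]
  rw [h1, h1, h2, h2]
  exact Iff.rfl

theorem nm_eq_zero_iff {x : P.D} : P.nm x = 0 ↔ x = 0 := by
  constructor
  · intro h
    have h0 : P.dn x ≤ 0 := by rw [dn, h, norm_zero]
    obtain ⟨h1, h2, h3, h4⟩ := P.dn_le_iff.1 h0
    have hp := P.norm_pi_pos
    have key : ∀ a : k, ‖a‖ ^ 2 ≤ 0 → a = 0 := fun a ha => by
      have := le_antisymm ha (by positivity)
      simpa using this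
    have key' : ∀ a : k, ‖P.π‖ * ‖a‖ ^ 2 ≤ 0 → a = 0 := fun a ha =>
      key a (nonpos_of_mul_nonpos_right ha hp)
    ext
    exacts [key _ h1, key _ h2, key' _ h3, key' _ h4]
  · rintro rfl
    simp

theorem dn_pos {x : P.D} (hx : x ≠ 0) : 0 < P.dn x :=
  norm_pos_iff.2 fun h => hx (P.nm_eq_zero_iff.1 h)

theorem dn_eq_zero_iff {x : P.D} : P.dn x = 0 ↔ x = 0 := by
  rw [dn, norm_eq_zero, nm_eq_zero_iff]

instance instDivisionRingD : DivisionRing P.D where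
  __ := (inferInstance : Ring P.D)
  inv x := algebraMap k P.D (P.nm x)⁻¹ * star x
  exists_pair_ne := ⟨0, 1, fun h => by simpa using congrArg QuaternionAlgebra.re h⟩
  mul_inv_cancel x hx := by
    change x * (algebraMap k P.D (P.nm x)⁻¹ * star x) = 1
    rw [← mul_assoc, ← Algebra.commutes, mul_assoc, mul_star_self, ← map_mul,
      inv_mul_cancel₀ fun h => hx (P.nm_eq_zero_iff.1 h), map_one]
  inv_zero := by
    change algebraMap k P.D (P.nm 0)⁻¹ * star 0 = 0
    simp
  nnqsmul := _
  nnqsmul_def := fun _ _ => rfl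
  qsmul := _
  qsmul_def := fun _ _ => rfl

theorem dn_inv (x : P.D) : P.dn x⁻¹ = (P.dn x)⁻¹ := by
  by_cases hx : x = 0
  · simp [hx]
  · refine eq_inv_of_mul_eq_one_left ?_
    rw [← dn_mul, inv_mul_cancel₀ hx, dn_one]

theorem exists_dn_eq_zpow {x : P.D} (hx : x ≠ 0) : ∃ m : ℤ, P.dn x = ‖P.π‖ ^ m :=
  P.norm_eq_zpow fun h => hx (P.nm_eq_zero_iff.1 h)

theorem nm_piCoe (e : ℤ) : P.nm (P.piCoe e) = P.π ^ (2 * e) := by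
  rw [mul_comm, zpow_mul]
  simp [nm, piCoe]

theorem nm_piPrime (e : ℤ) : P.nm (P.piPrime e) = -P.π ^ (2 * e + 1) := by
  rw [zpow_add_one₀ P.π_ne_zero, mul_comm 2 e, zpow_mul]
  simp only [nm, piPrime]
  rw [show ((P.π ^ e) ^ (2 : ℤ)) = (P.π ^ e) ^ 2 from zpow_natCast _ 2]
  ring

theorem dn_piCoe (e : ℤ) : P.dn (P.piCoe e) = ‖P.π‖ ^ (2 * e) := by
  rw [dn, nm_piCoe, norm_zpow]

theorem dn_piPrime (e : ℤ) : P.dn (P.piPrime e) = ‖P.π‖ ^ (2 * e + 1) := by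
  rw [dn, nm_piPrime, norm_neg, norm_zpow]

/-- The reduced norm `Dˣ → kˣ` is surjective. -/
theorem exists_nm_eq (a : k) : ∃ x : P.D, P.nm x = a := by
  by_cases ha : a = 0
  · exact ⟨0, by simp [ha]⟩
  obtain ⟨m, hm⟩ := P.norm_eq_zpow ha
  have hunit : ∀ b : k, ‖b‖ = 1 → ∃ x : P.D, P.nm x = b := by
    intro b hb
    obtain ⟨x, y, h⟩ := P.exists_norm_eq_of_unit hb
    exact ⟨⟨x, y, 0, 0⟩, by simp [nm, h]⟩
  have hred : ∀ z : P.D, P.dn z = ‖P.π‖ ^ m → ∃ x : P.D, P.nm x = a := by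
    intro z hz
    have hz0 : P.nm z ≠ 0 := by
      rw [← norm_pos_iff]
      change 0 < P.dn z
      rw [hz]
      exact zpow_pos P.norm_pi_pos _
    obtain ⟨x, hx⟩ := hunit (a / P.nm z) (by
      rw [norm_div, hm]
      change _ / P.dn z = 1
      rw [hz]
      exact div_self (zpow_pos P.norm_pi_pos _).ne')
    exact ⟨x * z, by rw [nm_mul, hx, div_mul_cancel₀ _ hz0]⟩
  obtain ⟨e, rfl | rfl⟩ := Int.even_or_odd' m
  · exact hred _ (P.dn_piCoe e)
  · exact hred _ (P.dn_piPrime e)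

end Norm

end QuatData

namespace QuatData

variable {k : Type*} [NontriviallyNormedField k] [IsUltrametricDist k]

/-! ### The reduced norm of matrices -/

section Nrd

variable (P : QuatData k)

theorem phi_mul (x y : P.D) : P.phi (x * y) = P.phi x * P.phi y := by
  ext i j <;> fin_cases i <;> fin_cases j <;> simp [phi, Matrix.mul_apply, Fin.sum_univ_two] <;> ring

/-- The splitting `φ : D → M₂(k')`, as a ring homomorphism. -/
def phiHom : P.D →+* Matrix (Fin 2) (Fin 2) P.K' where
  toFun := P.phi
  map_one' := by
    ext i j <;> fin_cases i <;> fin_cases j <;>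
      simp [phi, QuadraticAlgebra.re_one, QuadraticAlgebra.im_one]
  map_zero' := by
    ext i j <;> fin_cases i <;> fin_cases j <;> simp [phi]
  map_mul' := P.phi_mul
  map_add' x y := by
    ext i j <;> fin_cases i <;> fin_cases j <;> simp [phi] <;> ring

theorem phiHom_injective : Function.Injective P.phiHom := by
  intro x y h
  have h1 : P.phi x = P.phi y := h
  have h00 := congrFun (congrFun h1 0) 0
  have h10 := congrFun (congrFun h1 1) 0
  simp only [phi, Matrix.of_apply, Matrix.cons_val', Matrix.cons_val_zero, Matrix.cons_val_one,
    Matrix.cons_val_fin_one, QuadraticAlgebra.ext_iff, neg_inj] at h00 h10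
  ext
  exacts [h00.1, h00.2, h10.1, h10.2]

variable {P} {m : ℕ}

theorem phiMatrix_eq (A : Matrix (Fin m) (Fin m) P.D) : P.phiMatrix A =
    Matrix.compRingEquiv (Fin m) (Fin 2) P.K' (P.phiHom.mapMatrix A) := rfl

theorem phiMatrix_mul (A C : Matrix (Fin m) (Fin m) P.D) :
    P.phiMatrix (A * C) = P.phiMatrix A * P.phiMatrix C := by
  simp only [phiMatrix_eq, map_mul]

theorem phiMatrix_one : P.phiMatrix (1 : Matrix (Fin m) (Fin m) P.D) = 1 := by
  simp only [phiMatrix_eq, map_one]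

/-- The blockwise conjugation by a fixed `2 × 2` matrix. -/
theorem phiMatrix_conj_det (T : Matrix (Fin 2) (Fin 2) P.K') (hT : IsUnit T.det)
    (M N : Matrix (Fin m × Fin 2) (Fin m × Fin 2) P.K')
    (h : ∀ i j, T * Matrix.of (fun a b => M (i, a) (j, b)) =
      Matrix.of (fun a b => N (i, a) (j, b)) * T) : M.det = N.det := by
  let TT : Matrix (Fin m × Fin 2) (Fin m × Fin 2) P.K' := 
    Matrix.kroneckerMap (· * ·) (1 : Matrix (Fin m) (Fin m) P.K') T
  have h1 : TT * M = N * TT := by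
    ext1 ⟨i, a⟩ ⟨j, b⟩
    have := congrFun (congrFun (h i j) a) b
    simp only [Matrix.mul_apply, Matrix.of_apply] at this
    simp only [TT, Matrix.mul_apply, Fintype.sum_prod_type, Matrix.kroneckerMap_apply,
      Matrix.one_apply, ite_mul, one_mul, zero_mul, mul_ite, mul_zero]
    rw [Finset.sum_comm]
    conv_rhs => rw [Finset.sum_comm]
    simpa using this
  have hTT : IsUnit TT.det := by
    simp only [TT, Matrix.det_kronecker, Matrix.det_one, one_pow, one_mul]
    exact hT.pow _
  have h2 := congrArg Matrix.det h1
  rw [Matrix.det_mul, Matrix.det_mul, mul_comm] at h2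
  exact hTT.mul_right_cancel h2

/-- The determinant of `φₙ(A)` lies in `k`: conjugation by `ε ↦ -ε` amounts to a blockwise change
of basis. -/
theorem det_phiMatrix [P.IsOddLocal] (A : Matrix (Fin m) (Fin m) P.D) :
    (P.phiMatrix A).det = algebraMap k P.K' (P.nrd A) := by
  have h1 : ((starRingEnd P.K').mapMatrix (P.phiMatrix A)).det = (P.phiMatrix A).det := by
    symm
    refine phiMatrix_conj_det !![0, algebraMap k P.K' P.π; 1, 0] ?_ _ _ fun i j => ?_
    · rw [Matrix.det_fin_two_of, zero_mul, zero_sub, mul_one, ← map_neg]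
      exact (IsUnit.mk0 _ (neg_ne_zero.2 P.π_ne_zero)).map _
    · ext a b <;> fin_cases a <;> fin_cases b <;>
        simp [phiMatrix, phi, Matrix.mul_apply, Fin.sum_univ_two, QuadraticAlgebra.algebraMap_eq,
          starRingEnd_apply] <;> ring_nf
  rw [← RingHom.map_det] at h1
  have h2 := congrArg QuadraticAlgebra.im h1
  have h3 : (P.phiMatrix A).det.im = 0 := by
    rw [starRingEnd_apply, QuadraticAlgebra.im_star] at h2
    have : 2 * (P.phiMatrix A).det.im = 0 := by linear_combination -h2
    simpa [P.two_ne_zero'] using this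
  ext
  · rfl
  · simpa using h3

theorem algebraMap_K'_injective : Function.Injective (algebraMap k P.K') := by
  intro a b h
  have := congrArg QuadraticAlgebra.re h
  simpa using this

theorem nrd_one : P.nrd (1 : Matrix (Fin m) (Fin m) P.D) = 1 := by
  rw [nrd, phiMatrix_one, Matrix.det_one]
  rfl

variable [P.IsOddLocal]

theorem nrd_mul (A C : Matrix (Fin m) (Fin m) P.D) : P.nrd (A * C) = P.nrd A * P.nrd C := by
  apply algebraMap_K'_injective (P := P)
  rw [map_mul, ← det_phiMatrix, ← det_phiMatrix, ← det_phiMatrix, phiMatrix_mul, Matrix.det_mul]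

theorem nrd_star (A : Matrix (Fin m) (Fin m) P.D) : P.nrd (star A) = P.nrd A := by
  apply algebraMap_K'_injective (P := P)
  rw [← det_phiMatrix, ← det_phiMatrix, ← Matrix.det_transpose (P.phiMatrix A)]
  symm
  refine phiMatrix_conj_det !![0, 1; -1, 0] ?_ _ _ fun i j => ?_
  · rw [Matrix.det_fin_two_of]
    simp
  · ext a b <;> fin_cases a <;> fin_cases b <;>
      simp [phiMatrix, phi, Matrix.mul_apply, Fin.sum_univ_two, Matrix.star_apply]

theorem nrd_succ (A : Matrix (Fin (m + 1)) (Fin (m + 1)) P.D) (h : ∀ j : Fin m, A 0 j.succ = 0) :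
    P.nrd A = P.nm (A 0 0) * P.nrd (A.submatrix Fin.succ Fin.succ) := by
  let f : Fin 2 ⊕ (Fin m × Fin 2) → Fin (m + 1) × Fin 2 :=
    Sum.elim (fun a => (0, a)) fun p => (p.1.succ, p.2)
  have hf : Function.Bijective f := by
    constructor
    · rintro (a | ⟨i, a⟩) (b | ⟨j, b⟩) h <;> simp [f, Prod.ext_iff, Fin.succ_ne_zero] at h ⊢
      · exact h
      · exact absurd h.1.symm (Fin.succ_ne_zero j)
      · exact h
    · rintro ⟨i, a⟩
      refine Fin.cases ⟨Sum.inl a, rfl⟩ (fun i => ⟨Sum.inr (i, a), rfl⟩) i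
  have h1 : (P.phiMatrix A).submatrix f f = Matrix.fromBlocks (P.phi (A 0 0)) 0
      (Matrix.of fun p b => P.phi (A (Fin.succ p.1) 0) p.2 b)
      (P.phiMatrix (A.submatrix Fin.succ Fin.succ)) := by
    ext1 (a | ⟨i, a⟩) (b | ⟨j, b⟩)
    · rfl
    · change P.phi (A 0 j.succ) a b = 0
      rw [h]
      change P.phiHom 0 a b = 0
      rw [map_zero]
      rfl
    · rfl
    · rfl
  apply algebraMap_K'_injective (P := P)
  rw [← det_phiMatrix, ← Matrix.det_submatrix_equiv_self (Equiv.ofBijective f hf), map_mul,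
    ← det_phiMatrix]
  change ((P.phiMatrix A).submatrix f f).det = _
  rw [h1, Matrix.det_fromBlocks_zero₁₂]
  congr 1
  rw [phi, Matrix.det_fin_two_of]
  ext <;> simp [nm, QuadraticAlgebra.algebraMap_eq] <;> ring

theorem nrd_lowerTri (A : Matrix (Fin m) (Fin m) P.D) (h : ∀ i j, i < j → A i j = 0) :
    P.nrd A = ∏ i, P.nm (A i i) := by
  induction m with
  | zero =>
    rw [Subsingleton.elim A 1, nrd_one, Finset.univ_eq_empty, Finset.prod_empty]
  | succ m ih =>
    rw [nrd_succ A fun j => h _ _ (Fin.succ_pos j), Fin.prod_univ_succ, ih]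
    · rfl
    · intro i j hij
      exact h _ _ (Fin.succ_lt_succ_iff.2 hij)

theorem nrd_ne_zero_of_isUnit {A : Matrix (Fin m) (Fin m) P.D} (h : IsUnit A) : P.nrd A ≠ 0 := by
  obtain ⟨u, rfl⟩ := h
  intro h0
  have := P.nrd_one (m := m)
  rw [← u.mul_inv, nrd_mul, h0, zero_mul] at this
  exact zero_ne_one this

theorem phiMatrix_eq_zero {C : Matrix (Fin m) (Fin m) P.D} (h : P.phiMatrix C = 0) : C = 0 := by
  ext1 i j
  apply P.phiHom_injective
  rw [Matrix.zero_apply, map_zero]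
  ext1 a b
  exact congrFun (congrFun h (i, a)) (j, b)

theorem exists_right_inv_of_nrd_ne_zero {A : Matrix (Fin m) (Fin m) P.D} (h : P.nrd A ≠ 0) :
    ∃ C, A * C = 1 := by
  have : Module.Finite k (Matrix (Fin m) (Fin m) P.D) := Module.Finite.matrix
  have hinj : Function.Injective (LinearMap.mulLeft k A) := by
    rw [injective_iff_map_eq_zero]
    intro C hC
    apply phiMatrix_eq_zero
    have h1 : P.phiMatrix A * P.phiMatrix C = 0 := by
      rw [← phiMatrix_mul, show A * C = 0 from hC]
      ext1 i j
      change P.phiHom 0 i.2 j.2 = 0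
      rw [map_zero]
      rfl
    have h2 : IsUnit (P.phiMatrix A).det := by
      rw [det_phiMatrix]
      exact (IsUnit.mk0 _ h).map _
    have h3 : IsUnit (P.phiMatrix A) := (Matrix.isUnit_iff_isUnit_det _).2 h2
    rwa [h3.mul_right_eq_zero] at h1
  obtain ⟨C, hC⟩ := LinearMap.injective_iff_surjective.1 hinj 1
  exact ⟨C, hC⟩

theorem isUnit_iff_nrd_ne_zero {A : Matrix (Fin m) (Fin m) P.D} : IsUnit A ↔ P.nrd A ≠ 0 := by
  refine ⟨nrd_ne_zero_of_isUnit, fun h => ?_⟩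
  obtain ⟨C, hC⟩ := exists_right_inv_of_nrd_ne_zero h
  have hC0 : P.nrd C ≠ 0 := by
    intro h0
    have := P.nrd_one (m := m)
    rw [← hC, nrd_mul, h0, mul_zero] at this
    exact zero_ne_one this
  obtain ⟨E, hE⟩ := exists_right_inv_of_nrd_ne_zero hC0
  have : A = E := by rw [← mul_one A, ← hE, ← mul_assoc, hC, one_mul]
  exact ⟨⟨A, C, hC, by rw [this]; exact hE⟩, rfl⟩

theorem isUnit_of_mul_eq_one {A C : Matrix (Fin m) (Fin m) P.D} (h : A * C = 1) : IsUnit A := by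
  rw [isUnit_iff_nrd_ne_zero]
  intro h0
  have := P.nrd_one (m := m)
  rw [← h, nrd_mul, h0, zero_mul] at this
  exact zero_ne_one this

/-- The functions to `k'` with continuous coordinates. -/
def contSubring (P : QuatData k) (T : Type*) [TopologicalSpace T] : Subring (T → P.K') where
  carrier := {f | Continuous (fun t => (f t).re) ∧ Continuous fun t => (f t).im}
  mul_mem' := by
    rintro f g ⟨hf, hf'⟩ ⟨hg, hg'⟩
    constructor
    · simp only [Pi.mul_apply, QuadraticAlgebra.re_mul]
      fun_prop
    · simp only [Pi.mul_apply, QuadraticAlgebra.im_mul]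
      fun_prop
  one_mem' := ⟨continuous_const, continuous_const⟩
  add_mem' := by
    rintro f g ⟨hf, hf'⟩ ⟨hg, hg'⟩
    exact ⟨hf.add hg, hf'.add hg'⟩
  zero_mem' := ⟨continuous_const, continuous_const⟩
  neg_mem' := by
    rintro f ⟨hf, hf'⟩
    exact ⟨hf.neg, hf'.neg⟩

theorem continuous_nrd {T : Type*} [TopologicalSpace T] {A : T → Matrix (Fin m) (Fin m) P.D}
    (hA : ∀ i j, Continuous fun t => A t i j) : Continuous fun t => P.nrd (A t) := by
  have hM : ∀ i j, (fun t => P.phiMatrix (A t) i j) ∈ P.contSubring T := by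
    rintro ⟨i, a⟩ ⟨j, b⟩
    have h0 := P.continuous_re.comp (hA i j)
    have h1 := P.continuous_imI.comp (hA i j)
    have h2 := P.continuous_imJ.comp (hA i j)
    have h3 := P.continuous_imK.comp (hA i j)
    simp only [Function.comp_def] at h0 h1 h2 h3
    fin_cases a <;> fin_cases b <;> constructor <;> simp [phiMatrix, phi] <;> fun_prop
  have h : (fun t => (P.phiMatrix (A t)).det) ∈ P.contSubring T := by
    have : (fun t => (P.phiMatrix (A t)).det) = ∑ σ : Equiv.Perm (Fin m × Fin 2),
        Equiv.Perm.sign σ • ∏ i, fun t => P.phiMatrix (A t) (σ i) i := by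
      ext1 t
      rw [Matrix.det_apply, Finset.sum_apply]
      refine Finset.sum_congr rfl fun σ _ => ?_
      rw [Pi.smul_apply, Finset.prod_apply]
    rw [this]
    refine Subring.sum_mem _ fun σ _ => ?_
    have hp := Subring.prod_mem (P.contSubring T) (t := Finset.univ) fun i _ => hM (σ i) i
    rcases Int.units_eq_one_or (Equiv.Perm.sign σ) with h | h <;> rw [h]
    · rwa [one_smul]
    · rw [Units.neg_smul, one_smul]
      exact Subring.neg_mem _ hp
  exact h.1

end Nrd

end QuatData

namespace QuatData

variable {k : Type*} [NontriviallyNormedField k] [IsUltrametricDist k]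

/-! ### Elementary matrices -/

section Elementary

variable (P : QuatData k) {n : ℕ}

/-- The matrix `1 + ∑ₗ vₗ Eₗⱼ`, where `vⱼ = 0`. It adds `vₗ` times the `j`-th row to the
`l`-th row. -/
def colU (j : Fin n) (v : Fin n → P.D) (hv : v j = 0) : P.G n where
  val := 1 + Matrix.of fun l m => if m = j then v l else 0
  inv := 1 - Matrix.of fun l m => if m = j then v l else 0
  val_inv := by
    have : (Matrix.of fun l m => if m = j then v l else 0) *
        (Matrix.of fun l m => if m = j then v l else 0) = (0 : Matrix (Fin n) (Fin n) P.D) := by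
      ext1 l m
      simp [Matrix.mul_apply, hv]
    rw [add_mul, one_mul, mul_sub, mul_one, this]
    abel
  inv_val := by
    have : (Matrix.of fun l m => if m = j then v l else 0) *
        (Matrix.of fun l m => if m = j then v l else 0) = (0 : Matrix (Fin n) (Fin n) P.D) := by
      ext1 l m
      simp [Matrix.mul_apply, hv]
    rw [sub_mul, one_mul, mul_add, mul_one, this]
    abel

theorem colU_mul_apply {ι : Type*} (j : Fin n) (v : Fin n → P.D) (hv : v j = 0)
    (A : Matrix (Fin n) ι P.D) (l : Fin n) (m : ι) :
    (((P.colU j v hv : P.G n) : Matrix (Fin n) (Fin n) P.D) * A) l m = A l m + v l * A j m := by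
  change ((1 + Matrix.of fun l m => if m = j then v l else 0 : Matrix (Fin n) (Fin n) P.D) * A :
    Matrix (Fin n) ι P.D) l m = _
  rw [Matrix.add_mul, Matrix.add_apply, Matrix.one_mul, Matrix.mul_apply]
  simp

theorem mul_star_colU_apply (j : Fin n) (v : Fin n → P.D) (hv : v j = 0)
    (A : Matrix (Fin n) (Fin n) P.D) (l m : Fin n) :
    (A * star ((P.colU j v hv : P.G n) : Matrix (Fin n) (Fin n) P.D)) l m =
      A l m + A l j * star (v m) := by
  change (A * star (1 + Matrix.of fun l m => if m = j then v l else 0)) l m = _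
  rw [star_add, star_one, mul_add, mul_one, Matrix.add_apply, Matrix.mul_apply]
  simp [Matrix.star_apply, apply_ite star]

/-- The permutation matrix with rows `e_{σ i}`. -/
def permU (σ : Equiv.Perm (Fin n)) : P.G n where
  val := Matrix.of fun i j => if j = σ i then 1 else 0
  inv := Matrix.of fun i j => if j = σ.symm i then 1 else 0
  val_inv := by
    ext1 i j
    rw [Matrix.mul_apply, Finset.sum_eq_single (σ i)] <;>
      simp +contextual [Matrix.one_apply, eq_comm]
  inv_val := by
    ext1 i j
    rw [Matrix.mul_apply, Finset.sum_eq_single (σ.symm i)] <;>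
      simp +contextual [Matrix.one_apply, eq_comm]

theorem permU_mul_apply {ι : Type*} (σ : Equiv.Perm (Fin n)) (A : Matrix (Fin n) ι P.D)
    (l : Fin n) (m : ι) : (((P.permU σ : P.G n) : Matrix (Fin n) (Fin n) P.D) * A) l m = A (σ l) m := by
  rw [Matrix.mul_apply, Finset.sum_eq_single (σ l)] <;> simp +contextual [permU]

theorem mul_permU_apply (σ : Equiv.Perm (Fin n)) (A : Matrix (Fin n) (Fin n) P.D) (l m : Fin n) :
    (A * (P.permU σ : P.G n) : Matrix (Fin n) (Fin n) P.D) l m = A l (σ.symm m) := by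
  rw [Matrix.mul_apply, Finset.sum_eq_single (σ.symm m)]
  · simp [permU]
  · intro b _ hb
    have : m ≠ σ b := fun h => hb (by rw [h, Equiv.symm_apply_apply])
    simp [permU, this]
  · simp

theorem mul_star_permU_apply (σ : Equiv.Perm (Fin n)) (A : Matrix (Fin n) (Fin n) P.D)
    (l m : Fin n) : (A * star ((P.permU σ : P.G n) : Matrix (Fin n) (Fin n) P.D)) l m =
      A l (σ m) := by
  rw [Matrix.mul_apply, Finset.sum_eq_single (σ m)] <;>
    simp +contextual [permU, Matrix.star_apply]

theorem toMatrix_smul (g : P.G n) (y : P.X n) :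
    P.toMatrix (g • y) = (g : Matrix (Fin n) (Fin n) P.D) * P.toMatrix y *
      star (g : Matrix (Fin n) (Fin n) P.D) := rfl

theorem star_toMatrix (y : P.X n) : star (P.toMatrix y) = P.toMatrix y :=
  congrArg Units.val y.2

theorem star_toMatrix_apply (y : P.X n) (i j : Fin n) :
    star (P.toMatrix y i j) = P.toMatrix y j i := by
  conv_rhs => rw [← P.star_toMatrix y]
  rfl

theorem toMatrix_injective : Function.Injective (P.toMatrix (n := n)) := fun _ _ h =>
  Subtype.ext (Units.ext h)

theorem toMatrix_colU_smul (j : Fin n) (v : Fin n → P.D) (hv : v j = 0) (y : P.X n)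
    (l m : Fin n) : P.toMatrix (P.colU j v hv • y) l m =
      P.toMatrix y l m + v l * P.toMatrix y j m +
        (P.toMatrix y l j + v l * P.toMatrix y j j) * star (v m) := by
  rw [toMatrix_smul, mul_star_colU_apply, colU_mul_apply, colU_mul_apply]

theorem toMatrix_permU_smul (σ : Equiv.Perm (Fin n)) (y : P.X n) (l m : Fin n) :
    P.toMatrix (P.permU σ • y) l m = P.toMatrix y (σ l) (σ m) := by
  rw [toMatrix_smul, mul_star_permU_apply, permU_mul_apply]

theorem exists_row_ne_zero (g : P.G n) (i : Fin n) :
    ∃ l, (g : Matrix (Fin n) (Fin n) P.D) i l ≠ 0 := by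
  by_contra hc
  push Not at hc
  have h := congrFun (congrFun g.mul_inv i) i
  rw [Matrix.mul_apply, Matrix.one_apply_eq, Finset.sum_eq_zero fun l _ => by rw [hc l, zero_mul]]
    at h
  simpa using congrArg QuaternionAlgebra.re h

theorem exists_toMatrix_ne_zero (y : P.X n) (i : Fin n) : ∃ l, P.toMatrix y i l ≠ 0 :=
  P.exists_row_ne_zero y.1 i

theorem colU_mem_B {j : Fin n} {v : Fin n → P.D} (hv : v j = 0) (h : ∀ l < j, v l = 0) :
    P.colU j v hv ∈ P.B n := by
  intro l m hlm
  have h1 : (1 : Matrix (Fin n) (Fin n) P.D) l m = 0 := Matrix.one_apply_ne hlm.ne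
  change (1 : Matrix (Fin n) (Fin n) P.D) l m + (if m = j then v l else 0) = 0
  rw [h1, zero_add]
  split_ifs with hm
  · exact h l (hm ▸ hlm)
  · rfl

theorem colU_mem_K {j : Fin n} {v : Fin n → P.D} (hv : v j = 0) (h : ∀ l, v l ∈ P.maxOrder) :
    P.colU j v hv ∈ P.K n := by
  have h1 : ∀ l m, (1 : Matrix (Fin n) (Fin n) P.D) l m ∈ P.maxOrder := (P.K n).one_mem.1
  have h2 : ∀ l m : Fin n, (if m = j then v l else 0) ∈ P.maxOrder := by
    intro l m
    split_ifs
    exacts [h l, P.maxOrder.zero_mem]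
  exact ⟨fun l m => P.maxOrder.add_mem (h1 l m) (h2 l m),
    fun l m => P.maxOrder.sub_mem (h1 l m) (h2 l m)⟩

theorem permU_mem_K (σ : Equiv.Perm (Fin n)) : P.permU σ ∈ P.K n := by
  constructor <;> intro l m <;> simp only [permU, Units.inv_mk, Matrix.of_apply] <;> split_ifs
  exacts [P.maxOrder.one_mem, P.maxOrder.zero_mem, P.maxOrder.one_mem, P.maxOrder.zero_mem]

variable [CompleteSpace k] [P.IsOddLocal]

/-- The diagonal matrix with the given non-zero entries. -/
def diagU (d : Fin n → P.D) (hd : ∀ i, d i ≠ 0) : P.G n where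
  val := Matrix.diagonal d
  inv := Matrix.diagonal fun i => (d i)⁻¹
  val_inv := by
    rw [Matrix.diagonal_mul_diagonal, ← Matrix.diagonal_one]
    congr 1
    ext1 i
    exact mul_inv_cancel₀ (hd i)
  inv_val := by
    rw [Matrix.diagonal_mul_diagonal, ← Matrix.diagonal_one]
    congr 1
    ext1 i
    exact inv_mul_cancel₀ (hd i)

theorem toMatrix_diagU_smul (d : Fin n → P.D) (hd : ∀ i, d i ≠ 0) (y : P.X n) (l m : Fin n) :
    P.toMatrix (P.diagU d hd • y) l m = d l * P.toMatrix y l m * star (d m) := by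
  rw [toMatrix_smul]
  simp [diagU, Matrix.star_eq_conjTranspose, Matrix.diagonal_conjTranspose]

theorem diagU_mem_B (d : Fin n → P.D) (hd : ∀ i, d i ≠ 0) : P.diagU d hd ∈ P.B n :=
  fun _ _ h => Matrix.diagonal_apply_ne _ h.ne

theorem diagU_mem_K {d : Fin n → P.D} (hd : ∀ i, d i ≠ 0) (h : ∀ i, P.dn (d i) = 1) :
    P.diagU d hd ∈ P.K n := by
  constructor <;> intro l m <;> simp only [diagU, Units.inv_mk, Matrix.diagonal_apply] <;>
    split_ifs
  · exact P.mem_maxOrder_iff.2 (h l).le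
  · exact P.maxOrder.zero_mem
  · exact P.mem_maxOrder_iff.2 (by rw [dn_inv, h l, inv_one])
  · exact P.maxOrder.zero_mem

/-- The diagonal matrix with entry `c` at `i` and `1` elsewhere. -/
def diagOne (i : Fin n) (c : P.D) (hc : c ≠ 0) : P.G n :=
  P.diagU (Function.update (fun _ => 1) i c) fun j => by
    by_cases h : j = i
    · rw [h, Function.update_self]; exact hc
    · rw [Function.update_of_ne h]; exact one_ne_zero

theorem diagOne_mem_B (i : Fin n) (c : P.D) (hc : c ≠ 0) : P.diagOne i c hc ∈ P.B n :=
  P.diagU_mem_B _ _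

theorem diagOne_mem_K (i : Fin n) {c : P.D} (hc : c ≠ 0) (h : P.dn c = 1) :
    P.diagOne i c hc ∈ P.K n := by
  refine P.diagU_mem_K _ fun j => ?_
  by_cases hj : j = i
  · rw [hj, Function.update_self]; exact h
  · rw [Function.update_of_ne hj]; exact P.dn_one

theorem toMatrix_diagOne_smul (i : Fin n) (c : P.D) (hc : c ≠ 0) (y : P.X n) (l m : Fin n) :
    P.toMatrix (P.diagOne i c hc • y) l m =
      (if l = i then c else 1) * P.toMatrix y l m * star (if m = i then c else 1) := by
  rw [diagOne, toMatrix_diagU_smul, Function.update_apply, Function.update_apply]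

/-! ### Splitting off lines and hyperbolic planes -/

variable {P}

/-- A nonzero diagonal entry splits off an orthogonal line. The operation only involves the column
of this entry, so that rows which are already orthogonal to it do not change. -/
theorem split_line (y : P.X n) (i : Fin n) (hi : P.toMatrix y i i ≠ 0) :
    ∃ (v : Fin n → P.D) (hv : v i = 0),
      (∀ l, l ≠ i → v l = -P.toMatrix y l i * (P.toMatrix y i i)⁻¹) ∧
      (∀ l, l ≠ i → P.toMatrix (P.colU i v hv • y) l i = 0) ∧
      P.toMatrix (P.colU i v hv • y) i i = P.toMatrix y i i ∧
      ∀ l, P.toMatrix y l i = 0 → ∀ m, P.toMatrix (P.colU i v hv • y) l m = P.toMatrix y l m := by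
  let v : Fin n → P.D := fun l => if l = i then 0 else -P.toMatrix y l i * (P.toMatrix y i i)⁻¹
  have hv : v i = 0 := if_pos rfl
  have hv' : ∀ l, l ≠ i → v l = -P.toMatrix y l i * (P.toMatrix y i i)⁻¹ := fun l hl => if_neg hl
  refine ⟨v, hv, hv', fun l hl => ?_, ?_, fun l hl m => ?_⟩
  · rw [toMatrix_colU_smul, hv, star_zero, mul_zero, add_zero, hv' l hl, mul_assoc,
      inv_mul_cancel₀ hi, mul_one, add_neg_cancel]
  · rw [toMatrix_colU_smul, hv, star_zero, mul_zero, add_zero, zero_mul, add_zero]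
  · have hli : l ≠ i := by
      rintro rfl
      exact hi hl
    rw [toMatrix_colU_smul, hv' l hli, hl]
    simp

/-- A nonzero entry `y i j` with `y i i = 0` splits off a hyperbolic plane. The first operation
clears the column `i`, the second one clears the column `j`, where the entry at `(j, j)` is removed
with half the coefficient, as it is changed from both sides. -/
theorem split_plane (y : P.X n) {i j : Fin n} (hij : i ≠ j) (hi : P.toMatrix y i i = 0)
    (h0 : P.toMatrix y i j ≠ 0) :
    ∃ (v : Fin n → P.D) (hv : v j = 0) (w : Fin n → P.D) (hw : w i = 0),
      (∀ l, l ≠ j → v l = -P.toMatrix y l i * (P.toMatrix y j i)⁻¹) ∧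
      (∀ l, l ≠ i → l ≠ j →
        w l = -P.toMatrix (P.colU j v hv • y) l j * (P.toMatrix y i j)⁻¹) ∧
      (w j = -(algebraMap k P.D 2⁻¹ * P.toMatrix (P.colU j v hv • y) j j) *
        (P.toMatrix y i j)⁻¹) ∧
      (∀ l, l ≠ j → P.toMatrix (P.colU i w hw • P.colU j v hv • y) l i = 0) ∧
      (∀ l, l ≠ i → P.toMatrix (P.colU i w hw • P.colU j v hv • y) l j = 0) ∧
      (P.toMatrix (P.colU i w hw • P.colU j v hv • y) i j = P.toMatrix y i j) ∧
      (∀ l, P.toMatrix y l i = 0 → P.toMatrix y l j = 0 →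
        ∀ m, P.toMatrix (P.colU i w hw • P.colU j v hv • y) l m = P.toMatrix y l m) := by
  have h0' : P.toMatrix y j i ≠ 0 := by
    rw [← star_toMatrix_apply]
    exact star_ne_zero.2 h0
  let v : Fin n → P.D := fun l => if l = j then 0 else -P.toMatrix y l i * (P.toMatrix y j i)⁻¹
  have hv : v j = 0 := if_pos rfl
  have hv' : ∀ l, l ≠ j → v l = -P.toMatrix y l i * (P.toMatrix y j i)⁻¹ := fun l hl => if_neg hl
  have hvi : v i = 0 := by rw [hv' i hij, hi, neg_zero, zero_mul]
  clear_value v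
  set y' := P.colU j v hv • y with hy'
  have h1 : ∀ l, l ≠ j → P.toMatrix y' l i = 0 := by
    intro l hl
    rw [hy', toMatrix_colU_smul, hvi, star_zero, mul_zero, add_zero, hv' l hl, mul_assoc,
      inv_mul_cancel₀ h0', mul_one, add_neg_cancel]
  have h2 : P.toMatrix y' j i = P.toMatrix y j i := by
    rw [hy', toMatrix_colU_smul, hvi, star_zero, mul_zero, add_zero, hv, zero_mul, add_zero]
  have h3 : P.toMatrix y' i j = P.toMatrix y i j := by
    rw [← star_toMatrix_apply, h2, star_toMatrix_apply]
  have h4 : ∀ l, P.toMatrix y l i = 0 → P.toMatrix y l j = 0 →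
      ∀ m, P.toMatrix y' l m = P.toMatrix y l m := by
    intro l hl hlj m
    have hl' : l ≠ j := by
      rintro rfl
      exact h0' hl
    rw [hy', toMatrix_colU_smul, hv' l hl', hl, hlj]
    simp
  let w : Fin n → P.D := fun l => if l = i then 0 else if l = j then
      -(algebraMap k P.D 2⁻¹ * P.toMatrix y' j j) * (P.toMatrix y i j)⁻¹
    else -P.toMatrix y' l j * (P.toMatrix y i j)⁻¹
  have hw : w i = 0 := if_pos rfl
  have hwj : w j = -(algebraMap k P.D 2⁻¹ * P.toMatrix y' j j) * (P.toMatrix y i j)⁻¹ := by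
    simp only [w, if_neg hij.symm, if_true]
  have hw' : ∀ l, l ≠ i → l ≠ j → w l = -P.toMatrix y' l j * (P.toMatrix y i j)⁻¹ := by
    intro l hl hl'
    simp only [w, if_neg hl, if_neg hl']
  clear_value w
  refine ⟨v, hv, w, hw, hv', hw', hwj, fun l hl => ?_, fun l hl => ?_, ?_, fun l hl hl' m => ?_⟩
  · rw [toMatrix_colU_smul, hw, star_zero, mul_zero, add_zero, h1 l hl, h1 i hij, mul_zero,
      add_zero]
  · rw [toMatrix_colU_smul, h1 i hij, mul_zero, add_zero, h3]
    by_cases hlj : l = j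
    · subst hlj
      have hc : w l * P.toMatrix y i l = -(algebraMap k P.D 2⁻¹ * P.toMatrix y' l l) := by
        rw [hwj, mul_assoc, inv_mul_cancel₀ h0, mul_one]
      have hc' : P.toMatrix y' l i * star (w l) = -(algebraMap k P.D 2⁻¹ * P.toMatrix y' l l) := by
        rw [h2, ← star_toMatrix_apply, ← star_mul, hc, star_neg, star_mul, star_toMatrix_apply,
          star_algebraMap, Algebra.commutes]
      have hs : algebraMap k P.D 2⁻¹ * P.toMatrix y' l l + algebraMap k P.D 2⁻¹ * P.toMatrix y' l l
          = P.toMatrix y' l l := by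
        rw [← add_mul, ← map_add, ← two_mul, mul_inv_cancel₀ P.two_ne_zero', map_one, one_mul]
      rw [hc, hc']
      nth_rewrite 1 [← hs]
      abel
    · rw [h1 l hlj, zero_mul, add_zero, hw' l hl hlj, mul_assoc, inv_mul_cancel₀ h0, mul_one,
        add_neg_cancel]
  · rw [toMatrix_colU_smul, hw, zero_mul, zero_mul, add_zero, add_zero, h1 i hij, zero_mul,
      add_zero, h3]
  · have hli : l ≠ i := by
      rintro rfl
      exact h0 hl'
    have hlj : l ≠ j := by
      rintro rfl
      exact h0' hl
    have h5 : w l = 0 := by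
      rw [hw' l hli hlj, h4 l hl hl', hl', neg_zero, zero_mul]
    rw [toMatrix_colU_smul, h5, h1 l hlj, h4 l hl hl']
    simp

/-! ### Orbits of the Borel subgroup -/

/-- Elimination on the rows in `S`, the other ones being rows of a permutation matrix already. With
the first row in `S` and its first nonzero entry as pivot, all the operations are lower triangular.
A diagonal pivot is normalized using the surjectivity of the reduced norm of `D`. -/
theorem exists_B_smul_of_active (S : Finset (Fin n)) : ∀ y : P.X n,
    (∀ i, i ∉ S → ∃ j, j ∉ S ∧ ∀ l, P.toMatrix y i l = if l = j then 1 else 0) →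
    ∃ b ∈ P.B n, ∀ i, ∃ j, ∀ l, P.toMatrix (b • y) i l = if l = j then 1 else 0 := by
  classical
  induction S using Finset.strongInduction with
  | H S ih =>
  intro y hS
  rcases S.eq_empty_or_nonempty with rfl | hne
  · refine ⟨1, (P.B n).one_mem, fun i => ?_⟩
    obtain ⟨j, -, hj⟩ := hS i (Finset.notMem_empty i)
    exact ⟨j, by rwa [one_smul]⟩
  have hrow : ∀ i ∈ S, ∀ l, l ∉ S → P.toMatrix y l i = 0 := by
    intro i hi l hl
    obtain ⟨j, hj, hj'⟩ := hS l hl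
    rw [hj', if_neg]
    rintro rfl
    exact hj hi
  have hrow' : ∀ i ∈ S, ∀ l, l ∉ S → P.toMatrix y i l = 0 := by
    intro i hi l hl
    rw [← star_toMatrix_apply, hrow i hi l hl, star_zero]
  obtain ⟨i, hi, himin⟩ : ∃ i ∈ S, ∀ l ∈ S, i ≤ l := ⟨S.min' hne, S.min'_mem hne, S.min'_le⟩
  have hTne : (S.filter fun l => P.toMatrix y i l ≠ 0).Nonempty := by
    obtain ⟨l, hl⟩ := P.exists_toMatrix_ne_zero y i
    refine ⟨l, Finset.mem_filter.2 ⟨?_, hl⟩⟩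
    by_contra hc
    exact hl (hrow' i hi l hc)
  obtain ⟨j, hjT, hjmin⟩ : ∃ j ∈ S.filter fun l => P.toMatrix y i l ≠ 0,
      ∀ l ∈ S.filter fun l => P.toMatrix y i l ≠ 0, j ≤ l :=
    ⟨_, Finset.min'_mem _ hTne, Finset.min'_le _⟩
  obtain ⟨hj, hij0⟩ := Finset.mem_filter.1 hjT
  have hlt : ∀ l < j, P.toMatrix y i l = 0 := by
    intro l hl
    by_contra hc
    by_cases hlS : l ∈ S
    · exact absurd (hjmin l (Finset.mem_filter.2 ⟨hlS, hc⟩)) (not_le.2 hl)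
    · exact hc (hrow' i hi l hlS)
  have hlt' : ∀ l < j, P.toMatrix y l i = 0 := fun l hl => by
    rw [← star_toMatrix_apply, hlt l hl, star_zero]
  rcases eq_or_ne i j with rfl | hij
  · -- the pivot is on the diagonal
    obtain ⟨v, hv, hv', h1, h2, h3⟩ := split_line y i hij0
    have hself := eq_algebraMap_of_star (P.star_toMatrix_apply y i i)
    set a := (P.toMatrix y i i).re
    have ha : a ≠ 0 := by
      intro h
      rw [h, map_zero] at hself
      exact hij0 hself
    obtain ⟨c, hc⟩ := P.exists_nm_eq a⁻¹
    have hc0 : c ≠ 0 := by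
      rintro rfl
      rw [nm_zero, eq_comm, inv_eq_zero] at hc
      exact ha hc
    obtain ⟨b, hb, hb'⟩ := ih (S.erase i) (Finset.erase_ssubset hi)
      (P.diagOne i c hc0 • P.colU i v hv • y) (by
        intro l hl
        by_cases hli : l = i
        · subst hli
          refine ⟨l, hl, fun m => ?_⟩
          rw [toMatrix_diagOne_smul]
          by_cases hm : m = l
          · subst hm
            rw [if_pos rfl, if_pos rfl, h2, hself, ← Algebra.commutes, mul_assoc, mul_star_self,
              ← map_mul, hc, mul_inv_cancel₀ ha, map_one]
          · rw [if_neg hm, if_neg hm, ← star_toMatrix_apply, h1 m hm]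
            simp
        · have hlS : l ∉ S := fun h => hl (Finset.mem_erase.2 ⟨hli, h⟩)
          obtain ⟨j, hj1, hj2⟩ := hS l hlS
          refine ⟨j, fun h => hj1 (Finset.mem_of_mem_erase h), fun m => ?_⟩
          rw [toMatrix_diagOne_smul, if_neg hli, one_mul, h3 l (hrow i hi l hlS)]
          by_cases hm : m = i
          · have hmj : m ≠ j := by
              rintro rfl
              exact hj1 (hm ▸ hi)
            rw [hj2, if_neg hmj, zero_mul]
          · rw [if_neg hm, star_one, mul_one, hj2])
    refine ⟨b * (P.diagOne i c hc0 * P.colU i v hv), ?_, ?_⟩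
    · refine (P.B n).mul_mem hb ((P.B n).mul_mem (P.diagOne_mem_B _ _ _)
        (P.colU_mem_B hv fun l hl => ?_))
      rw [hv' l hl.ne, hlt' l hl, neg_zero, zero_mul]
    · rwa [mul_smul, mul_smul]
  · -- the pivot is off the diagonal, and splits off a hyperbolic plane
    have hijlt : i < j := lt_of_le_of_ne (himin j hj) hij
    have hii : P.toMatrix y i i = 0 := hlt i hijlt
    obtain ⟨v, hv, w, hw, hv', hw', hwj, h1, h2, h3, h4⟩ := split_plane y hij hii hij0
    have hc0 : star (P.toMatrix y i j)⁻¹ ≠ 0 := star_ne_zero.2 (inv_ne_zero hij0)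
    have hvB : P.colU j v hv ∈ P.B n := P.colU_mem_B hv fun l hl => by
      rw [hv' l hl.ne, hlt' l hl, neg_zero, zero_mul]
    have hwB : P.colU i w hw ∈ P.B n := P.colU_mem_B hw fun l hl => by
      have hlS : l ∉ S := fun h => absurd (himin l h) (not_le.2 hl)
      have hlj : l ≠ j := (hl.trans hijlt).ne
      rw [hw' l hl.ne hlj, toMatrix_colU_smul, hv' l hlj, hrow j hj l hlS, hrow i hi l hlS]
      simp
    set y'' := P.colU i w hw • P.colU j v hv • y with hy''
    set c := star (P.toMatrix y i j)⁻¹ with hc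
    have hci : P.toMatrix y'' i j * star c = 1 := by
      rw [h3, hc, star_star, mul_inv_cancel₀ hij0]
    obtain ⟨b, hb, hb'⟩ := ih ((S.erase i).erase j)
      ((Finset.erase_subset _ _).trans_ssubset (Finset.erase_ssubset hi))
      (P.diagOne j c hc0 • y'') (by
        intro l hl
        by_cases hli : l = i
        · subst hli
          refine ⟨j, Finset.notMem_erase _ _, fun m => ?_⟩
          rw [toMatrix_diagOne_smul, if_neg hij, one_mul]
          by_cases hm : m = j
          · subst hm
            rw [if_pos rfl, if_pos rfl, hci]
          · rw [if_neg hm, if_neg hm, ← star_toMatrix_apply, h1 m hm]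
            simp
        by_cases hlj : l = j
        · subst hlj
          refine ⟨i, fun h => Finset.notMem_erase i S (Finset.mem_of_mem_erase h), fun m => ?_⟩
          rw [toMatrix_diagOne_smul, if_pos rfl]
          by_cases hm : m = i
          · subst hm
            rw [if_neg hij, if_pos rfl, star_one, mul_one, ← star_toMatrix_apply, ← star_star c,
              ← star_mul, hci, star_one]
          · rw [if_neg hm, ← star_toMatrix_apply, h2 m hm]
            simp
        · have hlS : l ∉ S := fun h => hl (Finset.mem_erase.2 ⟨hlj, Finset.mem_erase.2 ⟨hli, h⟩⟩)
          obtain ⟨t, ht1, ht2⟩ := hS l hlS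
          refine ⟨t, fun h => ht1 (Finset.mem_of_mem_erase (Finset.mem_of_mem_erase h)),
            fun m => ?_⟩
          rw [toMatrix_diagOne_smul, if_neg hlj, one_mul, h4 l (hrow i hi l hlS) (hrow j hj l hlS)]
          by_cases hm : m = j
          · have hmt : m ≠ t := by
              rintro rfl
              exact ht1 (hm ▸ hj)
            rw [ht2, if_neg hmt, zero_mul]
          · rw [if_neg hm, star_one, mul_one, ht2])
    refine ⟨b * (P.diagOne j c hc0 * (P.colU i w hw * P.colU j v hv)), ?_, ?_⟩
    · exact (P.B n).mul_mem hb ((P.B n).mul_mem (P.diagOne_mem_B _ _ _)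
        ((P.B n).mul_mem hwB hvB))
    · rwa [mul_smul, mul_smul, mul_smul]

/-- The permutation matrix of an involution, as a hermitian form. -/
def permX (P : QuatData k) (σ : Equiv.Perm (Fin n)) (hσ : ∀ i, σ (σ i) = i) : P.X n :=
  ⟨P.permU σ, Units.ext (by
    ext1 i j
    rw [Units.coe_star, Matrix.star_apply]
    have : i = σ j ↔ j = σ i := by
      constructor <;> rintro rfl <;> rw [hσ]
    by_cases h : j = σ i
    · simp [permU, h, hσ]
    · simp [permU, h, mt this.1 h])⟩

theorem toMatrix_permX (σ : Equiv.Perm (Fin n)) (hσ : ∀ i, σ (σ i) = i) (i j : Fin n) :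
    P.toMatrix (P.permX σ hσ) i j = if j = σ i then 1 else 0 := rfl

/-- Every `B`-orbit in `X` contains the permutation matrix of an involution. -/
theorem exists_B_smul_eq_permX (y : P.X n) :
    ∃ b ∈ P.B n, ∃ (σ : Equiv.Perm (Fin n)) (hσ : ∀ i, σ (σ i) = i), b • y = P.permX σ hσ := by
  obtain ⟨b, hb, h⟩ := exists_B_smul_of_active Finset.univ y
    fun i hi => absurd (Finset.mem_univ i) hi
  choose f hf using h
  have hff : ∀ i, f (f i) = i := by
    intro i
    have h1 : P.toMatrix (b • y) (f i) i = 1 := by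
      rw [← star_toMatrix_apply, hf i, if_pos rfl, star_one]
    rw [hf] at h1
    by_contra hc
    rw [if_neg (Ne.symm hc)] at h1
    exact zero_ne_one h1
  exact ⟨b, hb, ⟨f, f, hff, hff⟩, hff, P.toMatrix_injective (by ext1 i j; exact hf i j)⟩

/-- The group `G` acts transitively on `X`. -/
theorem exists_smul_one_eq (y : P.X n) : ∃ g : P.G n, g • (⟨1, star_one _⟩ : P.X n) = y := by
  obtain ⟨b, -, σ, hσ, hb⟩ := exists_B_smul_eq_permX y
  suffices h : ∃ g : P.G n, g • (⟨1, star_one _⟩ : P.X n) = P.permX σ hσ by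
    obtain ⟨g, hg⟩ := h
    exact ⟨b⁻¹ * g, by rw [mul_smul, hg, ← hb, inv_smul_smul]⟩
  -- the form on a plane exchanged by `σ` is the orthogonal sum of `⟨1⟩` and `⟨-1⟩`, and `-1` is a
  -- reduced norm
  obtain ⟨z, hz⟩ := P.exists_nm_eq (-1)
  have hz' : z * star z = -1 := by rw [mul_star_self, hz, map_neg, map_one]
  let t : P.D := algebraMap k P.D 2⁻¹
  have htt : t + t = 1 := by
    rw [← map_add, ← two_mul, mul_inv_cancel₀ P.two_ne_zero', map_one]
  have hst : star t = t := P.star_algebraMap _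
  let A : Matrix (Fin n) (Fin n) P.D := Matrix.of fun i j =>
    if σ i = i then (if j = i then 1 else 0)
    else if i < σ i then (if j = i then 1 else if j = σ i then z else 0)
    else (if j = σ i then t else if j = i then -(t * z) else 0)
  have hfix : ∀ i, σ i = i → ∀ l, A i l = if l = i then 1 else 0 := fun i hi l => by
    simp only [A, Matrix.of_apply, if_pos hi]
  have hlt : ∀ i, i < σ i → ∀ l, A i l = if l = i then 1 else if l = σ i then z else 0 :=
    fun i hi l => by simp only [A, Matrix.of_apply, if_neg hi.ne', if_pos hi]
  have hgt : ∀ i, σ i < i → ∀ l, A i l = if l = σ i then t else if l = i then -(t * z) else 0 :=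
    fun i hi l => by simp only [A, Matrix.of_apply, if_neg hi.ne, if_neg hi.not_gt]
  have hsupp : ∀ i l, l ≠ i → l ≠ σ i → A i l = 0 := by
    intro i l h1 h2
    rcases lt_trichotomy i (σ i) with h | h | h
    · rw [hlt i h, if_neg h1, if_neg h2]
    · rw [hfix i h.symm, if_neg h1]
    · rw [hgt i h, if_neg h2, if_neg h1]
  have hA : A * star A = P.toMatrix (P.permX σ hσ) := by
    ext1 i j
    rw [toMatrix_permX, Matrix.mul_apply]
    simp only [Matrix.star_apply]
    by_cases hj : j = i ∨ j = σ i
    · rcases lt_trichotomy i (σ i) with h | h | h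
      · rw [Fintype.sum_eq_add i (σ i) h.ne fun l hl => by
          rw [hsupp i l hl.1 hl.2, zero_mul]]
        have hσi : σ (σ i) < σ i := by rwa [hσ]
        rcases hj with rfl | rfl
        · rw [hlt _ h, hlt _ h]
          simp [h.ne, h.ne', hz']
        · rw [hlt _ h, hlt _ h, hgt _ hσi, hgt _ hσi]
          simp [hσ, h.ne', hst, ← mul_assoc, hz', htt]
      · rw [Fintype.sum_eq_single i fun l hl => by rw [hsupp i l hl (h ▸ hl), zero_mul]]
        have hj' : j = i := by
          rcases hj with h1 | h1
          · exact h1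
          · rw [h1, ← h]
        subst hj'
        rw [hfix _ h.symm]
        simp [← h]
      · rw [Fintype.sum_eq_add i (σ i) h.ne' fun l hl => by
          rw [hsupp i l hl.1 hl.2, zero_mul]]
        have hσi : σ i < σ (σ i) := by rwa [hσ]
        rcases hj with rfl | rfl
        · rw [hgt _ h, hgt _ h]
          have h1 : t * z * (star z * t) = -(t * t) := by
            rw [mul_assoc, ← mul_assoc z, hz', neg_one_mul, mul_neg]
          simp [h.ne', h1, hst]
        · rw [hgt _ h, hgt _ h, hlt _ hσi, hlt _ hσi]
          simp [hσ, h.ne', mul_assoc, hz', htt]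
    · push Not at hj
      rw [if_neg hj.2]
      refine Finset.sum_eq_zero fun l _ => ?_
      by_cases h1 : l = i
      · rw [h1, hsupp j i hj.1.symm (fun h => hj.2 (by rw [h, hσ])), star_zero, mul_zero]
      by_cases h2 : l = σ i
      · rw [h2, hsupp j (σ i) hj.2.symm (fun h => hj.1 (σ.injective h).symm), star_zero, mul_zero]
      · rw [hsupp i l h1 h2, zero_mul]
  have hAu : IsUnit A := isUnit_of_mul_eq_one
    (C := star A * ((P.permX σ hσ).1⁻¹ : P.G n)) (by
      rw [← mul_assoc, hA]
      exact Units.mul_inv _)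
  refine ⟨hAu.unit, P.toMatrix_injective ?_⟩
  rw [toMatrix_smul, ← hA]
  change A * 1 * star A = _
  rw [mul_one]

end Elementary

end QuatData

namespace QuatData

variable {k : Type*} [NontriviallyNormedField k] [IsUltrametricDist k]

/-! ### The Iwasawa and Cartan decompositions -/

section Decomposition

variable {P : QuatData k} {n : ℕ}

theorem star_mem_K {g : P.G n} (hg : g ∈ P.K n) : star g ∈ P.K n := by
  have h : ∀ {x : P.D}, x ∈ P.maxOrder → star x ∈ P.maxOrder := by
    rintro x ⟨h1, h2, h3, h4⟩
    refine ⟨?_, ?_, ?_, ?_⟩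
    · simpa using h1
    · simpa using h2
    · simpa using h3
    · simpa using h4
  refine ⟨fun i j => h (hg.1 j i), fun i j => ?_⟩
  rw [← star_inv]
  exact h (hg.2 j i)

variable [CompleteSpace k] [P.IsOddLocal]

/-- Row operations over `𝒪` clear a column above the place `p`, without changing the rows below
`p`. -/
theorem exists_K_clear_column {ι : Type*} (A : Matrix (Fin n) ι P.D) (p : Fin n) (c : ι) :
    ∃ κ ∈ P.K n, (∀ l < p, ((κ : Matrix (Fin n) (Fin n) P.D) * A) l c = 0) ∧
      (∀ l, p < l → ∀ m, ((κ : Matrix (Fin n) (Fin n) P.D) * A) l m = A l m) ∧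
      ∀ m, (∀ l ≤ p, A l m = 0) → ∀ l ≤ p, ((κ : Matrix (Fin n) (Fin n) P.D) * A) l m = 0 := by
  obtain ⟨i, hi, hmax⟩ := (Finset.univ.filter fun l => l ≤ p).exists_max_image
    (fun l => P.dn (A l c)) ⟨p, by simp⟩
  simp only [Finset.mem_filter, Finset.mem_univ, true_and] at hi hmax
  by_cases h0 : A i c = 0
  · refine ⟨1, (P.K n).one_mem, fun l hl => ?_, fun l _ m => ?_, fun m hm l hl => ?_⟩ <;>
      rw [Units.val_one, Matrix.one_mul]
    · have := hmax l hl.le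
      rw [h0, dn_zero] at this
      exact P.dn_eq_zero_iff.1 (le_antisymm this (P.dn_nonneg _))
    · exact hm l hl
  let s := Equiv.swap i p
  have hs : ∀ l ≤ p, s l ≤ p := by
    intro l hl
    simp only [s, Equiv.swap_apply_def]
    split_ifs
    exacts [le_rfl, hi, hl]
  have hs' : ∀ l, p < l → s l = l := fun l hl =>
    Equiv.swap_apply_of_ne_of_ne (lt_of_le_of_lt hi hl).ne' hl.ne'
  have hsp : s p = i := Equiv.swap_apply_right _ _
  let v : Fin n → P.D := fun l => if l < p then -A (s l) c * (A i c)⁻¹ else 0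
  have hv : v p = 0 := if_neg (lt_irrefl p)
  have key : ∀ l m, (((P.colU p v hv * P.permU s : P.G n) : Matrix (Fin n) (Fin n) P.D) * A) l m =
      A (s l) m + v l * A i m := by
    intro l m
    rw [Units.val_mul, Matrix.mul_assoc, colU_mul_apply, permU_mul_apply, permU_mul_apply, hsp]
  refine ⟨P.colU p v hv * P.permU s, (P.K n).mul_mem (P.colU_mem_K hv fun l => ?_)
    (P.permU_mem_K s), fun l hl => ?_, fun l hl m => ?_, fun m hm l hl => ?_⟩
  · rw [mem_maxOrder_iff]
    by_cases hl : l < p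
    · simp only [v, if_pos hl]
      rw [dn_mul, dn_inv, dn_neg]
      exact div_le_one_of_le₀ (hmax _ (hs l hl.le)) (P.dn_nonneg _)
    · simp only [v, if_neg hl, dn_zero, zero_le_one]
  · rw [key]
    simp only [v, if_pos hl]
    rw [mul_assoc, inv_mul_cancel₀ h0, mul_one, add_neg_cancel]
  · rw [key, hs' l hl]
    simp only [v, if_neg hl.not_gt, zero_mul, add_zero]
  · rw [key, hm _ (hs l hl), hm i hi, mul_zero, add_zero]

/-- The Iwasawa decomposition `G = K B`. -/
theorem exists_K_mul_mem_B (g : P.G n) : ∃ κ ∈ P.K n, κ * g ∈ P.B n := by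
  have claim : ∀ m ≤ n, ∀ g : P.G n,
      (∀ i l : Fin n, i < l → m ≤ l.val → (g : Matrix (Fin n) (Fin n) P.D) i l = 0) →
      ∃ κ ∈ P.K n, κ * g ∈ P.B n := by
    intro m
    induction m with
    | zero =>
      intro _ g hg
      exact ⟨1, (P.K n).one_mem, by rw [one_mul]; exact fun i l h => hg i l h (Nat.zero_le _)⟩
    | succ m ih =>
      intro hm g hg
      let p : Fin n := ⟨m, hm⟩
      obtain ⟨κ, hκ, h1, h2, h3⟩ := exists_K_clear_column (g : Matrix (Fin n) (Fin n) P.D) p p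
      obtain ⟨κ', hκ', h⟩ := ih (Nat.le_of_succ_le hm) (κ * g) (by
        intro i l hil hl
        rw [Units.val_mul]
        rcases Nat.eq_or_lt_of_le hl with h | h
        · have : l = p := Fin.ext h.symm
          subst this
          exact h1 i hil
        · rcases le_or_gt i p with hi | hi
          · exact h3 l (fun l' hl' => hg l' l (lt_of_le_of_lt hl' h) h) i hi
          · rw [h2 i hi]
            exact hg i l hil h)
      exact ⟨κ' * κ, (P.K n).mul_mem hκ' hκ, by rwa [mul_assoc]⟩
  exact claim n le_rfl g fun i l _ h => absurd l.isLt (not_lt.2 h)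

/-- The Cartan decomposition: every double coset of `K` in `G` contains a diagonal matrix. -/
theorem exists_K_mul_mul_K_diagonal (g : P.G n) : ∃ κ ∈ P.K n, ∃ κ' ∈ P.K n,
    ∀ i j, i ≠ j → ((κ * g * κ' : P.G n) : Matrix (Fin n) (Fin n) P.D) i j = 0 := by
  have claim : ∀ m ≤ n, ∀ g : P.G n,
      (∀ i j : Fin n, i ≠ j → m ≤ i.val ∨ m ≤ j.val →
        (g : Matrix (Fin n) (Fin n) P.D) i j = 0) →
      ∃ κ ∈ P.K n, ∃ κ' ∈ P.K n,
        ∀ i j, i ≠ j → ((κ * g * κ' : P.G n) : Matrix (Fin n) (Fin n) P.D) i j = 0 := by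
    intro m
    induction m with
    | zero =>
      intro _ g hg
      exact ⟨1, (P.K n).one_mem, 1, (P.K n).one_mem, fun i j hij => by
        rw [one_mul, mul_one]; exact hg i j hij (Or.inl (Nat.zero_le _))⟩
    | succ m ih =>
      intro hm g hg
      let p : Fin n := ⟨m, hm⟩
      have hp : ∀ l : Fin n, p < l ↔ m + 1 ≤ l.val := fun l => Iff.rfl
      obtain ⟨⟨i₀, j₀⟩, hij, hmax⟩ := (Finset.univ.filter fun q : Fin n × Fin n =>
        q.1 ≤ p ∧ q.2 ≤ p).exists_max_image
        (fun q => P.dn ((g : Matrix (Fin n) (Fin n) P.D) q.1 q.2)) ⟨(p, p), by simp⟩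
      simp only [Finset.mem_filter, Finset.mem_univ, true_and, Prod.forall, and_imp] at hij hmax
      obtain ⟨hi₀, hj₀⟩ := hij
      have hpiv : (g : Matrix (Fin n) (Fin n) P.D) i₀ j₀ ≠ 0 := by
        obtain ⟨l, hl⟩ := P.exists_row_ne_zero g p
        have hlp : l ≤ p := by
          by_contra hc
          push Not at hc
          exact hl (hg p l hc.ne (Or.inr hc))
        intro h0
        have := hmax p l le_rfl hlp
        rw [h0, dn_zero] at this
        exact hl (P.dn_eq_zero_iff.1 (le_antisymm this (P.dn_nonneg _)))
      have hswap : ∀ i ≤ p, (∀ l ≤ p, Equiv.swap i p l ≤ p) ∧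
          (∀ l, p < l → Equiv.swap i p l = l) := by
        intro i hi
        refine ⟨fun l hl => ?_, fun l hl =>
          Equiv.swap_apply_of_ne_of_ne (lt_of_le_of_lt hi hl).ne' hl.ne'⟩
        rw [Equiv.swap_apply_def]
        split_ifs
        exacts [le_rfl, hi, hl]
      let s := Equiv.swap i₀ p
      let t := Equiv.swap j₀ p
      let g' : P.G n := P.permU s * g * P.permU t
      have hg' : ∀ l c, (g' : Matrix (Fin n) (Fin n) P.D) l c =
          (g : Matrix (Fin n) (Fin n) P.D) (s l) (t c) := by
        intro l c
        simp only [g', Units.val_mul]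
        rw [mul_permU_apply, permU_mul_apply, Equiv.symm_swap]
      have hpp : (g' : Matrix (Fin n) (Fin n) P.D) p p ≠ 0 := by
        rw [hg', Equiv.swap_apply_right, Equiv.swap_apply_right]
        exact hpiv
      have hbd : ∀ l ≤ p, ∀ c ≤ p, P.dn ((g' : Matrix (Fin n) (Fin n) P.D) l c) ≤
          P.dn ((g' : Matrix (Fin n) (Fin n) P.D) p p) := by
        intro l hl c hc
        rw [hg', hg' p p, Equiv.swap_apply_right, Equiv.swap_apply_right]
        exact hmax _ _ ((hswap i₀ hi₀).1 l hl) ((hswap j₀ hj₀).1 c hc)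
      have hz : ∀ l c, l ≠ c → p < l ∨ p < c → (g' : Matrix (Fin n) (Fin n) P.D) l c = 0 := by
        intro l c hlc h
        rw [hg']
        rcases h with h | h
        · rw [(hswap i₀ hi₀).2 l h]
          refine hg _ _ (fun he => hlc ?_) (Or.inl h)
          rw [← (hswap j₀ hj₀).2 l h] at he
          exact t.injective he
        · rw [(hswap j₀ hj₀).2 c h]
          refine hg _ _ (fun he => hlc ?_) (Or.inr h)
          rw [← (hswap i₀ hi₀).2 c h] at he
          exact s.injective he
      let v : Fin n → P.D := fun l => if l < p then -(g' : Matrix (Fin n) (Fin n) P.D) l p *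
        ((g' : Matrix (Fin n) (Fin n) P.D) p p)⁻¹ else 0
      have hv : v p = 0 := if_neg (lt_irrefl p)
      let w : Fin n → P.D := fun c => if c < p then
        star (-(((g' : Matrix (Fin n) (Fin n) P.D) p p)⁻¹ *
          (g' : Matrix (Fin n) (Fin n) P.D) p c)) else 0
      have hw : w p = 0 := if_neg (lt_irrefl p)
      have hvK : P.colU p v hv ∈ P.K n := P.colU_mem_K hv fun l => by
        rw [mem_maxOrder_iff]
        by_cases hl : l < p
        · simp only [v, if_pos hl]
          rw [dn_mul, dn_inv, dn_neg]
          exact div_le_one_of_le₀ (hbd l hl.le p le_rfl) (P.dn_nonneg _)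
        · simp only [v, if_neg hl, dn_zero, zero_le_one]
      have hwK : P.colU p w hw ∈ P.K n := P.colU_mem_K hw fun l => by
        rw [mem_maxOrder_iff]
        by_cases hl : l < p
        · simp only [w, if_pos hl]
          rw [dn_star, dn_neg, dn_mul, dn_inv, mul_comm]
          exact div_le_one_of_le₀ (hbd p le_rfl l hl.le) (P.dn_nonneg _)
        · simp only [w, if_neg hl, dn_zero, zero_le_one]
      let g'' : P.G n := P.colU p v hv * g' * star (P.colU p w hw)
      have hg'' : ∀ l c, (g'' : Matrix (Fin n) (Fin n) P.D) l c =
          (g' : Matrix (Fin n) (Fin n) P.D) l c + v l * (g' : Matrix (Fin n) (Fin n) P.D) p c +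
          ((g' : Matrix (Fin n) (Fin n) P.D) l p + v l * (g' : Matrix (Fin n) (Fin n) P.D) p p) *
            star (w c) := by
        intro l c
        simp only [g'', Units.val_mul, Units.coe_star]
        rw [mul_star_colU_apply, colU_mul_apply, colU_mul_apply]
      have hcol : ∀ l, l ≠ p → (g' : Matrix (Fin n) (Fin n) P.D) l p +
          v l * (g' : Matrix (Fin n) (Fin n) P.D) p p = 0 := by
        intro l hl
        by_cases h : l < p
        · simp only [v, if_pos h]
          rw [mul_assoc, inv_mul_cancel₀ hpp, mul_one, add_neg_cancel]
        · simp only [v, if_neg h]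
          rw [hz l p hl (Or.inl (lt_of_le_of_ne (not_lt.1 h) hl.symm)), zero_mul, add_zero]
      obtain ⟨κ, hκ, κ', hκ', h⟩ := ih (Nat.le_of_succ_le hm) g'' (by
        intro l c hlc h
        rw [hg'']
        by_cases hlp : l = p
        · subst hlp
          rw [hv, zero_mul, zero_mul, add_zero, add_zero]
          by_cases hc : c < p
          · simp only [w, if_pos hc, star_star]
            rw [mul_neg, ← mul_assoc, mul_inv_cancel₀ hpp, one_mul, add_neg_cancel]
          · simp only [w, if_neg hc, star_zero, mul_zero, add_zero]
            exact hz _ _ hlc (Or.inr (lt_of_le_of_ne (not_lt.1 hc) hlc))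
        · rw [hcol l hlp, zero_mul, add_zero]
          by_cases hcp : c = p
          · rw [hcp]
            exact hcol l hlp
          · have h' : p < l ∨ p < c := h.imp
              (fun h => lt_of_le_of_ne (Fin.le_def.2 h) (Ne.symm hlp))
              (fun h => lt_of_le_of_ne (Fin.le_def.2 h) (Ne.symm hcp))
            rw [hz l c hlc h', zero_add]
            rcases h' with h' | h'
            · simp only [v, if_neg h'.not_gt, zero_mul]
            · rw [hz p c h'.ne (Or.inr h'), mul_zero])
      refine ⟨κ * (P.colU p v hv * P.permU s),
        (P.K n).mul_mem hκ ((P.K n).mul_mem hvK (P.permU_mem_K s)),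
        P.permU t * star (P.colU p w hw) * κ',
        (P.K n).mul_mem ((P.K n).mul_mem (P.permU_mem_K t) (star_mem_K hwK)) hκ', ?_⟩
      rw [show κ * (P.colU p v hv * P.permU s) * g *
        (P.permU t * star (P.colU p w hw) * κ') = κ * g'' * κ' by simp only [g'', g', mul_assoc]]
      exact h
  exact claim n le_rfl g fun i j _ h => by
    rcases h with h | h
    · exact absurd i.isLt (not_lt.2 h)
    · exact absurd j.isLt (not_lt.2 h)

/-- The double cosets of `K` in `G` are stable under the conjugate transpose. -/
theorem exists_star_eq (g : P.G n) : ∃ κ ∈ P.K n, ∃ κ' ∈ P.K n, star g = κ * g * κ' := by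
  obtain ⟨κ₁, h₁, κ₂, h₂, hd⟩ := exists_K_mul_mul_K_diagonal g
  obtain ⟨δ, hδ⟩ : ∃ δ, δ = κ₁ * g * κ₂ := ⟨_, rfl⟩
  rw [← hδ] at hd
  let e : Fin n → P.D := fun i => (δ : Matrix (Fin n) (Fin n) P.D) i i
  have he : ∀ i, e i ≠ 0 := by
    intro i h
    obtain ⟨l, hl⟩ := P.exists_row_ne_zero δ i
    by_cases hil : i = l
    · subst hil
      exact hl h
    · exact hl (hd i l hil)
  have hee : ∀ i, star (e i) * (e i)⁻¹ ≠ 0 := fun i =>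
    mul_ne_zero (star_ne_zero.2 (he i)) (inv_ne_zero (he i))
  let w := P.diagU (fun i => star (e i) * (e i)⁻¹) hee
  have hw : w ∈ P.K n := P.diagU_mem_K hee fun i => by
    rw [dn_mul, dn_star, dn_inv, mul_inv_cancel₀ (P.dn_pos (he i)).ne']
  have hδdiag : (δ : Matrix (Fin n) (Fin n) P.D) = Matrix.diagonal e := by
    ext1 i j
    by_cases hij : i = j
    · subst hij
      rw [Matrix.diagonal_apply_eq]
    · rw [Matrix.diagonal_apply_ne _ hij, hd i j hij]
  have hstar : star δ = w * δ := by
    refine Units.ext ?_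
    rw [Units.coe_star, Units.val_mul, hδdiag]
    simp only [w, diagU]
    rw [Matrix.diagonal_mul_diagonal, Matrix.star_eq_conjTranspose,
      Matrix.diagonal_conjTranspose]
    congr 1
    ext1 i
    rw [mul_assoc, inv_mul_cancel₀ (he i), mul_one]
    rfl
  have hg : g = κ₁⁻¹ * δ * κ₂⁻¹ := by rw [hδ]; group
  refine ⟨star κ₂⁻¹ * w * κ₁, (P.K n).mul_mem ((P.K n).mul_mem
    (star_mem_K ((P.K n).inv_mem h₂)) hw) h₁, κ₂ * star κ₁⁻¹,
    (P.K n).mul_mem h₂ (star_mem_K ((P.K n).inv_mem h₁)), ?_⟩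
  calc star g = star κ₂⁻¹ * star δ * star κ₁⁻¹ := by
        nth_rewrite 1 [hg]
        rw [star_mul, star_mul, mul_assoc]
    _ = star κ₂⁻¹ * w * κ₁ * g * (κ₂ * star κ₁⁻¹) := by
        rw [hstar, hδ]
        group

end Decomposition

end QuatData

/-! ### Orbits of the maximal compact subgroup -/

theorem zero_mem_Lam (n : ℕ) : (fun _ => 0 : Fin n → ℤ) ∈ Lam n :=
  ⟨fun _ _ _ => le_rfl, fun _ h => absurd h (Int.not_odd_iff_even.2 Even.zero)⟩

section Extend

variable {n : ℕ} {α : Fin n → ℤ}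

/-- Prescribing an even entry at place `m`, where `α` is even up to that place. -/
theorem extend_even (hα : α ∈ Lam n) {m : ℕ} (hm : m < n) (hev : ∀ l : Fin n, l.val ≤ m → Even (α l))
    (e : ℤ) (he : ∀ i : Fin n, m < i.val → α i ≤ 2 * e) :
    ∃ β ∈ Lam n, (∀ l : Fin n, l.val < m → Even (β l)) ∧ β ⟨m, hm⟩ = 2 * e ∧
      (∀ i : Fin n, m < i.val → β i = α i) ∧
      ∀ i : Fin n, m < i.val → ¬ Even (α i) → rankBefore β i = rankBefore α i := by
  let β : Fin n → ℤ := fun l => if l.val < m then 2 * |e| else if l.val = m then 2 * e else α l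
  have hev' : ∀ l : Fin n, l.val ≤ m → Even (β l) := by
    intro l hl
    simp only [β]
    split_ifs with h1 h2
    · exact even_two_mul _
    · exact even_two_mul _
    · omega
  have hβ : ∀ i : Fin n, m < i.val → β i = α i := by
    intro i hi
    simp only [β]
    rw [if_neg (by omega), if_neg (by omega)]
  have hodd : ∀ c : ℤ, ¬ Even c → ∀ l, β l = c ↔ α l = c := by
    intro c hc l
    rcases le_or_gt l.val m with h | h
    · exact ⟨fun h' => absurd (h' ▸ hev' l h) hc, fun h' => absurd (h' ▸ hev l h) hc⟩
    · rw [hβ l h]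
  refine ⟨β, ⟨?_, ?_⟩, fun l hl => hev' l hl.le, ?_, hβ, ?_⟩
  · intro i j hij
    have hij' : i.val ≤ j.val := hij
    have h1 := hα.1 hij
    have h2 := le_abs_self e
    simp only [β]
    split_ifs <;>
      first
        | exact le_rfl
        | exact h1
        | omega
        | (have h3 := he j (by omega); omega)
  · intro i hi
    have hi' := Int.not_even_iff_odd.2 hi
    have hαi : α i = β i := (hodd _ hi' i).1 rfl
    have := hα.2 i (hαi ▸ hi)
    rw [hαi] at this
    simpa only [hodd _ hi'] using this
  · simp [β]
  · intro i hi ho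
    unfold rankBefore
    rw [hβ i hi]
    simp only [hodd _ ho]

/-- Prescribing a pair of odd entries at the places `m`, `m + 1`, where `α` is even up to that
place. -/
theorem extend_odd (hα : α ∈ Lam n) {m : ℕ} (hm : m + 1 < n)
    (hev : ∀ l : Fin n, l.val ≤ m + 1 → Even (α l))
    (e : ℤ) (he : ∀ i : Fin n, m + 1 < i.val → α i ≤ 2 * e + 1) :
    ∃ β ∈ Lam n, (∀ l : Fin n, l.val < m → Even (β l)) ∧ β ⟨m, by omega⟩ = 2 * e + 1 ∧
      β ⟨m + 1, hm⟩ = 2 * e + 1 ∧ rankBefore β ⟨m, by omega⟩ = 0 ∧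
      rankBefore β ⟨m + 1, hm⟩ = 1 ∧
      (∀ i : Fin n, m + 1 < i.val → β i = α i) ∧
      ∀ i : Fin n, m + 1 < i.val → ¬ Even (α i) →
        (Even (rankBefore β i) ↔ Even (rankBefore α i)) := by
  let β : Fin n → ℤ := fun l => if l.val < m then 2 * |e| + 2 else if l.val ≤ m + 1 then 2 * e + 1
    else α l
  let o : Fin n := ⟨m, by omega⟩
  let p : Fin n := ⟨m + 1, hm⟩
  have hop : o ≠ p := fun h => by
    have := congrArg Fin.val h
    simp [o, p] at this
  have hev' : ∀ l : Fin n, l.val < m → Even (β l) := by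
    intro l hl
    simp only [β, if_pos hl]
    exact ⟨|e| + 1, by ring⟩
  have hβ : ∀ i : Fin n, m + 1 < i.val → β i = α i := by
    intro i hi
    simp only [β]
    rw [if_neg (by omega), if_neg (by omega)]
  have hβo : β o = 2 * e + 1 := by simp [β, o]
  have hβp : β p = 2 * e + 1 := by simp [β, p]
  have hne : ∀ c : ℤ, ¬ Even c → ∀ l, β l = c ↔ α l = c ∨ ((l = o ∨ l = p) ∧ c = 2 * e + 1) := by
    intro c hc l
    rcases lt_or_ge l.val m with h | h
    · have h1 : l ≠ o := fun h' => by rw [h'] at h; exact lt_irrefl m h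
      have h2 : l ≠ p := fun h' => by rw [h'] at h; simp [p] at h
      have h3 : α l ≠ c := fun h' => hc (h' ▸ hev l (by omega))
      have h4 : β l ≠ c := fun h' => hc (h' ▸ hev' l h)
      simp [h1, h2, h3, h4]
    rcases le_or_gt l.val (m + 1) with h' | h'
    · have h1 : l = o ∨ l = p := by
        rcases Nat.eq_or_lt_of_le h with h2 | h2
        · exact Or.inl (Fin.ext h2.symm)
        · exact Or.inr (Fin.ext (show l.val = m + 1 by omega))
      have h3 : α l ≠ c := fun h' => hc (h' ▸ hev l (by omega))
      have h4 : β l = 2 * e + 1 := by rcases h1 with rfl | rfl <;> assumption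
      simp [h1, h3, h4, eq_comm]
    · have h1 : l ≠ o := fun h2 => by rw [h2] at h'; simp [o] at h'
      have h2 : l ≠ p := fun h2 => by rw [h2] at h'; simp [p] at h'
      simp [h1, h2, hβ l h']
  have hαop : ∀ c : ℤ, ¬ Even c → α o ≠ c ∧ α p ≠ c := by
    intro c hc
    exact ⟨fun h => hc (h ▸ hev o (by simp [o])), fun h => hc (h ▸ hev p le_rfl)⟩
  have hrank : rankBefore β o = 0 := by
    unfold rankBefore
    rw [Finset.card_eq_zero, Finset.filter_eq_empty_iff]
    rintro l - ⟨hl, hl'⟩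
    rw [hβo] at hl'
    have := hev' l hl
    rw [hl'] at this
    exact absurd this (by simp [parity_simps])
  refine ⟨β, ⟨?_, ?_⟩, hev', hβo, hβp, hrank, ?_, hβ, ?_⟩
  · intro i j hij
    have hij' : i.val ≤ j.val := hij
    have h1 := hα.1 hij
    have h2 := le_abs_self e
    simp only [β]
    split_ifs <;>
      first
        | exact le_rfl
        | exact h1
        | omega
        | (have h3 := he j (by omega); omega)
  · intro i hi
    have hi' := Int.not_even_iff_odd.2 hi
    have hα' : Even (Finset.univ.filter fun j => α j = β i).card := by
      by_cases hex : ∃ j, α j = β i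
      · obtain ⟨j, hj⟩ := hex
        rw [← hj]
        exact hα.2 j (hj ▸ hi)
      · push Not at hex
        rw [Finset.filter_false_of_mem fun j _ => hex j]
        simp
    by_cases hc : β i = 2 * e + 1
    · have : (Finset.univ.filter fun j => β j = β i) =
          insert o (insert p (Finset.univ.filter fun j => α j = β i)) := by
        ext l
        simp only [hne _ hi', Finset.mem_filter, Finset.mem_univ, true_and, Finset.mem_insert]
        tauto
      rw [this, Finset.card_insert_of_notMem, Finset.card_insert_of_notMem]
      · rw [add_assoc]
        exact hα'.add (by decide)
      · simp [(hαop _ hi').2]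
      · simp [(hαop _ hi').1, hop]
    · simpa only [hne _ hi', hc, and_false, or_false] using hα'
  · have h1 := rankBefore_succ (α := β) (i := o) (j := p) rfl (hβp.trans hβo.symm)
    rw [hrank] at h1
    exact h1
  · intro i hi ho
    by_cases hc : α i = 2 * e + 1
    · have : rankBefore β i = rankBefore α i + 2 := by
        unfold rankBefore
        have : (Finset.univ.filter fun l => l < i ∧ β l = β i) =
            insert o (insert p (Finset.univ.filter fun l => l < i ∧ α l = α i)) := by
          ext l
          simp only [hβ i hi, hne _ ho, Finset.mem_filter, Finset.mem_univ, true_and,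
            Finset.mem_insert]
          have h1 : o < i := Fin.lt_def.2 (by simp only [o]; omega)
          have h2 : p < i := Fin.lt_def.2 (by simp only [p]; omega)
          constructor
          · rintro ⟨h3, h4 | h4⟩ <;> tauto
          · rintro (rfl | rfl | h3) <;> tauto
        rw [this, Finset.card_insert_of_notMem, Finset.card_insert_of_notMem]
        · simp [(hαop _ ho).2]
        · simp [(hαop _ ho).1, hop]
      rw [this, Nat.even_add]
      simp
    · have : rankBefore β i = rankBefore α i := by
        unfold rankBefore
        simp only [hβ i hi, hne _ ho, hc, and_false, or_false]
      rw [this]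

end Extend

namespace QuatData

variable {k : Type*} [NontriviallyNormedField k] [IsUltrametricDist k] {P : QuatData k} {n : ℕ}

theorem algebraMap_zpow_eq_piCoe (e : ℤ) : algebraMap k P.D (P.π ^ e) = P.piCoe e := rfl

/-- A form `y` whose rows from the place `m` on agree with those of `π^α`, and whose remaining
entries have absolute value at most `r`. -/
structure IsTail (α : Fin n → ℤ) (m : ℕ) (r : ℝ) (y : P.X n) : Prop where
  rows : ∀ i : Fin n, m ≤ i.val → ∀ l, P.toMatrix y i l = P.piMatrix α i l
  zero : ∀ i l : Fin n, m ≤ i.val → l.val < m → P.toMatrix y i l = 0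
  bound : ∀ i l : Fin n, i.val < m → l.val < m → P.dn (P.toMatrix y i l) ≤ r

namespace IsTail

variable {α : Fin n → ℤ} {m : ℕ} {r : ℝ} {y : P.X n}

theorem zero' (h : IsTail α m r y) (i l : Fin n) (hi : i.val < m) (hl : m ≤ l.val) :
    P.toMatrix y i l = 0 := by
  rw [← star_toMatrix_apply, h.zero l i hl hi, star_zero]

variable [CompleteSpace k] [P.IsOddLocal]

theorem colU_smul (h : IsTail α m r y) (j : Fin n) (hj : j.val < m) (v : Fin n → P.D)
    (hv : v j = 0) (hv1 : ∀ l, P.dn (v l) ≤ 1) (hv0 : ∀ l : Fin n, m ≤ l.val → v l = 0) :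
    IsTail α m r (P.colU j v hv • y) := by
  have hrow : ∀ i : Fin n, m ≤ i.val → ∀ l, P.toMatrix (P.colU j v hv • y) i l =
      P.toMatrix y i l := by
    intro i hi l
    rw [toMatrix_colU_smul, hv0 i hi, h.zero i j hi hj]
    simp
  refine ⟨fun i hi l => by rw [hrow i hi, h.rows i hi], fun i l hi hl => by
    rw [hrow i hi, h.zero i l hi hl], fun i l hi hl => ?_⟩
  have key : ∀ {a b : P.D} {s : ℝ}, P.dn a ≤ 1 → P.dn b ≤ s → P.dn (a * b) ≤ s := by
    intro a b s ha hb
    rw [dn_mul]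
    have := P.dn_nonneg b
    nlinarith [P.dn_nonneg a]
  rw [toMatrix_colU_smul]
  refine P.dn_add_le (P.dn_add_le (h.bound i l hi hl) (key (hv1 i) (h.bound j l hj hl))) ?_
  rw [dn_mul, mul_comm, dn_star, ← dn_mul]
  exact key (hv1 l) (P.dn_add_le (h.bound i j hi hj) (key (hv1 i) (h.bound j j hj hj)))

theorem swap_smul (h : IsTail α m r y) {a b : Fin n} (ha : a.val < m) (hb : b.val < m) :
    IsTail α m r (P.permU (Equiv.swap a b) • y) := by
  have hs : ∀ l : Fin n, m ≤ l.val → Equiv.swap a b l = l := fun l hl =>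
    Equiv.swap_apply_of_ne_of_ne (fun h => by rw [h] at hl; omega) (fun h => by rw [h] at hl; omega)
  have hs' : ∀ l : Fin n, l.val < m → (Equiv.swap a b l).val < m := by
    intro l hl
    rw [Equiv.swap_apply_def]
    split_ifs
    exacts [hb, ha, hl]
  have hrow : ∀ i : Fin n, m ≤ i.val → ∀ l, P.toMatrix (P.permU (Equiv.swap a b) • y) i l =
      P.toMatrix y i l := by
    intro i hi l
    rw [toMatrix_permU_smul, hs i hi]
    rcases lt_or_ge l.val m with hl | hl
    · rw [h.zero i _ hi (hs' l hl), h.zero i l hi hl]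
    · rw [hs l hl]
  refine ⟨fun i hi l => by rw [hrow i hi, h.rows i hi], fun i l hi hl => by
    rw [hrow i hi, h.zero i l hi hl], fun i l hi hl => ?_⟩
  rw [toMatrix_permU_smul]
  exact h.bound _ _ (hs' i hi) (hs' l hl)

theorem diagOne_smul (h : IsTail α m r y) {a : Fin n} (ha : a.val < m) {c : P.D} (hc : c ≠ 0)
    (hc1 : P.dn c = 1) : IsTail α m r (P.diagOne a c hc • y) := by
  have hrow : ∀ i : Fin n, m ≤ i.val → ∀ l, P.toMatrix (P.diagOne a c hc • y) i l =
      P.toMatrix y i l := by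
    intro i hi l
    have hia : i ≠ a := fun h => by rw [h] at hi; omega
    rw [toMatrix_diagOne_smul, if_neg hia, one_mul]
    by_cases hl : l = a
    · rw [hl, h.zero i a hi ha, zero_mul]
    · rw [if_neg hl, star_one, mul_one]
  refine ⟨fun i hi l => by rw [hrow i hi, h.rows i hi], fun i l hi hl => by
    rw [hrow i hi, h.zero i l hi hl], fun i l hi hl => ?_⟩
  have h1 : ∀ j : Fin n, P.dn (if j = a then c else 1) = 1 := by
    intro j
    split_ifs
    exacts [hc1, P.dn_one]
  rw [toMatrix_diagOne_smul, dn_mul, dn_mul, dn_star, h1, h1, one_mul, mul_one]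
  exact h.bound i l hi hl

end IsTail

variable [CompleteSpace k] [P.IsOddLocal]

/-- Splitting off a line from the leading block, the pivot being of maximal absolute value. -/
theorem exists_tail_of_diag {α : Fin n → ℤ} (hα : α ∈ Lam n) {m : ℕ} (hm : m < n)
    (hev : ∀ l : Fin n, l.val ≤ m → Even (α l)) {r : ℝ} {y : P.X n}
    (hy : IsTail α (m + 1) r y) (hr : ∀ i : Fin n, m < i.val → r ≤ ‖P.π‖ ^ α i) (i : Fin n)
    (hi : i.val ≤ m) (hir : P.dn (P.toMatrix y i i) = r) (hr0 : 0 < r) :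
    ∃ κ ∈ P.K n, ∃ β ∈ Lam n, (∀ l : Fin n, l.val < m → Even (β l)) ∧
      IsTail β m r (κ • y) ∧ ∀ i : Fin n, m ≤ i.val → r ≤ ‖P.π‖ ^ β i := by
  have hp0 := P.norm_pi_pos
  let p : Fin n := ⟨m, hm⟩
  have hy1 := hy.swap_smul (a := i) (b := p) (Nat.lt_succ_of_le hi) (Nat.lt_succ_self m)
  set y1 := P.permU (Equiv.swap i p) • y with hy1'
  have hpp : P.dn (P.toMatrix y1 p p) = r := by
    rw [hy1', toMatrix_permU_smul, Equiv.swap_apply_right, hir]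
  have hpp0 : P.toMatrix y1 p p ≠ 0 := by
    intro h
    rw [h, dn_zero] at hpp
    exact hr0.ne hpp
  obtain ⟨v, hv, hv1, h1, h2, -⟩ := split_line y1 p hpp0
  have hv0 : ∀ l : Fin n, m + 1 ≤ l.val → v l = 0 := by
    intro l hl
    have hlp : l ≠ p := fun h => by rw [h] at hl; simp [p] at hl
    rw [hv1 l hlp, hy1.zero l p hl (Nat.lt_succ_self m), neg_zero, zero_mul]
  have hvi : ∀ l, P.dn (v l) ≤ 1 := by
    intro l
    rcases lt_or_ge l.val (m + 1) with hl | hl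
    · by_cases hlp : l = p
      · rw [hlp, hv, dn_zero]
        exact zero_le_one
      · rw [hv1 l hlp, dn_mul, dn_inv, dn_neg, hpp]
        exact div_le_one_of_le₀ (hy1.bound l p hl (Nat.lt_succ_self m)) hr0.le
    · rw [hv0 l hl, dn_zero]
      exact zero_le_one
  have hy2 := hy1.colU_smul p (Nat.lt_succ_self m) v hv hvi hv0
  have hvK : P.colU p v hv ∈ P.K n := P.colU_mem_K hv fun l => P.mem_maxOrder_iff.2 (hvi l)
  set y2 := P.colU p v hv • y1 with hy2'
  have hself := eq_algebraMap_of_star (P.star_toMatrix_apply y1 p p)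
  set a := (P.toMatrix y1 p p).re
  have ha : a ≠ 0 := by
    intro h
    rw [h, map_zero] at hself
    exact hpp0 hself
  obtain ⟨e, he⟩ := P.norm_eq_zpow ha
  have hre : r = ‖P.π‖ ^ (2 * e) := by
    rw [← hpp, hself, dn_algebraMap, he, mul_comm, zpow_mul]
    rfl
  obtain ⟨c, hc⟩ := P.exists_nm_eq (P.π ^ e / a)
  have hc1 : P.dn c = 1 := by
    rw [dn, hc, norm_div, norm_zpow, he]
    exact div_self (zpow_pos hp0 _).ne'
  have hc0 : c ≠ 0 := by
    rintro rfl
    rw [dn_zero] at hc1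
    exact zero_ne_one hc1
  have hy3 := hy2.diagOne_smul (a := p) (Nat.lt_succ_self m) hc0 hc1
  have h3 : P.toMatrix (P.diagOne p c hc0 • y2) p p = P.piCoe e := by
    rw [toMatrix_diagOne_smul, if_pos rfl, h2, hself, ← Algebra.commutes, mul_assoc, mul_star_self,
      ← map_mul, hc, mul_div_cancel₀ _ ha, algebraMap_zpow_eq_piCoe]
  have h4 : ∀ l, l ≠ p → P.toMatrix (P.diagOne p c hc0 • y2) l p = 0 := by
    intro l hl
    rw [toMatrix_diagOne_smul, h1 l hl]
    simp
  have h5 : ∀ l, l ≠ p → P.toMatrix (P.diagOne p c hc0 • y2) p l = 0 := by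
    intro l hl
    rw [← star_toMatrix_apply, h4 l hl, star_zero]
  obtain ⟨β, hβ, hβ1, hβ2, hβ3, hβ4⟩ := extend_even hα hm hev e fun i hi => by
    have := hr i hi
    rw [hre] at this
    exact (zpow_le_zpow_iff_right_of_lt_one₀ hp0 P.norm_π_lt_one).1 this
  refine ⟨P.diagOne p c hc0 * (P.colU p v hv * P.permU (Equiv.swap i p)),
    (P.K n).mul_mem (P.diagOne_mem_K p hc0 hc1) ((P.K n).mul_mem hvK (P.permU_mem_K _)), β, hβ,
    hβ1, ?_, ?_⟩
  · rw [mul_smul, mul_smul, ← hy1', ← hy2']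
    refine ⟨fun i hi l => ?_, fun i l hi hl => ?_, fun i l hi hl =>
      hy3.bound i l (Nat.lt_succ_of_lt hi) (Nat.lt_succ_of_lt hl)⟩
    · rcases Nat.eq_or_lt_of_le hi with h | h
      · have hip : i = p := Fin.ext h.symm
        subst hip
        have hev' : Even (β p) := hβ2 ▸ even_two_mul e
        simp only [piMatrix, Matrix.of_apply, if_pos hev']
        by_cases hl : l = p
        · rw [hl, h3, if_pos rfl, hβ2]
          congr 1
          omega
        · rw [if_neg hl, h5 l hl]
      · rw [hy3.rows i h]
        simp only [piMatrix, Matrix.of_apply, hβ3 i h]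
        by_cases ho : Even (α i)
        · rw [if_pos ho, if_pos ho]
        · rw [if_neg ho, if_neg ho, hβ4 i h ho]
    · rcases Nat.eq_or_lt_of_le hi with h | h
      · have hip : i = p := Fin.ext h.symm
        subst hip
        exact h5 l fun h => by rw [h] at hl; exact lt_irrefl _ hl
      · exact hy3.zero i l h (Nat.lt_succ_of_lt hl)
  · intro i hi
    rcases Nat.eq_or_lt_of_le hi with h | h
    · rw [show i = p from Fin.ext h.symm, hβ2, hre]
    · rw [hβ3 i h]
      exact hr i h

theorem norm_le_of_sq_le {b : k} {e : ℤ} (h : ‖b‖ ^ 2 ≤ ‖P.π‖ ^ (2 * e + 1)) :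
    ‖b‖ ≤ ‖P.π‖ ^ (e + 1) := by
  have hp0 := P.norm_pi_pos
  by_cases hb : b = 0
  · rw [hb, norm_zero]
    exact (zpow_pos hp0 _).le
  obtain ⟨m, hm⟩ := P.norm_eq_zpow hb
  rw [hm, ← zpow_natCast, ← zpow_mul] at h
  rw [hm]
  have h1 := (zpow_le_zpow_iff_right_of_lt_one₀ hp0 P.norm_π_lt_one).1 h
  refine (zpow_le_zpow_iff_right_of_lt_one₀ hp0 P.norm_π_lt_one).2 ?_
  push_cast at h1
  omega

/-- If an entry of absolute value of odd exponent dominates a `2 × 2`-block, then the block can be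
made isotropic by an integral elementary transformation. -/
theorem exists_isotropic (y : P.X n) {o p : Fin n} {e : ℤ}
    (hop : P.dn (P.toMatrix y o p) = ‖P.π‖ ^ (2 * e + 1))
    (ho : P.dn (P.toMatrix y o o) ≤ ‖P.π‖ ^ (2 * e + 1))
    (hp : P.dn (P.toMatrix y p p) ≤ ‖P.π‖ ^ (2 * e + 1)) :
    ∃ a : P.D, P.dn a < 1 ∧ P.toMatrix y o o + a * P.toMatrix y p o +
      (P.toMatrix y o p + a * P.toMatrix y p p) * star a = 0 := by
  have hp0 := P.norm_pi_pos
  have hA := eq_algebraMap_of_star (P.star_toMatrix_apply y o o)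
  have hB := eq_algebraMap_of_star (P.star_toMatrix_apply y p p)
  set A := (P.toMatrix y o o).re
  set b := (P.toMatrix y p p).re
  rw [hA, dn_algebraMap] at ho
  rw [hB, dn_algebraMap] at hp
  have ho' := norm_le_of_sq_le ho
  have hp' := norm_le_of_sq_le hp
  set c := P.toMatrix y p o with hc
  have hcs : P.toMatrix y o p = star c := (P.star_toMatrix_apply y p o).symm
  rw [hcs, dn_star] at hop
  have hN : ‖P.nm c‖ = ‖P.π‖ ^ (2 * e + 1) := hop
  have hN0 : P.nm c ≠ 0 := by
    intro h
    rw [h, norm_zero] at hN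
    exact (zpow_pos hp0 _).ne hN
  have hc0 : c ≠ 0 := fun h => hN0 (by rw [h, nm_zero])
  have h20 := P.two_ne_zero'
  have h2 := IsOddLocal.norm_two (P := P)
  have hpe : P.π ^ e ≠ 0 := zpow_ne_zero _ P.π_ne_zero
  have hb1 : ‖b * P.π ^ e / (2 * P.nm c)‖ ≤ 1 := by
    rw [norm_div, norm_mul, norm_mul, h2, hN, norm_zpow, one_mul]
    refine div_le_one_of_le₀ ?_ (zpow_pos hp0 _).le
    calc ‖b‖ * ‖P.π‖ ^ e ≤ ‖P.π‖ ^ (e + 1) * ‖P.π‖ ^ e := by gcongr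
      _ = ‖P.π‖ ^ (2 * e + 1) := by rw [← zpow_add₀ hp0.ne']; congr 1; ring
  have hc1 : ‖-A / (2 * P.π ^ e)‖ ≤ ‖P.π‖ := by
    rw [norm_div, norm_mul, h2, norm_neg, norm_zpow, one_mul, div_le_iff₀ (zpow_pos hp0 _)]
    calc ‖A‖ ≤ ‖P.π‖ ^ (e + 1) := ho'
      _ = ‖P.π‖ * ‖P.π‖ ^ e := by rw [zpow_add_one₀ hp0.ne', mul_comm]
  obtain ⟨t, ht, htn⟩ := exists_quadratic_root hb1 (hc1.trans_lt P.norm_π_lt_one)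
  have htn' := htn.trans hc1
  refine ⟨algebraMap k P.D (P.π ^ e * t) * c⁻¹, ?_, ?_⟩
  · rw [dn_mul, dn_algebraMap, dn_inv, hop, norm_mul, norm_zpow]
    rw [← div_eq_mul_inv, div_lt_one (zpow_pos hp0 _)]
    calc (‖P.π‖ ^ e * ‖t‖) ^ 2 ≤ (‖P.π‖ ^ e * ‖P.π‖) ^ 2 := by gcongr
      _ = ‖P.π‖ ^ (2 * e + 2) := by
        rw [← zpow_add_one₀ hp0.ne', ← zpow_natCast, ← zpow_mul]
        congr 1
        push_cast
        ring
      _ < ‖P.π‖ ^ (2 * e + 1) :=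
        (zpow_lt_zpow_iff_right_of_lt_one₀ hp0 P.norm_π_lt_one).2 (by omega)
  · have hs : star (algebraMap k P.D (P.π ^ e * t) * c⁻¹) =
        star c⁻¹ * algebraMap k P.D (P.π ^ e * t) := by
      rw [star_mul, star_algebraMap]
    have e1 : algebraMap k P.D (P.π ^ e * t) * c⁻¹ * c = algebraMap k P.D (P.π ^ e * t) := by
      rw [mul_assoc, inv_mul_cancel₀ hc0, mul_one]
    have e2 : star c * star (algebraMap k P.D (P.π ^ e * t) * c⁻¹) =
        algebraMap k P.D (P.π ^ e * t) := by
      rw [← star_mul, e1, star_algebraMap]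
    have e3 : P.nm (algebraMap k P.D (P.π ^ e * t) * c⁻¹) = (P.π ^ e * t) ^ 2 / P.nm c := by
      have h1 : P.nm (algebraMap k P.D (P.π ^ e * t) * c⁻¹) * P.nm c = (P.π ^ e * t) ^ 2 := by
        rw [← nm_mul, e1, nm_algebraMap]
      rw [eq_div_iff hN0, h1]
    rw [hcs, add_mul, e1, e2, hA, hB, ← Algebra.commutes, mul_assoc, mul_star_self, e3, ← map_mul,
      ← map_add, ← map_add, ← map_add]
    convert map_zero (algebraMap k P.D)
    field_simp at ht ⊢
    linear_combination ht

/-- Splitting off a plane of odd type from the leading block. -/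
theorem exists_tail_of_odd {α : Fin n → ℤ} (hα : α ∈ Lam n) {m : ℕ} (hm : m + 1 < n)
    (hev : ∀ l : Fin n, l.val ≤ m + 1 → Even (α l)) {e : ℤ} {y : P.X n}
    (hy : IsTail α (m + 2) (‖P.π‖ ^ (2 * e + 1)) y)
    (hr : ∀ i : Fin n, m + 1 < i.val → ‖P.π‖ ^ (2 * e + 1) ≤ ‖P.π‖ ^ α i) {i j : Fin n}
    (hij : i ≠ j) (hi : i.val ≤ m + 1) (hj : j.val ≤ m + 1)
    (hir : P.dn (P.toMatrix y i j) = ‖P.π‖ ^ (2 * e + 1)) :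
    ∃ κ ∈ P.K n, ∃ β ∈ Lam n, (∀ l : Fin n, l.val < m → Even (β l)) ∧
      IsTail β m (‖P.π‖ ^ (2 * e + 1)) (κ • y) ∧
      ∀ i : Fin n, m ≤ i.val → ‖P.π‖ ^ (2 * e + 1) ≤ ‖P.π‖ ^ β i := by
  have hp0 := P.norm_pi_pos
  set ρ := ‖P.π‖ ^ (2 * e + 1) with hρ
  have hρ0 : 0 < ρ := zpow_pos hp0 _
  let o : Fin n := ⟨m, by omega⟩
  let p : Fin n := ⟨m + 1, hm⟩
  have ho : o.val < m + 2 := by simp only [o]; omega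
  have hp : p.val < m + 2 := by simp only [p]; omega
  have hop : o ≠ p := fun h => by
    have := congrArg Fin.val h
    simp [o, p] at this
  -- the dominating entry is moved to the place `(m, m + 1)`
  have hy1 := hy.swap_smul (a := i) (b := o) (by omega) ho
  set y1 := P.permU (Equiv.swap i o) • y with hy1'
  have hj' : (Equiv.swap i o j).val < m + 2 := by
    rw [Equiv.swap_apply_def]
    split_ifs
    exacts [ho, by omega, by omega]
  have hjo : Equiv.swap i o j ≠ o := fun h => by
    rw [Equiv.swap_apply_eq_iff, Equiv.swap_apply_right] at h
    exact hij h.symm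
  have hy2 := hy1.swap_smul (a := Equiv.swap i o j) (b := p) hj' hp
  set y2 := P.permU (Equiv.swap (Equiv.swap i o j) p) • y1 with hy2'
  have h2op : P.dn (P.toMatrix y2 o p) = ρ := by
    rw [hy2', toMatrix_permU_smul, Equiv.swap_apply_right,
      Equiv.swap_apply_of_ne_of_ne hjo.symm hop, hy1', toMatrix_permU_smul, Equiv.swap_apply_right,
      Equiv.swap_apply_self, hir]
  -- the diagonal entry at `m` is killed
  obtain ⟨a, ha1, ha⟩ := exists_isotropic y2 h2op (hy2.bound o o ho ho) (hy2.bound p p hp hp)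
  have hap : Pi.single (M := fun _ => P.D) o a p = 0 :=
    Function.update_of_ne hop.symm _ _
  have hasi : ∀ l, P.dn (Pi.single (M := fun _ => P.D) o a l) ≤ 1 := by
    intro l
    by_cases hl : l = o
    · rw [hl, Pi.single_eq_same]
      exact ha1.le
    · rw [Pi.single_eq_of_ne hl, dn_zero]
      exact zero_le_one
  have has0 : ∀ l : Fin n, m + 2 ≤ l.val → Pi.single (M := fun _ => P.D) o a l = 0 := fun l hl =>
    Function.update_of_ne (fun h => by rw [h] at hl; omega) _ _
  have hy3 := hy2.colU_smul p hp _ hap hasi has0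
  set y3 := P.colU p _ hap • y2 with hy3'
  have h3oo : P.toMatrix y3 o o = 0 := by
    rw [hy3', toMatrix_colU_smul, Pi.single_eq_same, ha]
  have h3op : P.dn (P.toMatrix y3 o p) = ρ := by
    rw [hy3', toMatrix_colU_smul, hap, star_zero, mul_zero, add_zero, Pi.single_eq_same,
      dn_add_eq_left, h2op]
    rw [dn_mul, h2op]
    have := hy2.bound p p hp hp
    have := P.dn_nonneg a
    have := P.dn_nonneg (P.toMatrix y2 p p)
    nlinarith
  have h3op0 : P.toMatrix y3 o p ≠ 0 := by
    intro h
    rw [h, dn_zero] at h3op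
    exact hρ0.ne h3op
  have h3po : P.dn (P.toMatrix y3 p o) = ρ := by
    rw [← star_toMatrix_apply, dn_star, h3op]
  -- the plane is split off
  obtain ⟨v, hv, w, hw, hv1, hw1, hw2, h4o, h4p, h4op, -⟩ := split_plane y3 hop h3oo h3op0
  have hlt : ∀ l : Fin n, m + 2 ≤ l.val → l ≠ o ∧ l ≠ p := fun l hl =>
    ⟨fun h => by rw [h] at hl; omega, fun h => by rw [h] at hl; omega⟩
  have hv0 : ∀ l : Fin n, m + 2 ≤ l.val → v l = 0 := fun l hl => by
    rw [hv1 l (hlt l hl).2, hy3.zero l o hl ho, neg_zero, zero_mul]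
  have hvi : ∀ l, P.dn (v l) ≤ 1 := by
    intro l
    rcases lt_or_ge l.val (m + 2) with hl | hl
    · by_cases hlp : l = p
      · rw [hlp, hv, dn_zero]
        exact zero_le_one
      · rw [hv1 l hlp, dn_mul, dn_inv, dn_neg, h3po]
        exact div_le_one_of_le₀ (hy3.bound l o hl ho) hρ0.le
    · rw [hv0 l hl, dn_zero]
      exact zero_le_one
  have hy4 := hy3.colU_smul p hp v hv hvi hv0
  have hw0 : ∀ l : Fin n, m + 2 ≤ l.val → w l = 0 := fun l hl => by
    rw [hw1 l (hlt l hl).1 (hlt l hl).2, hy4.zero l p hl hp, neg_zero, zero_mul]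
  have hwi : ∀ l, P.dn (w l) ≤ 1 := by
    intro l
    rcases lt_or_ge l.val (m + 2) with hl | hl
    · by_cases hlo : l = o
      · rw [hlo, hw, dn_zero]
        exact zero_le_one
      by_cases hlp : l = p
      · rw [hlp, hw2, dn_mul, dn_inv, dn_neg, h3op, dn_mul, dn_algebraMap, norm_inv,
          IsOddLocal.norm_two (P := P), inv_one, one_pow, one_mul]
        exact div_le_one_of_le₀ (hy4.bound p p hp hp) hρ0.le
      · rw [hw1 l hlo hlp, dn_mul, dn_inv, dn_neg, h3op]
        exact div_le_one_of_le₀ (hy4.bound l p hl hp) hρ0.le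
    · rw [hw0 l hl, dn_zero]
      exact zero_le_one
  have hy5 := hy4.colU_smul o ho w hw hwi hw0
  set y5 := P.colU o w hw • P.colU p v hv • y3 with hy5'
  -- the remaining entry is normalized
  set f := P.toMatrix y5 o p with hf
  have hf0 : f ≠ 0 := by rw [h4op]; exact h3op0
  have hfn : P.dn f = ρ := by rw [h4op, h3op]
  let c : P.D := star (f⁻¹ * P.piPrime e)
  have hc1 : P.dn c = 1 := by
    simp only [c]
    rw [dn_star, dn_mul, dn_inv, hfn, dn_piPrime]
    exact inv_mul_cancel₀ hρ0.ne'
  have hc0 : c ≠ 0 := by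
    intro h
    rw [h, dn_zero] at hc1
    exact zero_ne_one hc1
  have hy6 := hy5.diagOne_smul (a := p) hp hc0 hc1
  set y6 := P.diagOne p c hc0 • y5 with hy6'
  have h6 : P.toMatrix y6 o p = P.piPrime e := by
    rw [hy6', toMatrix_diagOne_smul, if_neg hop, if_pos rfl, one_mul, ← hf]
    simp only [c]
    rw [star_star, ← mul_assoc, mul_inv_cancel₀ hf0, one_mul]
  have h6p : ∀ l, l ≠ o → P.toMatrix y6 l p = 0 := by
    intro l hl
    rw [hy6', toMatrix_diagOne_smul, h4p l hl]
    simp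
  have h6o : ∀ l, l ≠ p → P.toMatrix y6 l o = 0 := by
    intro l hl
    rw [hy6', toMatrix_diagOne_smul, h4o l hl]
    simp
  have h6p' : ∀ l, l ≠ o → P.toMatrix y6 p l = 0 := fun l hl => by
    rw [← star_toMatrix_apply, h6p l hl, star_zero]
  have h6o' : ∀ l, l ≠ p → P.toMatrix y6 o l = 0 := fun l hl => by
    rw [← star_toMatrix_apply, h6o l hl, star_zero]
  have h6' : P.toMatrix y6 p o = -P.piPrime e := by
    rw [← star_toMatrix_apply, h6]
    ext <;> simp [piPrime]
  obtain ⟨β, hβ, hβ1, hβo, hβp, hβro, hβrp, hβ3, hβ4⟩ := extend_odd hα hm hev e fun i hi =>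
    (zpow_le_zpow_iff_right_of_lt_one₀ hp0 P.norm_π_lt_one).1 (hr i hi)
  refine ⟨P.diagOne p c hc0 * (P.colU o w hw * (P.colU p v hv * (P.colU p _ hap *
    (P.permU (Equiv.swap (Equiv.swap i o j) p) * P.permU (Equiv.swap i o))))), ?_, β, hβ,
    hβ1, ?_, ?_⟩
  · exact (P.K n).mul_mem (P.diagOne_mem_K p hc0 hc1) <| (P.K n).mul_mem
      (P.colU_mem_K hw fun l => P.mem_maxOrder_iff.2 (hwi l)) <| (P.K n).mul_mem
      (P.colU_mem_K hv fun l => P.mem_maxOrder_iff.2 (hvi l)) <| (P.K n).mul_mem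
      (P.colU_mem_K hap fun l => P.mem_maxOrder_iff.2 (hasi l)) <| (P.K n).mul_mem
      (P.permU_mem_K _) (P.permU_mem_K _)
  · rw [mul_smul, mul_smul, mul_smul, mul_smul, mul_smul, ← hy1', ← hy2', ← hy3', ← hy5', ← hy6']
    have hd : (2 * e + 1) / 2 = e := by omega
    have hodd : ¬ Even (2 * e + 1) := by simp [parity_simps]
    have hcases : ∀ i : Fin n, m ≤ i.val → i = o ∨ i = p ∨ m + 2 ≤ i.val := by
      intro i hi
      rcases Nat.lt_or_ge i.val (m + 2) with h | h
      · rcases Nat.eq_or_lt_of_le hi with h' | h'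
        · exact Or.inl (Fin.ext h'.symm)
        · exact Or.inr (Or.inl (Fin.ext (show i.val = m + 1 by omega)))
      · exact Or.inr (Or.inr h)
    refine ⟨fun i hi l => ?_, fun i l hi hl => ?_, fun i l hi hl =>
      hy6.bound i l (by omega) (by omega)⟩
    · rcases hcases i hi with rfl | rfl | h
      · simp only [piMatrix, Matrix.of_apply]
        rw [if_neg (by rw [hβo]; exact hodd), if_pos (by rw [hβro]; exact Even.zero), hβo, hd]
        by_cases hl : l = p
        · rw [hl, h6, if_pos rfl]
        · rw [h6o' l hl, if_neg fun h => hl (Fin.ext h)]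
      · simp only [piMatrix, Matrix.of_apply]
        rw [if_neg (by rw [hβp]; exact hodd), if_neg (by rw [hβrp]; exact Nat.not_even_one), hβp,
          hd]
        by_cases hl : l = o
        · rw [hl, h6', if_pos rfl]
        · rw [h6p' l hl, if_neg fun h => hl (Fin.ext (Nat.succ.inj h).symm)]
      · rw [hy6.rows i h]
        simp only [piMatrix, Matrix.of_apply, hβ3 i h]
        by_cases ho : Even (α i)
        · rw [if_pos ho, if_pos ho]
        · rw [if_neg ho, if_neg ho]
          simp only [hβ4 i h ho]
    · rcases hcases i hi with rfl | rfl | h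
      · exact h6o' l fun h => by rw [h] at hl; simp [p] at hl
      · exact h6p' l fun h => by rw [h] at hl; simp [o] at hl
      · exact hy6.zero i l h (by omega)
  · intro i hi
    rcases Nat.lt_or_ge i.val (m + 2) with h | h
    · rcases Nat.eq_or_lt_of_le hi with h' | h'
      · rw [show i = o from Fin.ext h'.symm, hβo]
      · rw [show i = p from Fin.ext (show i.val = m + 1 by omega), hβp]
    · rw [hβ3 i h]
      exact hr i h

/-- The `m`-th stage of the reduction: a form which is in normal form from the place `m` on. -/
theorem exists_K_smul_eq_piX_of_isTail (m : ℕ) (hm : m ≤ n) : ∀ (α : Fin n → ℤ), α ∈ Lam n →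
    (∀ l : Fin n, l.val < m → Even (α l)) → ∀ (r : ℝ) (y : P.X n), IsTail α m r y →
    (∀ i : Fin n, m ≤ i.val → r ≤ ‖P.π‖ ^ α i) →
    ∃ κ ∈ P.K n, ∃ α : Lam n, κ • y = P.piX α := by
  induction m using Nat.strong_induction_on with
  | _ m ih =>
  intro α hα hev r y hy hr
  have hp0 := P.norm_pi_pos
  rcases Nat.eq_zero_or_pos m with rfl | hm0
  · refine ⟨1, (P.K n).one_mem, ⟨α, hα⟩, P.toMatrix_injective ?_⟩
    rw [one_smul]
    ext1 i l
    rw [hy.rows i (Nat.zero_le _)]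
    rfl
  obtain ⟨m, rfl⟩ := Nat.exists_eq_add_of_lt hm0
  rw [zero_add] at *
  -- an entry of maximal absolute value in the leading block
  obtain ⟨⟨i, j⟩, hijm, hmax⟩ := (Finset.univ.filter fun t : Fin n × Fin n =>
    t.1.val < m + 1 ∧ t.2.val < m + 1).exists_max_image
      (fun t => P.dn (P.toMatrix y t.1 t.2)) ⟨(⟨m, hm⟩, ⟨m, hm⟩), by simp⟩
  simp only [Finset.mem_filter, Finset.mem_univ, true_and, Prod.forall] at hijm hmax
  set ρ := P.dn (P.toMatrix y i j) with hρ
  have hρ0 : 0 < ρ := by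
    refine lt_of_le_of_ne (P.dn_nonneg _) fun h => ?_
    obtain ⟨l, hl⟩ := P.exists_toMatrix_ne_zero y ⟨m, hm⟩
    refine hl (P.dn_eq_zero_iff.1 (le_antisymm ?_ (P.dn_nonneg _)))
    rcases Nat.lt_or_ge l.val (m + 1) with hlm | hlm
    · rw [h]
      exact hmax _ _ ⟨Nat.lt_succ_self m, hlm⟩
    · rw [hy.zero' _ l (Nat.lt_succ_self m) hlm, dn_zero]
  have hy' : IsTail α (m + 1) ρ y := ⟨hy.rows, hy.zero, fun i l hi hl => hmax i l ⟨hi, hl⟩⟩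
  have hr' : ∀ i : Fin n, m + 1 ≤ i.val → ρ ≤ ‖P.π‖ ^ α i := fun l hl =>
    (hy.bound i j hijm.1 hijm.2).trans (hr l hl)
  have hev' : ∀ l : Fin n, l.val ≤ m → Even (α l) := fun l hl => hev l (Nat.lt_succ_of_le hl)
  have diag : ∀ y' : P.X n, IsTail α (m + 1) ρ y' → ∀ l : Fin n, l.val ≤ m →
      P.dn (P.toMatrix y' l l) = ρ → ∃ κ ∈ P.K n, ∃ α : Lam n, κ • y' = P.piX α := by
    intro y' hy' l hl hlr
    obtain ⟨κ, hκ, β, hβ, h1, h2, h3⟩ := exists_tail_of_diag hα hm hev' hy' hr' l hl hlr hρ0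
    obtain ⟨κ', hκ', α', h4⟩ := ih m (Nat.lt_succ_self m) (by omega) β hβ h1 ρ _ h2 h3
    exact ⟨κ' * κ, (P.K n).mul_mem hκ' hκ, α', by rw [mul_smul, h4]⟩
  by_cases hd : ∃ l : Fin n, l.val ≤ m ∧ P.dn (P.toMatrix y l l) = ρ
  · obtain ⟨l, hl, hlr⟩ := hd
    exact diag y hy' l hl hlr
  push Not at hd
  have hij : i ≠ j := fun h => hd i (by omega) (by rw [hρ, ← h])
  have hnz : P.toMatrix y i j ≠ 0 := fun h => by rw [hρ, h, dn_zero] at hρ0; exact lt_irrefl _ hρ0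
  obtain ⟨c, hc⟩ := P.exists_dn_eq_zpow hnz
  rcases Int.even_or_odd' c with ⟨e, rfl | rfl⟩
  · -- an even off-diagonal entry is moved to the diagonal
    let a : P.D := P.piCoe e * (P.toMatrix y i j)⁻¹
    have ha : P.dn a = 1 := by
      simp only [a]
      rw [dn_mul, dn_inv, dn_piCoe, hc]
      exact mul_inv_cancel₀ (zpow_pos hp0 _).ne'
    have hai : Pi.single (M := fun _ => P.D) j a i = 0 :=
      Function.update_of_ne hij _ _
    have hasi : ∀ l, P.dn (Pi.single (M := fun _ => P.D) j a l) ≤ 1 := by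
      intro l
      by_cases hl : l = j
      · rw [hl, Pi.single_eq_same, ha]
      · rw [Pi.single_eq_of_ne hl, dn_zero]
        exact zero_le_one
    have has0 : ∀ l : Fin n, m + 1 ≤ l.val → Pi.single (M := fun _ => P.D) j a l = 0 :=
      fun l hl => Function.update_of_ne (fun h => by rw [h] at hl; omega) _ _
    have hy2 := hy'.colU_smul i hijm.1 _ hai hasi has0
    have hjj : P.dn (P.toMatrix (P.colU i _ hai • y) j j) = ρ := by
      have e1 : a * P.toMatrix y i j = algebraMap k P.D (P.π ^ e) := by
        simp only [a]
        rw [mul_assoc, inv_mul_cancel₀ hnz, mul_one, algebraMap_zpow_eq_piCoe]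
      have e2 : P.toMatrix y j i * star a = algebraMap k P.D (P.π ^ e) := by
        rw [← star_toMatrix_apply, ← star_mul, e1, star_algebraMap]
      have e3 : P.toMatrix (P.colU i _ hai • y) j j = algebraMap k P.D (2 * P.π ^ e) +
          (P.toMatrix y j j + a * P.toMatrix y i i * star a) := by
        rw [toMatrix_colU_smul, Pi.single_eq_same, e1, add_mul, e2, two_mul, map_add]
        abel
      have e4 : P.dn (algebraMap k P.D (2 * P.π ^ e)) = ρ := by
        rw [dn_algebraMap, norm_mul, IsOddLocal.norm_two (P := P), one_mul, norm_zpow, hρ, hc,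
          mul_comm, zpow_mul]
        rfl
      rw [e3, dn_add_eq_left, e4]
      rw [e4]
      refine lt_of_le_of_lt (P.dn_add_le_max _ _) (max_lt ?_ ?_)
      · exact lt_of_le_of_ne (hmax _ _ ⟨hijm.2, hijm.2⟩) (hd j (by omega))
      · rw [dn_mul, dn_mul, dn_star, ha, one_mul, mul_one]
        exact lt_of_le_of_ne (hmax _ _ ⟨hijm.1, hijm.1⟩) (hd i (by omega))
    obtain ⟨κ, hκ, α', h⟩ := diag _ hy2 j (by omega) hjj
    exact ⟨κ * P.colU i _ hai, (P.K n).mul_mem hκ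
      (P.colU_mem_K hai fun l => P.mem_maxOrder_iff.2 (hasi l)), α', by rw [mul_smul, h]⟩
  · have hm1 : 1 ≤ m := by
      by_contra h
      exact hij (Fin.ext (by omega))
    obtain ⟨m, rfl⟩ := Nat.exists_eq_add_of_le' hm1
    rw [hρ, hc] at hy' hr'
    obtain ⟨κ, hκ, β, hβ, h1, h2, h3⟩ := exists_tail_of_odd hα (m := m) hm hev' hy' hr' hij
      (by omega) (by omega) hc
    obtain ⟨κ', hκ', α', h4⟩ := ih m (by omega) (by omega) β hβ h1 _ _ h2 h3
    exact ⟨κ' * κ, (P.K n).mul_mem hκ' hκ, α', by rw [mul_smul, h4]⟩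

/-- Every `K`-orbit in `X` contains one of the forms `π^α`. -/
theorem exists_K_smul_eq_piX (x : P.X n) : ∃ κ ∈ P.K n, ∃ α : Lam n, κ • x = P.piX α := by
  obtain ⟨r, hr⟩ : ∃ r, ∀ t ∈ (Finset.univ : Finset (Fin n × Fin n)),
      P.dn (P.toMatrix x t.1 t.2) ≤ r := by
    obtain ⟨r, hr⟩ := ((Finset.univ : Finset (Fin n × Fin n)).image
      fun t => P.dn (P.toMatrix x t.1 t.2)).bddAbove
    exact ⟨r, fun t ht => hr (Finset.mem_coe.2 (Finset.mem_image_of_mem _ ht))⟩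
  refine exists_K_smul_eq_piX_of_isTail n le_rfl _ (zero_mem_Lam n) (fun _ _ => Even.zero) r x
    ⟨fun i hi => absurd i.isLt (by omega), fun i l hi => absurd i.isLt (by omega),
      fun i l _ _ => hr (i, l) (Finset.mem_univ _)⟩ fun i hi => absurd i.isLt (by omega)

end QuatData

/-! ### Topology of the groups and of the space of forms -/

theorem totallyDisconnectedSpace_of_injective {α β : Type*} [TopologicalSpace α]
    [TopologicalSpace β] [TotallyDisconnectedSpace β] {f : α → β} (hf : Continuous f)
    (hi : Function.Injective f) : TotallyDisconnectedSpace α :=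
  ⟨fun _ _ hs x hx y hy => hi <|
    (hs.image f hf.continuousOn).subsingleton ⟨x, hx, rfl⟩ ⟨y, hy, rfl⟩⟩

/-- In a locally compact totally disconnected Hausdorff space, every compact subset of an open set
has a compact open neighbourhood inside. -/
theorem exists_isCompact_isOpen_between {α : Type*} [TopologicalSpace α] [T2Space α]
    [LocallyCompactSpace α] [TotallyDisconnectedSpace α] {C U : Set α} (hC : IsCompact C)
    (hU : IsOpen U) (hCU : C ⊆ U) : ∃ V, IsCompact V ∧ IsOpen V ∧ C ⊆ V ∧ V ⊆ U := by
  refine hC.induction_on (p := fun C => ∃ V, IsCompact V ∧ IsOpen V ∧ C ⊆ V ∧ V ⊆ U)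
    ⟨∅, isCompact_empty, isOpen_empty, le_rfl, Set.empty_subset _⟩
    (fun s t hst ⟨V, h1, h2, h3, h4⟩ => ⟨V, h1, h2, hst.trans h3, h4⟩)
    (fun s t ⟨V, h1, h2, h3, h4⟩ ⟨V', h1', h2', h3', h4'⟩ => ⟨V ∪ V', h1.union h1', h2.union h2',
      Set.union_subset_union h3 h3', Set.union_subset h4 h4'⟩) fun x hx => ?_
  obtain ⟨L, hL, hLU, hLc⟩ := local_compact_nhds (hU.mem_nhds (hCU hx))
  obtain ⟨V, hV, hxV, hVL⟩ := loc_compact_Haus_tot_disc_of_zero_dim.mem_nhds_iff.1 hL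
  exact ⟨V, mem_nhdsWithin_of_mem_nhds (hV.isOpen.mem_nhds hxV), V,
    hLc.of_isClosed_subset hV.isClosed hVL, hV.isOpen, le_rfl, hVL.trans hLU⟩

namespace QuatData

variable {k : Type*} [NontriviallyNormedField k] [IsUltrametricDist k] (P : QuatData k) {n : ℕ}

instance : ContinuousStar P.D where
  continuous_star := by
    have h0 := P.continuous_re
    have h1 := P.continuous_imI
    have h2 := P.continuous_imJ
    have h3 := P.continuous_imK
    rw [continuous_D_iff]
    simp only [QuaternionAlgebra.re_star, QuaternionAlgebra.imI_star, QuaternionAlgebra.imJ_star,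
      QuaternionAlgebra.imK_star]
    refine ⟨?_, ?_, ?_, ?_⟩ <;> fun_prop

instance : ContinuousStar (P.G n) where
  continuous_star := by
    rw [Units.continuous_iff]
    exact ⟨continuous_star.comp Units.continuous_val,
      continuous_star.comp (Units.continuous_val.comp continuous_inv)⟩

instance : ContinuousSMul (P.G n) (P.X n) where
  continuous_smul := by
    refine Continuous.subtype_mk (f := fun t : P.G n × P.X n => t.1 * t.2.1 * star t.1) ?_ _
    exact (continuous_fst.mul (continuous_subtype_val.comp continuous_snd)).mul
      (continuous_star.comp continuous_fst)

theorem continuous_toMatrix (i j : Fin n) : Continuous fun x : P.X n => P.toMatrix x i j :=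
  (Units.continuous_val.comp continuous_subtype_val).matrix_elem i j

instance : TotallyDisconnectedSpace P.D :=
  totallyDisconnectedSpace_of_injective P.coordHomeo.continuous P.coordHomeo.injective

instance : TotallyDisconnectedSpace (P.G n) := by
  have : TotallyDisconnectedSpace (Fin n → Fin n → P.D) := inferInstance
  refine totallyDisconnectedSpace_of_injective (β := Fin n → Fin n → P.D)
    (f := fun g i j => (g : Matrix (Fin n) (Fin n) P.D) i j) ?_ fun g g' h => Units.ext h
  exact continuous_pi fun i => continuous_pi fun j => Units.continuous_val.matrix_elem i j

instance : TotallyDisconnectedSpace (P.X n) :=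
  totallyDisconnectedSpace_of_injective continuous_subtype_val Subtype.val_injective

theorem isClosed_X : IsClosed {x : P.G n | star x = x} :=
  isClosed_eq continuous_star continuous_id

theorem isOpen_maxOrder : IsOpen (P.maxOrder : Set P.D) := by
  have h : IsOpen (Metric.closedBall (0 : k) 1) :=
    IsUltrametricDist.isOpen_closedBall 0 one_ne_zero
  have h' : (P.maxOrder : Set P.D) = (fun x : P.D => x.re) ⁻¹' Metric.closedBall (0 : k) 1 ∩
      ((fun x : P.D => x.imI) ⁻¹' Metric.closedBall (0 : k) 1 ∩
      ((fun x : P.D => x.imJ) ⁻¹' Metric.closedBall (0 : k) 1 ∩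
      (fun x : P.D => x.imK) ⁻¹' Metric.closedBall (0 : k) 1)) := by
    ext x
    simp only [Set.mem_inter_iff, Set.mem_preimage, mem_closedBall_zero_iff]
    rfl
  rw [h']
  exact (h.preimage P.continuous_re).inter ((h.preimage P.continuous_imI).inter
    ((h.preimage P.continuous_imJ).inter (h.preimage P.continuous_imK)))

theorem isOpen_K : IsOpen (P.K n : Set (P.G n)) := by
  have h : (P.K n : Set (P.G n)) = (⋂ i, ⋂ j, (fun g : P.G n =>
      (g : Matrix (Fin n) (Fin n) P.D) i j) ⁻¹' P.maxOrder) ∩ (⋂ i, ⋂ j, (fun g : P.G n =>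
      ((g⁻¹ : P.G n) : Matrix (Fin n) (Fin n) P.D) i j) ⁻¹' P.maxOrder) := by
    ext g
    simp only [Set.mem_inter_iff, Set.mem_iInter, Set.mem_preimage]
    exact Iff.rfl
  rw [h]
  refine (isOpen_iInter_of_finite fun i => isOpen_iInter_of_finite fun j => ?_).inter
    (isOpen_iInter_of_finite fun i => isOpen_iInter_of_finite fun j => ?_)
  · exact P.isOpen_maxOrder.preimage (Units.continuous_val.matrix_elem i j)
  · exact P.isOpen_maxOrder.preimage
      ((Units.continuous_val.comp continuous_inv).matrix_elem i j)

variable [LocallyCompactSpace k]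

instance : LocallyCompactSpace (P.X n) :=
  (P.isClosed_X (n := n)).isClosedEmbedding_subtypeVal.locallyCompactSpace

theorem isCompact_maxOrder : IsCompact (P.maxOrder : Set P.D) := by
  have : ProperSpace k := ProperSpace.of_locallyCompactSpace k
  have h : (P.maxOrder : Set P.D) =
      P.coordHomeo ⁻¹' Set.univ.pi fun _ => Metric.closedBall (0 : k) 1 := by
    ext x
    simp only [Set.mem_preimage, Set.mem_pi, Set.mem_univ, mem_closedBall_zero_iff, forall_const,
      Fin.forall_fin_succ, Fin.forall_fin_zero, and_true]
    exact Iff.rfl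
  rw [h]
  exact P.coordHomeo.isCompact_preimage.2 (isCompact_univ_pi fun _ => isCompact_closedBall 0 1)

theorem isCompact_K : IsCompact (P.K n : Set (P.G n)) := by
  let A : Set (Matrix (Fin n) (Fin n) P.D) :=
    Set.univ.pi fun _ => Set.univ.pi fun _ => (P.maxOrder : Set P.D)
  have hA : IsCompact A :=
    isCompact_univ_pi fun _ => isCompact_univ_pi fun _ => P.isCompact_maxOrder
  have h : (P.K n : Set (P.G n)) =
      Units.embedProduct _ ⁻¹' (A ×ˢ (MulOpposite.opHomeomorph.symm ⁻¹' A)) := by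
    ext g
    refine ⟨fun hg => ⟨fun i _ j _ => hg.1 i j, fun i _ j _ => hg.2 i j⟩, fun hg =>
      ⟨fun i j => hg.1 i trivial j trivial, fun i j => hg.2 i trivial j trivial⟩⟩
  rw [h]
  exact Units.isClosedEmbedding_embedProduct.isCompact_preimage
    (hA.prod (MulOpposite.opHomeomorph.symm.isCompact_preimage.2 hA))

instance : SecondCountableTopology P.D := by
  have : ProperSpace k := ProperSpace.of_locallyCompactSpace k
  exact P.coordHomeo.isEmbedding.secondCountableTopology

instance : SecondCountableTopology (P.G n) := by
  have h : SecondCountableTopology (Matrix (Fin n) (Fin n) P.D) :=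
    inferInstanceAs (SecondCountableTopology (Fin n → Fin n → P.D))
  have h' : SecondCountableTopology (Matrix (Fin n) (Fin n) P.D)ᵐᵒᵖ :=
    MulOpposite.opHomeomorph.symm.isEmbedding.secondCountableTopology
  exact Units.isEmbedding_embedProduct.secondCountableTopology

instance : CompactSpace (P.K n) := isCompact_iff_compactSpace.1 P.isCompact_K

variable [CompleteSpace k] [P.IsOddLocal]

instance : MulAction.IsPretransitive (P.G n) (P.X n) := by
  refine ⟨fun x y => ?_⟩
  obtain ⟨g, hg⟩ := P.exists_smul_one_eq x
  obtain ⟨h, hh⟩ := P.exists_smul_one_eq y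
  exact ⟨h * g⁻¹, by rw [mul_smul, ← hg, inv_smul_smul, hh]⟩

theorem isOpenMap_smul (x : P.X n) : IsOpenMap fun g : P.G n => g • x :=
  isOpenMap_smul_of_sigmaCompact x

/-- The orbit of a form under the maximal compact subgroup. -/
def orbitK (x : P.X n) : Set (P.X n) := (fun g : P.G n => g • x) '' (P.K n)

variable {P}

theorem self_mem_orbitK (x : P.X n) : x ∈ P.orbitK x := ⟨1, (P.K n).one_mem, one_smul _ _⟩

theorem orbitK_eq {x y : P.X n} (h : y ∈ P.orbitK x) : P.orbitK y = P.orbitK x := by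
  obtain ⟨κ, hκ, rfl⟩ := h
  ext z
  constructor
  · rintro ⟨κ', hκ', rfl⟩
    exact ⟨κ' * κ, (P.K n).mul_mem hκ' hκ, mul_smul _ _ _⟩
  · rintro ⟨κ', hκ', rfl⟩
    refine ⟨κ' * κ⁻¹, (P.K n).mul_mem hκ' ((P.K n).inv_mem hκ), ?_⟩
    change (κ' * κ⁻¹) • κ • x = κ' • x
    rw [mul_smul, inv_smul_smul]

theorem smul_mem_orbitK_iff {x y : P.X n} {κ : P.G n} (hκ : κ ∈ P.K n) :
    κ • y ∈ P.orbitK x ↔ y ∈ P.orbitK x := by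
  constructor
  · rintro ⟨κ', hκ', h⟩
    refine ⟨κ⁻¹ * κ', (P.K n).mul_mem ((P.K n).inv_mem hκ) hκ', ?_⟩
    change (κ⁻¹ * κ') • x = y
    have h' : κ' • x = κ • y := h
    rw [mul_smul, h', inv_smul_smul]
  · rintro ⟨κ', hκ', rfl⟩
    exact ⟨κ * κ', (P.K n).mul_mem hκ hκ', mul_smul _ _ _⟩

theorem isOpen_orbitK (x : P.X n) : IsOpen (P.orbitK x) := P.isOpenMap_smul x _ P.isOpen_K

theorem isCompact_orbitK (x : P.X n) : IsCompact (P.orbitK x) :=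
  P.isCompact_K.image (continuous_id.smul continuous_const)

/-- A `K`-invariant function is locally constant. -/
theorem isLocallyConstant_of_K_invariant {T : Type*} {φ : P.X n → T}
    (h : ∀ κ ∈ P.K n, ∀ x, φ (κ • x) = φ x) : IsLocallyConstant φ := by
  rw [IsLocallyConstant.iff_exists_open]
  refine fun x => ⟨P.orbitK x, isOpen_orbitK x, self_mem_orbitK x, ?_⟩
  rintro _ ⟨κ, hκ, rfl⟩
  exact h κ hκ x

/-! ### The relative invariants -/

theorem block_mul_of_lowerTri {A C : Matrix (Fin n) (Fin n) P.D} (hA : A ∈ P.lowerTri n)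
    (i : Fin n) : P.block (A * C) i = P.block A i * P.block C i := by
  ext1 a c
  simp only [block, Matrix.submatrix_apply, Matrix.mul_apply]
  refine (Fintype.sum_of_injective (Fin.castLE i.isLt) (Fin.castLE_injective _) _ _ ?_
    fun _ => rfl).symm
  intro l hl
  have : i.val < l.val := by
    by_contra h
    exact hl ⟨⟨l.val, by omega⟩, rfl⟩
  rw [hA _ _ (Fin.lt_def.2 (lt_of_le_of_lt (Nat.le_of_lt_succ a.isLt) this)), zero_mul]

theorem block_star (A : Matrix (Fin n) (Fin n) P.D) (i : Fin n) :
    P.block (star A) i = star (P.block A i) := rfl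

theorem nrd_block_smul {b : P.G n} (hb : b ∈ P.B n) (x : P.X n) (i : Fin n) :
    P.nrd (P.block (P.toMatrix (b • x)) i) =
      P.nrd (P.block (b : Matrix (Fin n) (Fin n) P.D) i) ^ 2 *
        P.nrd (P.block (P.toMatrix x) i) := by
  have h1 : ∀ A : Matrix (Fin n) (Fin n) P.D, P.block (A * star (b : Matrix (Fin n) (Fin n) P.D)) i
      = P.block A i * star (P.block (b : Matrix (Fin n) (Fin n) P.D) i) := by
    intro A
    rw [← star_star A, ← star_mul, block_star, block_mul_of_lowerTri hb, star_mul, ← block_star,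
      star_star]
  rw [toMatrix_smul, h1, block_mul_of_lowerTri hb, nrd_mul, nrd_mul, nrd_star]
  ring

theorem exists_sq_eq_nrd (x : P.X n) (i : Fin n) :
    ∃ a : k, a ^ 2 = P.nrd (P.block (P.toMatrix x) i) := by
  by_cases h : P.nrd (P.block (P.toMatrix x) i) = 0
  · exact ⟨0, by rw [h]; simp⟩
  obtain ⟨u, hu⟩ := P.isUnit_iff_nrd_ne_zero.2 h
  have hs : star u = u := Units.ext (by
    rw [Units.coe_star, hu, ← block_star, P.star_toMatrix])
  obtain ⟨g, hg⟩ := P.exists_smul_one_eq (⟨u, hs⟩ : P.X (i.val + 1))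
  refine ⟨P.nrd (g : Matrix (Fin (i.val + 1)) (Fin (i.val + 1)) P.D), ?_⟩
  have h2 := congrArg (fun y : P.X (i.val + 1) => P.nrd (P.toMatrix y)) hg
  simp only [toMatrix_smul, nrd_mul, nrd_star] at h2
  have h3 : P.nrd (P.toMatrix (⟨1, star_one _⟩ : P.X (i.val + 1))) = 1 := P.nrd_one
  rw [h3] at h2
  rw [← hu]
  change _ = P.nrd (P.toMatrix (⟨u, hs⟩ : P.X (i.val + 1)))
  rw [← h2]
  ring

theorem d_sq (i : Fin n) (x : P.X n) : P.d i x ^ 2 = P.nrd (P.block (P.toMatrix x) i) := by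
  rw [d, dif_pos (exists_sq_eq_nrd x i)]
  exact (exists_sq_eq_nrd x i).choose_spec

theorem norm_d (i : Fin n) (x : P.X n) :
    ‖P.d i x‖ = √‖P.nrd (P.block (P.toMatrix x) i)‖ := by
  rw [← d_sq, norm_pow, Real.sqrt_sq (norm_nonneg _)]

theorem norm_d_smul (i : Fin n) (b : P.B n) (x : P.X n) :
    ‖P.d i ((b : P.G n) • x)‖ = ‖P.psi i b‖ * ‖P.d i x‖ := by
  rw [norm_d, nrd_block_smul b.2, norm_mul, norm_pow, Real.sqrt_mul (by positivity),
    Real.sqrt_sq (norm_nonneg _), norm_d]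
  rfl

theorem psi_mul (i : Fin n) (b b' : P.B n) : P.psi i (b * b') = P.psi i b * P.psi i b' := by
  rw [psi, psi, psi, ← nrd_mul, ← block_mul_of_lowerTri b.2]
  rfl

theorem psi_one (i : Fin n) : P.psi i (1 : P.B n) = 1 := by
  have : P.block (((1 : P.B n) : P.G n) : Matrix (Fin n) (Fin n) P.D) i = 1 :=
    Matrix.submatrix_one _ (Fin.castLE_injective _)
  rw [psi, this, nrd_one]

theorem psi_ne_zero (i : Fin n) (b : P.B n) : P.psi i b ≠ 0 := by
  intro h
  have := psi_mul i b b⁻¹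
  rw [mul_inv_cancel, psi_one, h, zero_mul] at this
  exact one_ne_zero this

theorem psi_inv (i : Fin n) (b : P.B n) : P.psi i b⁻¹ = (P.psi i b)⁻¹ := by
  refine eq_inv_of_mul_eq_one_left ?_
  rw [← psi_mul, inv_mul_cancel, psi_one]

theorem psi_eq_prod (i : Fin n) (b : P.B n) : P.psi i b = ∏ j : Fin (i.val + 1),
    P.nm (((b : P.G n) : Matrix (Fin n) (Fin n) P.D) (Fin.castLE i.isLt j)
      (Fin.castLE i.isLt j)) := by
  rw [psi, nrd_lowerTri]
  · rfl
  · intro a c h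
    exact b.2 _ _ h

theorem norm_psi_eq_one (i : Fin n) {b : P.B n} (hb : (b : P.G n) ∈ P.K n) :
    ‖P.psi i b‖ = 1 := by
  have key : ∀ b : P.B n, (b : P.G n) ∈ P.K n → ‖P.psi i b‖ ≤ 1 := by
    intro b hb
    rw [psi_eq_prod, norm_prod]
    exact Finset.prod_le_one (fun _ _ => norm_nonneg _) fun j _ =>
      P.mem_maxOrder_iff.1 (hb.1 _ _)
  refine le_antisymm (key b hb) ?_
  have h := key b⁻¹ ((P.K n).inv_mem hb)
  rw [psi_inv, norm_inv] at h
  exact (inv_le_one₀ (norm_pos_iff.2 (psi_ne_zero i b))).1 h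

theorem continuous_nrd_block (i : Fin n) :
    Continuous fun x : P.X n => P.nrd (P.block (P.toMatrix x) i) :=
  P.continuous_nrd fun _ _ => P.continuous_toMatrix _ _

theorem continuous_norm_d (i : Fin n) : Continuous fun x : P.X n => ‖P.d i x‖ := by
  simp only [norm_d]
  exact (continuous_nrd_block i).norm.sqrt

theorem d_ne_zero_of_last (i : Fin n) (hi : i.val + 1 = n) (x : P.X n) : P.d i x ≠ 0 := by
  intro h
  have h1 := d_sq i x
  rw [h, zero_pow two_ne_zero] at h1
  obtain ⟨m, rfl⟩ : ∃ m, n = m + 1 := ⟨i.val, hi.symm⟩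
  obtain rfl : i = Fin.last m := Fin.ext (by simpa using hi)
  have : P.block (P.toMatrix x) (Fin.last m) = P.toMatrix x := rfl
  rw [this] at h1
  exact P.nrd_ne_zero_of_isUnit (x.1.isUnit) h1.symm

theorem exists_norm_psi_eq (i : Fin n) (b : P.B n) : ∃ m : ℤ, ‖P.psi i b‖ = (q k : ℝ) ^ m := by
  obtain ⟨m, hm⟩ := P.norm_eq_zpow (psi_ne_zero i b)
  exact ⟨-m, by rw [hm, IsOddLocal.norm_pi, inv_zpow, zpow_neg]⟩

/-- If no invariant vanishes at a point, then they are of constant absolute value near it. -/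
theorem eventually_norm_d_eq {x : P.X n} (i : Fin n) (hx : P.d i x ≠ 0) :
    ∀ᶠ y in nhds x, ‖P.d i y‖ = ‖P.d i x‖ := by
  have h0 : P.nrd (P.block (P.toMatrix x) i) ≠ 0 := by
    rw [← d_sq]
    exact pow_ne_zero 2 hx
  have h := (continuous_nrd_block (P := P) i).continuousAt (x := x)
  have h' := h.eventually (Metric.ball_mem_nhds _ (norm_pos_iff.2 h0))
  filter_upwards [h'] with y hy
  rw [norm_d, norm_d]
  congr 1
  rw [dist_eq_norm] at hy
  by_contra hne
  rw [norm_sub_eq_max' hne] at hy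
  exact absurd hy (not_lt.2 (le_max_right _ _))

/-- If all invariants are nonzero, the value of `|𝐝(x)|^s` is an explicit product. -/
theorem absd_smul (s : Fin n → ℂ) (b : P.B n) (x : P.X n) :
    P.absd s ((b : P.G n) • x) = (∏ i, ((‖P.psi i b‖ : ℝ) : ℂ) ^ s i) * P.absd s x := by
  have h : (∀ i, P.d i ((b : P.G n) • x) ≠ 0) ↔ ∀ i, P.d i x ≠ 0 := by
    refine forall_congr' fun i => ?_
    rw [← norm_ne_zero_iff, norm_d_smul, ← norm_ne_zero_iff]
    simp [psi_ne_zero]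
  unfold absd
  by_cases hx : ∀ i, P.d i x ≠ 0
  · rw [if_pos hx, if_pos (h.2 hx), ← Finset.prod_mul_distrib]
    refine Finset.prod_congr rfl fun i _ => ?_
    rw [norm_d_smul, Complex.ofReal_mul, Complex.mul_cpow_ofReal_nonneg (norm_nonneg _)
      (norm_nonneg _)]
  · rw [if_neg hx, if_neg fun h' => hx (h.1 h'), mul_zero]

theorem measurable_absd (s : Fin n → ℂ) : Measurable (P.absd (n := n) s) := by
  unfold absd
  refine Measurable.ite ?_ ?_ measurable_const
  · have : {x : P.X n | ∀ i, P.d i x ≠ 0} = ⋂ i, (fun x => ‖P.d i x‖) ⁻¹' {0}ᶜ := by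
      ext x
      simp
    rw [this]
    exact MeasurableSet.iInter fun i => (continuous_norm_d i).measurable
      (measurableSet_singleton 0).compl
  · refine Finset.measurable_prod _ fun i _ => ?_
    exact (Complex.measurable_ofReal.comp (continuous_norm_d i).measurable).pow_const _

/-- In the region of convergence `|𝐝|^s` is bounded on compact sets. No condition on the last
exponent is needed, since `dₙ` does not vanish on `X`. -/
theorem exists_norm_absd_le {s : Fin n → ℂ} (hs : s ∈ region n) {C : Set (P.X n)}
    (hC : IsCompact C) : ∃ M : ℝ, ∀ x ∈ C, ‖P.absd s x‖ ≤ M := by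
  have key : ∀ i : Fin n, ∃ M : ℝ, 0 ≤ M ∧ ∀ x ∈ C, P.d i x ≠ 0 →
      ‖((‖P.d i x‖ : ℝ) : ℂ) ^ s i‖ ≤ M := by
    intro i
    by_cases hi : i.val + 1 < n
    · obtain ⟨M, hM⟩ := hC.exists_bound_of_continuousOn (continuous_norm_d i).continuousOn
      refine ⟨|M| ^ (s i).re, by positivity, fun x hx hd => ?_⟩
      rw [Complex.norm_cpow_eq_rpow_re_of_pos (norm_pos_iff.2 hd)]
      have h := hM x hx
      rw [norm_norm] at h
      exact Real.rpow_le_rpow (norm_nonneg _) (h.trans (le_abs_self M)) (hs i hi)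
    · have hd : ∀ x : P.X n, P.d i x ≠ 0 := d_ne_zero_of_last i (by omega)
      have hc : Continuous fun x : P.X n => ‖P.d i x‖ ^ (s i).re :=
        (continuous_norm_d i).rpow_const fun x => Or.inl (norm_ne_zero_iff.2 (hd x))
      obtain ⟨M, hM⟩ := hC.exists_bound_of_continuousOn hc.continuousOn
      refine ⟨|M|, abs_nonneg _, fun x hx hd => ?_⟩
      rw [Complex.norm_cpow_eq_rpow_re_of_pos (norm_pos_iff.2 hd)]
      exact (le_abs_self _).trans ((hM x hx).trans (le_abs_self M))
  choose M hM0 hM using key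
  refine ⟨∏ i, M i, fun x hx => ?_⟩
  unfold absd
  split_ifs with h
  · rw [norm_prod]
    exact Finset.prod_le_prod (fun _ _ => norm_nonneg _) fun i _ => hM i x hx (h i)
  · rw [norm_zero]
    exact Finset.prod_nonneg fun i _ => hM0 i

end QuatData

/-! ### Functions which are rational in `q^s` -/

section Rational

open MvPolynomial in
/-- The function `Φ` of `s ∈ S` is given by a rational function in `q^{s₁}, …, q^{sₙ}`, where the
denominator may vanish at some points. -/
def IsRat {n : ℕ} (q : ℕ) (S : Set (Fin n → ℂ)) (Φ : (Fin n → ℂ) → ℂ) : Prop :=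
  ∃ N M : MvPolynomial (Fin n) ℂ, M ≠ 0 ∧
    ∀ s ∈ S, eval (fun i => (q : ℂ) ^ s i) M * Φ s = eval (fun i => (q : ℂ) ^ s i) N

namespace IsRat

variable {n q : ℕ} {S : Set (Fin n → ℂ)} {Φ Ψ : (Fin n → ℂ) → ℂ}

theorem represents (h : IsRat q S Φ) : Represents q S Φ (continuation q S Φ) := by
  have h' : ∃ R, Represents q S Φ R := by
    obtain ⟨N, M, hM, h⟩ := h
    exact ⟨_, N, M, hM, rfl, h⟩
  rw [continuation, dif_pos h']
  exact h'.choose_spec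

theorem congr (h : IsRat q S Φ) (h' : ∀ s ∈ S, Ψ s = Φ s) : IsRat q S Ψ := by
  obtain ⟨N, M, hM, h⟩ := h
  exact ⟨N, M, hM, fun s hs => by rw [h' s hs, h s hs]⟩

theorem const (c : ℂ) : IsRat q S fun _ => c :=
  ⟨MvPolynomial.C c, 1, one_ne_zero, fun s _ => by simp⟩

theorem add (h : IsRat q S Φ) (h' : IsRat q S Ψ) : IsRat q S fun s => Φ s + Ψ s := by
  obtain ⟨N, M, hM, h⟩ := h
  obtain ⟨N', M', hM', h'⟩ := h'
  refine ⟨N * M' + N' * M, M * M', mul_ne_zero hM hM', fun s hs => ?_⟩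
  simp only [map_mul, map_add, ← h s hs, ← h' s hs]
  ring

theorem mul (h : IsRat q S Φ) (h' : IsRat q S Ψ) : IsRat q S fun s => Φ s * Ψ s := by
  obtain ⟨N, M, hM, h⟩ := h
  obtain ⟨N', M', hM', h'⟩ := h'
  refine ⟨N * N', M * M', mul_ne_zero hM hM', fun s hs => ?_⟩
  simp only [map_mul, ← h s hs, ← h' s hs]
  ring

theorem sum {ι : Type*} (A : Finset ι) {Φ : ι → (Fin n → ℂ) → ℂ}
    (h : ∀ i ∈ A, IsRat q S (Φ i)) : IsRat q S fun s => ∑ i ∈ A, Φ i s := by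
  classical
  induction A using Finset.induction_on with
  | empty => simpa using const 0
  | insert i A hi ih =>
    refine ((h i (Finset.mem_insert_self _ _)).add
      (ih fun j hj => h j (Finset.mem_insert_of_mem hj))).congr fun s _ => ?_
    rw [Finset.sum_insert hi]

end IsRat

/-- The function `∏ᵢ q^{mᵢ sᵢ}`. -/
def qmon {n : ℕ} (q : ℕ) (m : Fin n → ℤ) (s : Fin n → ℂ) : ℂ := ∏ i, ((q : ℂ) ^ s i) ^ m i

variable {n q : ℕ} {S : Set (Fin n → ℂ)}

theorem ofReal_zpow_cpow (hq : 2 ≤ q) (m : ℤ) (s : ℂ) :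
    ((((q : ℝ) ^ m : ℝ)) : ℂ) ^ s = ((q : ℂ) ^ s) ^ m := by
  have h0 : (0 : ℝ) < q := by positivity
  rw [Complex.cpow_def_of_ne_zero, Complex.cpow_def_of_ne_zero, ← Complex.exp_int_mul,
    ← Complex.ofReal_log (zpow_nonneg h0.le _), Real.log_zpow, ← Complex.ofReal_natCast q,
    ← Complex.ofReal_log h0.le]
  · congr 1
    push_cast
    ring
  · exact_mod_cast h0.ne'
  · exact_mod_cast (zpow_pos h0 _).ne'

theorem prod_eq_qmon (hq : 2 ≤ q) {c : Fin n → ℝ} {m : Fin n → ℤ}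
    (h : ∀ i, c i = (q : ℝ) ^ m i) (s : Fin n → ℂ) : ∏ i, ((c i : ℝ) : ℂ) ^ s i = qmon q m s := by
  refine Finset.prod_congr rfl fun i _ => ?_
  rw [h, ofReal_zpow_cpow hq]

/-- The denominator of the monomial with exponents `m`; its numerator belongs to `-m`. -/
theorem eval_denom_mul_qmon (hq : 2 ≤ q) (m : Fin n → ℤ) (s : Fin n → ℂ) :
    MvPolynomial.eval (fun i => (q : ℂ) ^ s i)
        (MvPolynomial.monomial (Finsupp.equivFunOnFinite.symm fun i => (-m i).toNat) 1) *
      qmon q m s = MvPolynomial.eval (fun i => (q : ℂ) ^ s i)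
        (MvPolynomial.monomial (Finsupp.equivFunOnFinite.symm fun i => (m i).toNat) 1) := by
  rw [MvPolynomial.eval_monomial, MvPolynomial.eval_monomial, Finsupp.prod_fintype _ _ (by simp),
    Finsupp.prod_fintype _ _ (by simp), one_mul, one_mul, qmon, ← Finset.prod_mul_distrib]
  refine Finset.prod_congr rfl fun i _ => ?_
  have h0 : (q : ℂ) ^ s i ≠ 0 := by
    rw [Complex.cpow_def_of_ne_zero (Nat.cast_ne_zero.2 (by omega))]
    exact Complex.exp_ne_zero _
  simp only [Finsupp.equivFunOnFinite_symm_apply_apply]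
  rw [← zpow_natCast, ← zpow_natCast, ← zpow_add₀ h0]
  congr 1
  omega

theorem isRat_qmon (hq : 2 ≤ q) (m : Fin n → ℤ) : IsRat q S (qmon q m) :=
  ⟨_, _, by simp [MvPolynomial.monomial_eq_zero], fun s _ => eval_denom_mul_qmon hq m s⟩

/-- Division by `a - b q^{⟨m, s⟩}`, `m ≠ 0`, preserves rationality. -/
theorem IsRat.of_mul_sub (hq : 2 ≤ q) {m : Fin n → ℤ} (hm : m ≠ 0) {a b : ℂ} (ha : a ≠ 0)
    {Φ : (Fin n → ℂ) → ℂ} (h : IsRat q S fun s => (a - b * qmon q m s) * Φ s) : IsRat q S Φ := by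
  obtain ⟨N, M, hM, h⟩ := h
  set e : Fin n →₀ ℕ := Finsupp.equivFunOnFinite.symm fun i => (-m i).toNat with he
  set e' : Fin n →₀ ℕ := Finsupp.equivFunOnFinite.symm fun i => (m i).toNat with he'
  have hne : e' ≠ e := by
    intro hee
    apply hm
    ext i
    have := DFunLike.congr_fun hee i
    simp only [he, he', Finsupp.equivFunOnFinite_symm_apply_apply] at this
    simp only [Pi.zero_apply]
    omega
  have h0 : MvPolynomial.monomial e a - MvPolynomial.monomial e' b ≠ 0 := by
    intro h0
    have := congrArg (MvPolynomial.coeff e) h0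
    rw [MvPolynomial.coeff_sub, MvPolynomial.coeff_monomial, MvPolynomial.coeff_monomial,
      if_pos rfl, if_neg hne, sub_zero, MvPolynomial.coeff_zero] at this
    exact ha this
  refine ⟨MvPolynomial.monomial e 1 * N, M * (MvPolynomial.monomial e a -
    MvPolynomial.monomial e' b), mul_ne_zero hM h0, fun s hs => ?_⟩
  have h1 := eval_denom_mul_qmon hq m s
  rw [← he, ← he'] at h1
  have h2 : ∀ (e : Fin n →₀ ℕ) (c : ℂ), MvPolynomial.monomial e c =
      MvPolynomial.C c * MvPolynomial.monomial e (1 : ℂ) := by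
    intro e c
    rw [MvPolynomial.C_mul_monomial, mul_one]
  rw [h2 e a, h2 e' b]
  simp only [map_mul, map_sub, MvPolynomial.eval_C, ← h1, ← h s hs]
  ring

theorem Represents.isRat {Φ : (Fin n → ℂ) → ℂ} {R : RatField n} (h : Represents q S Φ R) :
    IsRat q S Φ := by
  obtain ⟨N, M, hM, -, h⟩ := h
  exact ⟨N, M, hM, h⟩

theorem algebraMap_ne_zero {M : MvPolynomial (Fin n) ℂ} (hM : M ≠ 0) :
    algebraMap _ (RatField n) M ≠ 0 := by simpa using hM

theorem Represents.mul {S' : Set (Fin n → ℂ)} (hS : S ⊆ S') {Φ Ψ : (Fin n → ℂ) → ℂ}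
    {R R' : RatField n} (h : Represents q S' Φ R) (h' : Represents q S Ψ R') :
    Represents q S (fun s => Φ s * Ψ s) (R * R') := by
  obtain ⟨N, M, hM, rfl, h⟩ := h
  obtain ⟨N', M', hM', rfl, h'⟩ := h'
  refine ⟨N * N', M * M', mul_ne_zero hM hM', ?_, fun s hs => ?_⟩
  · rw [map_mul, map_mul, div_mul_div_comm]
  · simp only [map_mul, ← h s (hS hs), ← h' s hs]
    ring

theorem Represents.add {Φ Ψ : (Fin n → ℂ) → ℂ}
    {R R' : RatField n} (h : Represents q S Φ R) (h' : Represents q S Ψ R') :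
    Represents q S (fun s => Φ s + Ψ s) (R + R') := by
  obtain ⟨N, M, hM, rfl, h⟩ := h
  obtain ⟨N', M', hM', rfl, h'⟩ := h'
  refine ⟨N * M' + M * N', M * M', mul_ne_zero hM hM', ?_, fun s hs => ?_⟩
  · rw [map_mul, map_add, map_mul, map_mul,
      div_add_div _ _ (algebraMap_ne_zero hM) (algebraMap_ne_zero hM')]
  · simp only [map_mul, map_add, ← h s hs, ← h' s hs]
    ring

theorem Represents.zero : Represents q S (fun _ => 0) 0 :=
  ⟨0, 1, one_ne_zero, by simp, fun s _ => by simp⟩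

theorem Represents.smul (c : ℂ) {Φ : (Fin n → ℂ) → ℂ} {R : RatField n}
    (h : Represents q S Φ R) : Represents q S (fun s => c * Φ s) (c • R) := by
  obtain ⟨N, M, hM, rfl, h⟩ := h
  refine ⟨MvPolynomial.C c * N, M, hM, ?_, fun s hs => ?_⟩
  · rw [map_mul, mul_div_assoc, ← MvPolynomial.algebraMap_eq,
      ← IsScalarTower.algebraMap_apply, ← Algebra.smul_def]
  · rw [map_mul, MvPolynomial.eval_C, ← h s hs]
    ring

theorem Represents.sum {ι : Type*} (A : Finset ι) {Φ : ι → (Fin n → ℂ) → ℂ} {R : ι → RatField n}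
    (h : ∀ i ∈ A, Represents q S (Φ i) (R i)) :
    Represents q S (fun s => ∑ i ∈ A, Φ i s) (∑ i ∈ A, R i) := by
  classical
  induction A using Finset.induction_on with
  | empty => simpa using Represents.zero
  | insert i A hi ih =>
    simp only [Finset.sum_insert hi]
    exact (h i (Finset.mem_insert_self _ _)).add
      (ih fun j hj => h j (Finset.mem_insert_of_mem hj))

theorem Represents.congr {Φ Ψ : (Fin n → ℂ) → ℂ} {R : RatField n} (h : Represents q S Φ R)
    (h' : ∀ s ∈ S, Ψ s = Φ s) : Represents q S Ψ R := by
  obtain ⟨N, M, hM, hR, h⟩ := h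
  exact ⟨N, M, hM, hR, fun s hs => by rw [h' s hs, h s hs]⟩

end Rational

/-! ### Rationality of zeta integrals -/

namespace QuatData

variable {k : Type*} [NontriviallyNormedField k] [IsUltrametricDist k] {P : QuatData k} {n : ℕ}

/-- Locally constant functions of compact support. -/
def IsTest (Φ : P.X n → ℂ) : Prop := IsLocallyConstant Φ ∧ HasCompactSupport Φ

namespace IsTest

variable {Φ Ψ : P.X n → ℂ}

theorem isClopen_support (h : IsTest Φ) : IsClopen (Function.support Φ) :=
  h.1.isClopen_fiber 0 |>.compl

theorem isCompact_support (h : IsTest Φ) : IsCompact (Function.support Φ) := by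
  have := h.2.isCompact
  rwa [tsupport, h.isClopen_support.isClosed.closure_eq] at this

theorem add (h : IsTest Φ) (h' : IsTest Ψ) : IsTest fun y => Φ y + Ψ y :=
  ⟨h.1.add h'.1, h.2.add h'.2⟩

theorem const_mul (h : IsTest Φ) (c : ℂ) : IsTest fun y => c * Φ y :=
  ⟨h.1.comp (fun z => c * z), h.2.comp_left (g := fun z => c * z) (by simp)⟩

theorem zero : IsTest fun _ : P.X n => 0 := ⟨.const 0, HasCompactSupport.zero⟩

theorem sum {ι : Type*} (A : Finset ι) {Φ : ι → P.X n → ℂ} (h : ∀ i, IsTest (Φ i)) :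
    IsTest fun y => ∑ i ∈ A, Φ i y := by
  classical
  induction A using Finset.induction_on with
  | empty => simpa using zero
  | insert i A hi ih =>
    simp only [Finset.sum_insert hi]
    exact (h i).add ih

theorem ite (h : IsTest Φ) {W : Set (P.X n)} (hW : IsClopen W) : IsTest (W.indicator Φ) := by
  refine ⟨?_, h.2.mono fun y hy hΦ => hy (by rw [Set.indicator_apply_eq_zero]; exact fun _ => hΦ)⟩
  rw [IsLocallyConstant.iff_eventually_eq]
  intro x
  by_cases hx : x ∈ W
  · filter_upwards [(IsLocallyConstant.iff_eventually_eq _).1 h.1 x, hW.isOpen.mem_nhds hx]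
      with y hy hyW
    rw [Set.indicator_of_mem hx, Set.indicator_of_mem hyW, hy]
  · filter_upwards [hW.compl.isOpen.mem_nhds hx] with y hyW
    rw [Set.indicator_of_notMem hx, Set.indicator_of_notMem hyW]

theorem indicator_one {W : Set (P.X n)} (hW : IsCompact W) (hW' : IsOpen W) :
    IsTest (W.indicator fun _ => (1 : ℂ)) := by
  refine ⟨?_, HasCompactSupport.intro hW fun y hy => Set.indicator_of_notMem hy _⟩
  rw [IsLocallyConstant.iff_eventually_eq]
  intro x
  by_cases hx : x ∈ W
  · filter_upwards [hW'.mem_nhds hx] with y hyW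
    rw [Set.indicator_of_mem hx, Set.indicator_of_mem hyW]
  · filter_upwards [hW.isClosed.isOpen_compl.mem_nhds hx] with y hyW
    rw [Set.indicator_of_notMem hx, Set.indicator_of_notMem hyW]

theorem smul (h : IsTest Φ) (g : P.G n) : IsTest fun y => Φ (g • y) :=
  ⟨h.1.comp_continuous (continuous_const_smul g), h.2.comp_homeomorph (Homeomorph.smul g)⟩

theorem integrable_comp [LocallyCompactSpace k] [CompleteSpace k] [P.IsOddLocal] (h : IsTest Φ)
    {s : Fin n → ℂ} (hs : s ∈ region n) {τ : P.X n → P.X n} (hτ : Continuous τ)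
    (dx : Measure (P.X n)) [IsFiniteMeasureOnCompacts dx] :
    Integrable (fun y => Φ y * P.absd s (τ y)) dx := by
  obtain ⟨M, hM⟩ := exists_norm_absd_le hs (h.isCompact_support.image hτ)
  obtain ⟨M', hM'⟩ := h.isCompact_support.exists_bound_of_continuousOn h.1.continuous.continuousOn
  rw [← integrableOn_iff_integrable_of_support_subset (s := Function.support Φ)
    fun y hy hΦ => hy (by simp only [hΦ, zero_mul])]
  refine Measure.integrableOn_of_bounded (M := |M'| * |M|) h.isCompact_support.measure_lt_top.ne
    (h.1.continuous.measurable.mul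
      ((measurable_absd s).comp hτ.measurable)).aestronglyMeasurable ?_
  filter_upwards [ae_restrict_mem h.isClopen_support.isOpen.measurableSet] with y hy
  rw [norm_mul]
  exact mul_le_mul ((hM' y hy).trans (le_abs_self _)) ((hM _ ⟨y, hy, rfl⟩).trans (le_abs_self _))
    (norm_nonneg _) (abs_nonneg _)

theorem integrable [LocallyCompactSpace k] [CompleteSpace k] [P.IsOddLocal] (h : IsTest Φ)
    {s : Fin n → ℂ} (hs : s ∈ region n) (dx : Measure (P.X n)) [IsFiniteMeasureOnCompacts dx] :
    Integrable (fun y => Φ y * P.absd s y) dx :=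
  h.integrable_comp hs continuous_id dx

end IsTest

/-- The zeta integral `∫_X Φ(x) |𝐝(x)|^s dx`. -/
def zeta (dx : Measure (P.X n)) (Φ : P.X n → ℂ) (s : Fin n → ℂ) : ℂ :=
  ∫ y, Φ y * P.absd s y ∂dx

variable [LocallyCompactSpace k] [CompleteSpace k] [P.IsOddLocal] {dx : Measure (P.X n)}
  [IsFiniteMeasureOnCompacts dx] {Φ Ψ : P.X n → ℂ}

theorem zeta_add (h : IsTest Φ) (h' : IsTest Ψ) {s : Fin n → ℂ} (hs : s ∈ region n) :
    zeta dx (fun y => Φ y + Ψ y) s = zeta dx Φ s + zeta dx Ψ s := by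
  unfold zeta
  rw [← integral_add (h.integrable hs dx) (h'.integrable hs dx)]
  simp only [add_mul]

theorem zeta_const_mul (c : ℂ) (s : Fin n → ℂ) :
    zeta dx (fun y => c * Φ y) s = c * zeta dx Φ s := by
  unfold zeta
  rw [← integral_const_mul]
  simp only [mul_assoc]

theorem zeta_sum {ι : Type*} (A : Finset ι) {Φ : ι → P.X n → ℂ} (h : ∀ i, IsTest (Φ i))
    {s : Fin n → ℂ} (hs : s ∈ region n) :
    zeta dx (fun y => ∑ i ∈ A, Φ i y) s = ∑ i ∈ A, zeta dx (Φ i) s := by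
  unfold zeta
  rw [← integral_finsetSum _ fun i _ => (h i).integrable hs dx]
  simp only [Finset.sum_mul]

theorem zeta_smul [SMulInvariantMeasure (P.G n) (P.X n) dx] (b : P.B n) (s : Fin n → ℂ) :
    zeta dx (fun y => Φ ((b : P.G n)⁻¹ • y)) s =
      (∏ i, ((‖P.psi i b‖ : ℝ) : ℂ) ^ s i) * zeta dx Φ s := by
  unfold zeta
  rw [← integral_smul_eq_self (μ := dx) _ (g := (b : P.G n)), ← integral_const_mul]
  simp only [inv_smul_smul, absd_smul]
  congr 1
  ext y
  ring

theorem zeta_smul_eq [SMulInvariantMeasure (P.G n) (P.X n) dx] {b : P.B n}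
    (hb : ∀ i, ‖P.psi i b‖ = 1) (s : Fin n → ℂ) :
    zeta dx (fun y => Φ ((b : P.G n)⁻¹ • y)) s = zeta dx Φ s := by
  rw [zeta_smul]
  simp [hb]

variable (dx) in
/-- The test function `Φ` has a rational zeta integral. -/
def HasRatZeta (Φ : P.X n → ℂ) : Prop := IsRat (q k) (region n) (zeta dx Φ)

variable (dx) in
/-- All test functions supported in `U` have rational zeta integrals. -/
def IsGood (U : Set (P.X n)) : Prop :=
  ∀ Φ : P.X n → ℂ, IsTest Φ → Function.support Φ ⊆ U → HasRatZeta dx Φ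

variable (dx) in
/-- The set of points without good neighbourhoods. -/
def badSet : Set (P.X n) := {x | ∀ U : Set (P.X n), IsOpen U → x ∈ U → ¬ IsGood dx U}

theorem isClosed_badSet : IsClosed (badSet dx) := by
  rw [← isOpen_compl_iff, isOpen_iff_mem_nhds]
  intro x hx
  simp only [badSet, Set.mem_compl_iff, Set.mem_ofPred_eq, not_forall, not_not] at hx
  obtain ⟨U, hU, hxU, h⟩ := hx
  filter_upwards [hU.mem_nhds hxU] with y hy hbad
  exact hbad U hU hy h

theorem HasRatZeta.of_ite (h : IsTest Φ) {W : Set (P.X n)} (hW : IsClopen W)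
    (h1 : HasRatZeta dx (W.indicator Φ)) (h2 : HasRatZeta dx (Wᶜ.indicator Φ)) :
    HasRatZeta dx Φ := by
  refine (IsRat.add h1 h2).congr fun s hs => ?_
  rw [← zeta_add (h.ite hW) (h.ite hW.compl) hs]
  congr 1
  ext y
  by_cases hy : y ∈ W <;> simp [hy]

/-- A gluing principle: rationality for the functions of a class stable under restriction may be
checked locally on a compact set `C` containing the supports. -/
theorem hasRatZeta_of_local (𝒯 : (P.X n → ℂ) → Prop) (𝒲 : Set (P.X n) → Prop)
    (h𝒯 : ∀ Φ, 𝒯 Φ → IsTest Φ) (h𝒲 : ∀ W, 𝒲 W → IsClopen W) (h0 : 𝒲 ∅)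
    (hun : ∀ W W', 𝒲 W → 𝒲 W' → 𝒲 (W ∪ W')) (hcompl : ∀ W, 𝒲 W → 𝒲 Wᶜ)
    (hres : ∀ Φ W, 𝒯 Φ → 𝒲 W → 𝒯 (W.indicator Φ))
    {C : Set (P.X n)} (hC : IsCompact C)
    (hloc : ∀ x ∈ C, ∃ W, 𝒲 W ∧ x ∈ W ∧ ∀ Φ, 𝒯 Φ → Function.support Φ ⊆ W → HasRatZeta dx Φ) :
    ∃ W, 𝒲 W ∧ C ⊆ W ∧ ∀ Φ, 𝒯 Φ → Function.support Φ ⊆ W → HasRatZeta dx Φ := by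
  refine hC.induction_on (p := fun C => ∃ W, 𝒲 W ∧ C ⊆ W ∧ ∀ Φ, 𝒯 Φ → Function.support Φ ⊆ W →
    HasRatZeta dx Φ) ⟨∅, h0, le_rfl, fun Φ hΦ hs => ?_⟩
    (fun s t hst ⟨W, h1, h2, h3⟩ => ⟨W, h1, hst.trans h2, h3⟩) ?_ fun x hx => ?_
  · have : Φ = fun _ => 0 := by
      ext y
      by_contra hy
      exact hs hy
    refine (IsRat.const 0).congr fun s _ => ?_
    simp [zeta, this]
  · rintro s t ⟨W, h1, h2, h3⟩ ⟨W', h1', h2', h3'⟩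
    refine ⟨W ∪ W', hun _ _ h1 h1', Set.union_subset_union h2 h2', fun Φ hΦ hs => ?_⟩
    refine HasRatZeta.of_ite (h𝒯 Φ hΦ) (h𝒲 W h1) (h3 _ (hres Φ W hΦ h1) fun y hy => ?_)
      (h3' _ (hres Φ Wᶜ hΦ (hcompl W h1)) fun y hy => ?_)
    · rw [Set.support_indicator] at hy
      exact hy.1
    · have h4 : y ∈ Wᶜ ∩ Function.support Φ := by rwa [Set.support_indicator] at hy
      exact (hs h4.2).resolve_left h4.1
  · obtain ⟨W, h1, h2, h3⟩ := hloc x hx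
    exact ⟨W, mem_nhdsWithin_of_mem_nhds ((h𝒲 W h1).isOpen.mem_nhds h2), W, h1, le_rfl, h3⟩

/-- Test functions vanishing on the bad set have rational zeta integrals. -/
theorem hasRatZeta_of_vanish (h : IsTest Φ) (h0 : ∀ y ∈ badSet dx, Φ y = 0) :
    HasRatZeta dx Φ := by
  obtain ⟨W, -, hW, hW'⟩ := hasRatZeta_of_local (dx := dx) IsTest IsClopen (fun _ h => h)
    (fun _ h => h) isClopen_empty (fun _ _ h h' => h.union h') (fun _ h => h.compl)
    (fun _ _ h h' => h.ite h') h.isCompact_support fun x hx => by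
      have : x ∉ badSet dx := fun h => hx (h0 x h)
      simp only [badSet, Set.mem_ofPred_eq, not_forall, not_not] at this
      obtain ⟨U, hU, hxU, h1⟩ := this
      obtain ⟨V, hV, hV', hxV, hVU⟩ := exists_isCompact_isOpen_between isCompact_singleton hU
        (Set.singleton_subset_iff.2 hxU)
      exact ⟨V, ⟨hV.isClosed, hV'⟩, Set.singleton_subset_iff.1 hxV, fun Φ h2 h3 =>
        h1 Φ h2 (h3.trans hVU)⟩
  exact hW' Φ h hW

theorem HasRatZeta.congr_badSet (h : HasRatZeta dx Ψ) (hΨ : IsTest Ψ) (hΦ : IsTest Φ)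
    (h' : ∀ y ∈ badSet dx, Φ y = Ψ y) : HasRatZeta dx Φ := by
  have h1 := hasRatZeta_of_vanish (dx := dx) (hΦ.add (hΨ.const_mul (-1))) fun y hy => by
    rw [h' y hy]
    ring
  refine (IsRat.add h h1).congr fun s hs => ?_
  rw [← zeta_add hΨ (hΦ.add (hΨ.const_mul (-1))) hs]
  congr 1
  ext y
  ring

theorem smul_mem_badSet [SMulInvariantMeasure (P.G n) (P.X n) dx] (b : P.B n) {x : P.X n}
    (hx : x ∈ badSet dx) : (b : P.G n) • x ∈ badSet dx := by
  intro U hU hbU hgood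
  refine hx ((fun y => (b : P.G n) • y) ⁻¹' U) (hU.preimage (continuous_const_smul _)) hbU
    fun Φ hΦ hs => ?_
  have h1 := hgood _ (hΦ.smul (b : P.G n)⁻¹) fun y hy => by
    have := hs hy
    rwa [Set.mem_preimage, smul_inv_smul] at this
  choose m hm using fun i : Fin n => exists_norm_psi_eq i b⁻¹
  refine (IsRat.mul (isRat_qmon P.two_le_q m) h1).congr fun s hs => ?_
  rw [← prod_eq_qmon P.two_le_q hm, ← zeta_smul b⁻¹]
  simp

/-- Near a point where no relative invariant vanishes, the zeta integrals are monomials. -/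
theorem notMem_badSet_of_d_ne_zero {x : P.X n} (hx : ∀ i, P.d i x ≠ 0) : x ∉ badSet dx := by
  intro hbad
  have h1 := Filter.eventually_all.2 fun i => eventually_norm_d_eq i (hx i)
  obtain ⟨U, hU, hUo, hxU⟩ := mem_nhds_iff.1 h1
  refine hbad U hUo hxU fun Φ hΦ hs => ?_
  choose m hm using fun i : Fin n => P.norm_eq_zpow (hx i)
  have hm' : ∀ i, ‖P.d i x‖ = (q k : ℝ) ^ (-m i) := fun i => by
    rw [hm, IsOddLocal.norm_pi, inv_zpow, zpow_neg]
  refine (IsRat.mul (IsRat.const (∫ y, Φ y ∂dx)) (isRat_qmon P.two_le_q fun i => -m i)).congr fun s _ => ?_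
  rw [← prod_eq_qmon P.two_le_q hm', zeta, ← integral_mul_const]
  congr 1
  ext y
  by_cases hy : Φ y = 0
  · rw [hy, zero_mul, zero_mul]
  · have h2 : ∀ i, ‖P.d i y‖ = ‖P.d i x‖ := hU (hs hy)
    have h3 : ∀ i, P.d i y ≠ 0 := fun i => by
      rw [← norm_ne_zero_iff, h2]
      exact norm_ne_zero_iff.2 (hx i)
    rw [absd, if_pos h3]
    simp only [h2]

end QuatData

namespace QuatData

variable {k : Type*} [NontriviallyNormedField k] [IsUltrametricDist k] {P : QuatData k} {n : ℕ}
  [LocallyCompactSpace k] [CompleteSpace k] [P.IsOddLocal]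

instance : SigmaCompactSpace (P.B n) :=
  (P.isClosed_B n).isClosedEmbedding_subtypeVal.sigmaCompactSpace

/-- An element of the stabilizer in `B` of a degenerate form, on which the characters `ψᵢ` are not
all units. -/
theorem exists_stabilizer {z : P.X n} (hz : ∃ i, P.d i z = 0) :
    ∃ (h : P.B n) (m : Fin n → ℤ), (h : P.G n) • z = z ∧ m ≠ 0 ∧
      ∀ i, ‖P.psi i h‖ = (q k : ℝ) ^ m i := by
  obtain ⟨b, hb, σ, hσ, hbz⟩ := exists_B_smul_eq_permX z
  have hdb : ∀ i, P.d i z = 0 ↔ P.d i (P.permX σ hσ) = 0 := by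
    intro i
    have := norm_d_smul i ⟨b, hb⟩ z
    change ‖P.d i (b • z)‖ = _ at this
    rw [hbz] at this
    rw [← norm_eq_zero (a := P.d i (P.permX σ hσ)), this, mul_eq_zero, norm_eq_zero, norm_eq_zero,
      or_iff_right (psi_ne_zero i _)]
  -- the involution is not trivial
  obtain ⟨i, hi⟩ : ∃ i, σ i ≠ i := by
    by_contra hcon
    push Not at hcon
    obtain ⟨i, hi⟩ := hz
    have h1 : P.block (P.toMatrix (P.permX σ hσ)) i = 1 := by
      ext1 a c
      simp only [block, Matrix.submatrix_apply, toMatrix_permX, hcon, Matrix.one_apply]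
      congr 1
      simp [Fin.ext_iff, eq_comm]
    have h2 := d_sq i (P.permX σ hσ)
    rw [(hdb i).1 hi, h1, nrd_one, zero_pow two_ne_zero] at h2
    exact zero_ne_one h2
  obtain ⟨i, hi⟩ : ∃ i, i < σ i := by
    rcases lt_or_gt_of_ne hi with h | h
    · exact ⟨σ i, by rwa [hσ]⟩
    · exact ⟨i, h⟩
  have hne : σ i ≠ i := hi.ne'
  let d : Fin n → P.D := fun l =>
    algebraMap k P.D (if l = i then P.π else if l = σ i then P.π⁻¹ else 1)
  have hd : ∀ l, d l ≠ 0 := by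
    intro l
    simp only [d]
    rw [map_ne_zero_iff _ (algebraMap k P.D).injective]
    split_ifs
    exacts [P.π_ne_zero, inv_ne_zero P.π_ne_zero, one_ne_zero]
  have hds : ∀ l, d l * star (d (σ l)) = 1 := by
    intro l
    simp only [d]
    rw [star_algebraMap, ← map_mul, ← map_one (algebraMap k P.D)]
    congr 1
    by_cases h1 : l = i
    · rw [h1, if_pos rfl, if_neg hne, if_pos rfl, mul_inv_cancel₀ P.π_ne_zero]
    · by_cases h2 : l = σ i
      · rw [h2, hσ, if_neg hne, if_pos rfl, if_pos rfl, inv_mul_cancel₀ P.π_ne_zero]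
      · have h3 : σ l ≠ i := fun h => h2 (by rw [← h, hσ])
        have h4 : σ l ≠ σ i := fun h => h1 (σ.injective h)
        rw [if_neg h1, if_neg h2, if_neg h3, if_neg h4, one_mul]
  let t : P.B n := ⟨P.diagU d hd, P.diagU_mem_B d hd⟩
  have ht : (t : P.G n) • P.permX σ hσ = P.permX σ hσ := by
    apply P.toMatrix_injective
    ext1 l m
    change P.toMatrix (P.diagU d hd • P.permX σ hσ) l m = _
    rw [toMatrix_diagU_smul, toMatrix_permX]
    split_ifs with h
    · rw [h, mul_one, hds]
    · rw [mul_zero, zero_mul]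
  have hpsi : ‖P.psi i t‖ = ‖P.π‖ ^ 2 := by
    rw [psi_eq_prod, norm_prod, Finset.prod_eq_single (Fin.last i.val)]
    · change P.dn (Matrix.diagonal d _ _) = _
      rw [Matrix.diagonal_apply_eq]
      have : Fin.castLE i.isLt (Fin.last i.val) = i := rfl
      rw [this]
      simp only [d, if_true]
      rw [dn_algebraMap]
    · intro l _ hl
      have hl' : l.val < i.val := lt_of_le_of_ne (Nat.le_of_lt_succ l.isLt)
        fun h => hl (Fin.ext h)
      change P.dn (Matrix.diagonal d _ _) = _
      rw [Matrix.diagonal_apply_eq]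
      simp only [d]
      rw [if_neg fun h => hl'.ne (congrArg Fin.val h), if_neg fun h => ?_, map_one, dn_one]
      have h1 := congrArg Fin.val h
      have h2 : i.val < (σ i).val := hi
      simp only [Fin.val_castLE] at h1
      omega
    · intro h
      exact absurd (Finset.mem_univ _) h
  choose m hm using fun l : Fin n => exists_norm_psi_eq l t
  let b' : P.B n := ⟨b, hb⟩
  refine ⟨b'⁻¹ * t * b', m, ?_, fun h0 => ?_, fun l => ?_⟩
  · change ((b⁻¹ * (t : P.G n)) * b) • z = z
    rw [mul_smul, hbz, mul_smul, ht, ← hbz, inv_smul_smul]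
  · have h1 := hm i
    rw [h0, hpsi, Pi.zero_apply, zpow_zero] at h1
    have h2 := P.norm_π_lt_one
    have h3 := P.norm_pi_pos
    nlinarith
  · rw [psi_mul, psi_mul, psi_inv, mul_comm, ← mul_assoc, mul_inv_cancel₀ (psi_ne_zero l _),
      one_mul, hm]

variable {dx : Measure (P.X n)} [IsFiniteMeasureOnCompacts dx]
  [SMulInvariantMeasure (P.G n) (P.X n) dx]

open Classical in
/-- The number of cosets of `J'` in `J` which contain an element moving `z` to `y`. -/
def cosetCount (J J' : Subgroup (P.B n)) [Finite (J ⧸ J'.subgroupOf J)] (z y : P.X n) : ℕ :=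
  letI := Fintype.ofFinite (J ⧸ J'.subgroupOf J)
  (Finset.univ.filter fun c : J ⧸ J'.subgroupOf J =>
    ∃ g : J, (g : J ⧸ J'.subgroupOf J) = c ∧ ((g : P.B n) : P.G n) • z = y).card

theorem cosetCount_smul (J J' : Subgroup (P.B n)) [Finite (J ⧸ J'.subgroupOf J)] (z : P.X n)
    (j : J) : cosetCount J J' z (((j : P.B n) : P.G n) • z) = cosetCount J J' z z := by
  classical
  let _ := Fintype.ofFinite (J ⧸ J'.subgroupOf J)
  unfold cosetCount
  refine (Finset.card_equiv (MulAction.toPerm j) fun c => ?_).symm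
  simp only [Finset.mem_filter, Finset.mem_univ, true_and, MulAction.toPerm_apply]
  constructor
  · rintro ⟨g, rfl, hg⟩
    exact ⟨j * g, rfl, by
      rw [Subgroup.coe_mul, Subgroup.coe_mul, mul_smul, hg]⟩
  · rintro ⟨g, hgc, hg⟩
    refine ⟨j⁻¹ * g, ?_, by
      rw [Subgroup.coe_mul, Subgroup.coe_mul, mul_smul, hg, Subgroup.coe_inv, Subgroup.coe_inv,
        inv_smul_smul]⟩
    have : ((j⁻¹ * g : J) : J ⧸ J'.subgroupOf J) = j⁻¹ • (g : J ⧸ J'.subgroupOf J) := rfl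
    rw [this, hgc, inv_smul_smul]

theorem cosetCount_pos (J J' : Subgroup (P.B n)) [Finite (J ⧸ J'.subgroupOf J)] (z : P.X n) :
    0 < cosetCount J J' z z := by
  classical
  unfold cosetCount
  refine Finset.card_pos.2 ⟨((1 : J) : J ⧸ J'.subgroupOf J), ?_⟩
  simp only [Finset.mem_filter, Finset.mem_univ, true_and]
  exact ⟨1, rfl, one_smul _ _⟩

/-- On the bad set, `Φ` is the characteristic function of the orbit `J z`. -/
def IsOrbitFun (dx : Measure (P.X n)) (J : Subgroup (P.B n)) (z : P.X n) (Φ : P.X n → ℂ) : Prop :=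
  IsTest Φ ∧ (∀ j ∈ J, (j : P.G n) • z ∈ badSet dx → Φ ((j : P.G n) • z) = 1) ∧
    ∀ y ∈ badSet dx, (∀ j ∈ J, (j : P.G n) • z ≠ y) → Φ y = 0

/-- Comparison of the zeta integrals attached to the orbits of a point under a compact group and an
open subgroup. -/
theorem exists_compare {J J' : Subgroup (P.B n)} [Finite (J ⧸ J'.subgroupOf J)] (hJ : J' ≤ J)
    (hpsi : ∀ j ∈ J, ∀ i, ‖P.psi i j‖ = 1) {z : P.X n} {Φ Φ' : P.X n → ℂ}
    (hΦ : IsOrbitFun dx J z Φ) (hΦ' : IsOrbitFun dx J' z Φ') :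
    ∃ N m : ℕ, 0 < N ∧ 0 < m ∧
      IsRat (q k) (region n) fun s => (N : ℂ) * zeta dx Φ' s - (m : ℂ) * zeta dx Φ s := by
  classical
  let _ := Fintype.ofFinite (J ⧸ J'.subgroupOf J)
  refine ⟨Fintype.card (J ⧸ J'.subgroupOf J), cosetCount J J' z z, Fintype.card_pos,
    cosetCount_pos J J' z, ?_⟩
  let Ψ : J ⧸ J'.subgroupOf J → P.X n → ℂ := fun c y =>
    Φ' ((((c.out : J) : P.B n) : P.G n)⁻¹ • y)
  have hΨt : ∀ c, IsTest (Ψ c) := fun c => hΦ'.1.smul _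
  have hΨz : ∀ c s, zeta dx (Ψ c) s = zeta dx Φ' s := fun c s =>
    zeta_smul_eq (hpsi _ (c.out : J).2) s
  have hbad : ∀ y ∈ badSet dx, ∑ c, Ψ c y = cosetCount J J' z y := by
    intro y hy
    unfold cosetCount
    rw [Finset.card_filter, Nat.cast_sum]
    refine Finset.sum_congr (by congr!) fun c _ => ?_
    have hy' : (((c.out : J) : P.B n) : P.G n)⁻¹ • y ∈ badSet dx := by
      have := smul_mem_badSet (c.out : J).1⁻¹ hy
      rwa [Subgroup.coe_inv] at this
    split_ifs with hc
    · obtain ⟨g, hgc, hg⟩ := hc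
      have h1 : (c.out : J)⁻¹ * g ∈ J'.subgroupOf J := by
        rw [← QuotientGroup.eq, hgc]
        exact QuotientGroup.out_eq' c
      have h2 : (((c.out : J) : P.B n) : P.G n)⁻¹ • y =
          ((((c.out : J)⁻¹ * g : J) : P.B n) : P.G n) • z := by
        rw [Subgroup.coe_mul, Subgroup.coe_mul, mul_smul, hg]
        rfl
      simp only [Ψ]
      rw [h2] at hy' ⊢
      rw [hΦ'.2.1 _ (Subgroup.mem_subgroupOf.1 h1) hy', Nat.cast_one]
    · rw [Nat.cast_zero]
      refine hΦ'.2.2 _ hy' fun j hj hjz => hc ⟨(c.out : J) * ⟨j, hJ hj⟩, ?_, ?_⟩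
      · conv_rhs => rw [← QuotientGroup.out_eq' c]
        rw [QuotientGroup.eq, Subgroup.mem_subgroupOf]
        simpa using J'.inv_mem hj
      · rw [Subgroup.coe_mul, Subgroup.coe_mul, mul_smul]
        change _ • (j : P.G n) • z = y
        rw [hjz, smul_inv_smul]
  have hT : IsTest fun y => (∑ c, Ψ c y) + (-(cosetCount J J' z z : ℂ)) * Φ y :=
    (IsTest.sum _ hΨt).add (hΦ.1.const_mul _)
  have h := hasRatZeta_of_vanish (dx := dx) hT fun y hy => by
    rw [hbad y hy]
    by_cases hex : ∃ j ∈ J, (j : P.G n) • z = y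
    · obtain ⟨j, hj, rfl⟩ := hex
      rw [hΦ.2.1 j hj hy, cosetCount_smul J J' z ⟨j, hj⟩]
      ring
    · push Not at hex
      rw [hΦ.2.2 y hy hex, mul_zero, add_zero, Nat.cast_eq_zero]
      unfold cosetCount
      rw [Finset.card_eq_zero, Finset.filter_eq_empty_iff]
      rintro c - ⟨g, -, hg⟩
      exact hex g g.2 hg
  refine IsRat.congr h fun s hs => ?_
  rw [zeta_add (IsTest.sum _ hΨt) (hΦ.1.const_mul _) hs, zeta_sum _ hΨt hs, zeta_const_mul]
  simp only [hΨz, Finset.sum_const, nsmul_eq_mul, Finset.card_univ]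
  ring

theorem finite_quotient {J J' : Subgroup (P.B n)} (hJ : IsCompact (J : Set (P.B n)))
    (hJ' : IsOpen (J' : Set (P.B n))) : Finite (J ⧸ J'.subgroupOf J) := by
  have : CompactSpace J := isCompact_iff_compactSpace.1 hJ
  exact Subgroup.quotient_finite_of_isOpen _ (hJ'.preimage continuous_subtype_val)

/-- The key point: the zeta integral over (a thickening of) the orbit of a degenerate form under a
small group is rational, since comparing it with its translate under the stabilizer of the form
multiplies it by a nontrivial monomial. -/
theorem hasRatZeta_of_isOrbitFun {H : Subgroup (P.B n)} (hH : IsOpen (H : Set (P.B n)))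
    (hHc : IsCompact (H : Set (P.B n))) (hHK : ∀ j ∈ H, (j : P.G n) ∈ P.K n) {z : P.X n}
    (hz : ∃ i, P.d i z = 0) (hex : ∀ J : Subgroup (P.B n), IsOpen (J : Set (P.B n)) →
      IsCompact (J : Set (P.B n)) → ∃ Φ, IsOrbitFun dx J z Φ) {Φ : P.X n → ℂ}
    (hΦ : IsOrbitFun dx H z Φ) : HasRatZeta dx Φ := by
  obtain ⟨h, m, hhz, hm, hpsi⟩ := exists_stabilizer hz
  have hhz' : (h : P.G n)⁻¹ • z = z := by
    conv_lhs => rw [← hhz]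
    rw [inv_smul_smul]
  have hH1 : ∀ j ∈ H, ∀ i, ‖P.psi i j‖ = 1 := fun j hj i => norm_psi_eq_one i (hHK j hj)
  let J : Subgroup (P.B n) := H.comap (MulAut.conj h⁻¹).toMonoidHom
  have hJmem : ∀ j, j ∈ J ↔ h⁻¹ * j * h ∈ H := fun j => by
    simp [J, Subgroup.mem_comap]
  have hJ : IsOpen (J : Set (P.B n)) := by
    have : (J : Set (P.B n)) = (fun j => h⁻¹ * j * h) ⁻¹' H := Set.ext hJmem
    rw [this]
    exact hH.preimage ((continuous_const.mul continuous_id).mul continuous_const)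
  have hJc : IsCompact (J : Set (P.B n)) := by
    have : (J : Set (P.B n)) = (fun j => h * j * h⁻¹) '' H := by
      ext j
      refine ⟨fun hj => ⟨_, (hJmem j).1 hj, by simp [mul_assoc]⟩, ?_⟩
      rintro ⟨j, hj, rfl⟩
      exact (hJmem _).2 (by simpa [mul_assoc] using hj)
    rw [this]
    exact hHc.image ((continuous_const.mul continuous_id).mul continuous_const)
  have hJ1 : ∀ j ∈ J, ∀ i, ‖P.psi i j‖ = 1 := by
    intro j hj i
    have h1 := hH1 _ ((hJmem j).1 hj) i
    rwa [psi_mul, psi_mul, psi_inv, mul_comm, ← mul_assoc, mul_inv_cancel₀ (psi_ne_zero i _),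
      one_mul] at h1
  have hΦJ : IsOrbitFun dx J z fun y => Φ ((h : P.G n)⁻¹ • y) := by
    refine ⟨hΦ.1.smul _, fun j hj hb => ?_, fun y hy hj => ?_⟩
    · have h1 : (h : P.G n)⁻¹ • (j : P.G n) • z = ((h⁻¹ * j * h : P.B n) : P.G n) • z := by
        rw [Subgroup.coe_mul, Subgroup.coe_mul, mul_smul, mul_smul, hhz]
        rfl
      have h2 := smul_mem_badSet h⁻¹ hb
      rw [Subgroup.coe_inv, h1] at h2
      change Φ ((h : P.G n)⁻¹ • (j : P.G n) • z) = 1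
      rw [h1, hΦ.2.1 _ ((hJmem j).1 hj) h2]
    · have h2 := smul_mem_badSet h⁻¹ hy
      rw [Subgroup.coe_inv] at h2
      refine hΦ.2.2 _ h2 fun j' hj' h3 => hj (h * j' * h⁻¹)
        ((hJmem _).2 (by simpa [mul_assoc] using hj')) ?_
      rw [Subgroup.coe_mul, Subgroup.coe_mul, mul_smul, mul_smul, Subgroup.coe_inv, hhz', h3,
        smul_inv_smul]
  have hHJ : IsOpen ((H ⊓ J : Subgroup (P.B n)) : Set (P.B n)) := hH.inter hJ
  obtain ⟨Φ', hΦ'⟩ := hex (H ⊓ J) hHJ (hHc.inter_right hJc.isClosed)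
  have := finite_quotient hHc hHJ
  have := finite_quotient hJc hHJ
  obtain ⟨N₁, m₁, hN₁, hm₁, hr₁⟩ := exists_compare inf_le_left hH1 hΦ hΦ'
  obtain ⟨N₂, m₂, hN₂, hm₂, hr₂⟩ := exists_compare inf_le_right hJ1 hΦJ hΦ'
  refine IsRat.of_mul_sub P.two_le_q hm (a := -(N₂ * m₁ : ℂ)) (b := -(N₁ * m₂ : ℂ))
    (neg_ne_zero.2 (mul_ne_zero (by exact_mod_cast hN₂.ne') (by exact_mod_cast hm₁.ne'))) ?_
  refine (((IsRat.const (N₂ : ℂ)).mul hr₁).add ((IsRat.const (-(N₁ : ℂ))).mul hr₂)).congr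
    fun s hs => ?_
  rw [zeta_smul, prod_eq_qmon P.two_le_q hpsi]
  ring

/-- If the orbit `B z` is open in the bad set, then the orbits of `z` under small groups are cut out
of the bad set by test functions. -/
theorem exists_isOrbitFun {z : P.X n} (hz : z ∈ badSet dx) {U : Set (P.X n)} (hU : IsOpen U)
    (h1 : ∀ b : P.B n, (b : P.G n) • z ∈ U)
    (h2 : ∀ y ∈ U, y ∈ badSet dx → ∃ b : P.B n, (b : P.G n) • z = y)
    {J : Subgroup (P.B n)} (hJ : IsOpen (J : Set (P.B n))) (hJc : IsCompact (J : Set (P.B n))) :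
    ∃ Φ, IsOrbitFun dx J z Φ := by
  have hO : MulAction.orbit (P.B n) z = U ∩ badSet dx := by
    ext y
    constructor
    · rintro ⟨b, rfl⟩
      exact ⟨h1 b, smul_mem_badSet b hz⟩
    · rintro ⟨hy, hy'⟩
      exact h2 y hy hy'
  have hlc : IsLocallyClosed (MulAction.orbit (P.B n) z) := by
    rw [hO]
    exact hU.isLocallyClosed.inter isClosed_badSet.isLocallyClosed
  have := hlc.locallyCompactSpace
  have : ContinuousSMul (P.B n) (MulAction.orbit (P.B n) z) := by
    refine ⟨Continuous.subtype_mk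
      (f := fun t : P.B n × MulAction.orbit (P.B n) z => t.1 • t.2.1) ?_ _⟩
    exact continuous_fst.smul (continuous_subtype_val.comp continuous_snd)
  have hopen := isOpenMap_smul_of_sigmaCompact (G := P.B n)
    (⟨z, MulAction.mem_orbit_self z⟩ : MulAction.orbit (P.B n) z) _ hJ
  obtain ⟨V, hV, hVJ⟩ := isOpen_induced_iff.1 hopen
  have hC : IsCompact ((fun j : P.B n => (j : P.G n) • z) '' J) :=
    hJc.image (continuous_subtype_val.smul continuous_const)
  obtain ⟨W, hW, hW', hCW, hWV⟩ := exists_isCompact_isOpen_between hC (hV.inter hU) (by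
    rintro _ ⟨j, hj, rfl⟩
    refine ⟨?_, h1 j⟩
    have : (⟨(j : P.G n) • z, j, rfl⟩ : MulAction.orbit (P.B n) z) ∈ Subtype.val ⁻¹' V := by
      rw [hVJ]
      exact ⟨j, hj, rfl⟩
    exact this)
  refine ⟨W.indicator fun _ => 1, IsTest.indicator_one hW hW', fun j hj _ =>
    Set.indicator_of_mem (hCW ⟨j, hj, rfl⟩) _, fun y hy hne => Set.indicator_of_notMem ?_ _⟩
  intro hyW
  obtain ⟨hyV, hyU⟩ := hWV hyW
  have h3 : (⟨y, h2 y hyU hy⟩ : MulAction.orbit (P.B n) z) ∈ Subtype.val ⁻¹' V := hyV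
  rw [hVJ] at h3
  obtain ⟨j, hj, hjy⟩ := h3
  exact hne j hj (congrArg Subtype.val hjy)

/-- The group of elements of `B ∩ K` fixing a function. -/
def fixer (Φ : P.X n → ℂ) : Subgroup (P.B n) where
  carrier := {b | (b : P.G n) ∈ P.K n ∧ ∀ y, Φ ((b : P.G n) • y) = Φ y}
  mul_mem' := fun {a b} ha hb => ⟨(P.K n).mul_mem ha.1 hb.1, fun y => by
    rw [Subgroup.coe_mul, mul_smul, ha.2, hb.2]⟩
  one_mem' := ⟨(P.K n).one_mem, fun y => by rw [Subgroup.coe_one, one_smul]⟩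
  inv_mem' := fun {a} ha => ⟨(P.K n).inv_mem ha.1, fun y => by
    rw [← ha.2, Subgroup.coe_inv, smul_inv_smul]⟩

theorem isOpen_fixer {Φ : P.X n → ℂ} (hΦ : IsTest Φ) : IsOpen (fixer Φ : Set (P.B n)) := by
  refine Subgroup.isOpen_of_mem_nhds _ (g := 1) ?_
  have key : ∀ f : P.B n → P.B n, Continuous f → f 1 = 1 →
      ∀ᶠ b in nhds (1 : P.B n), ∀ y ∈ Function.support Φ, Φ ((f b : P.G n) • y) = Φ y := by
    intro f hf hf1
    refine hΦ.isCompact_support.eventually_forall_of_forall_eventually fun y _ => ?_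
    have hc : Continuous fun t : P.B n × P.X n => (f t.1 : P.G n) • t.2 :=
      (continuous_subtype_val.comp (hf.comp continuous_fst)).smul continuous_snd
    have h1 := (hΦ.1.comp_continuous hc).eventually_eq (1, y)
    have h2 := (hΦ.1.comp_continuous (continuous_snd (X := P.B n))).eventually_eq (1, y)
    filter_upwards [h1, h2] with t ht1 ht2
    have ht1' : Φ ((f t.1 : P.G n) • t.2) = Φ ((f 1 : P.G n) • y) := ht1
    have ht2' : Φ t.2 = Φ y := ht2
    rw [ht1', ht2', hf1, Subgroup.coe_one, one_smul]
  have hK : {b : P.B n | (b : P.G n) ∈ P.K n} ∈ nhds (1 : P.B n) :=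
    (P.isOpen_K.preimage continuous_subtype_val).mem_nhds
      (show ((1 : P.B n) : P.G n) ∈ P.K n from (P.K n).one_mem)
  filter_upwards [key id continuous_id rfl, key _ continuous_inv inv_one, hK] with b h1 h2 h3
  refine ⟨h3, fun y => ?_⟩
  by_cases hy : y ∈ Function.support Φ
  · exact h1 y hy
  by_cases hy' : (b : P.G n) • y ∈ Function.support Φ
  · have := h2 _ hy'
    rw [Subgroup.coe_inv, inv_smul_smul] at this
    exact this.symm
  · rw [Function.notMem_support.1 hy, Function.notMem_support.1 hy']

theorem isCompact_B_inter_K : IsCompact {b : P.B n | (b : P.G n) ∈ P.K n} :=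
  (P.isClosed_B n).isClosedEmbedding_subtypeVal.isCompact_preimage P.isCompact_K

theorem isCompact_fixer {Φ : P.X n → ℂ} (hΦ : IsTest Φ) : IsCompact (fixer Φ : Set (P.B n)) :=
  isCompact_B_inter_K.of_isClosed_subset (Subgroup.isClosed_of_isOpen _ (isOpen_fixer hΦ))
    fun _ h => h.1

/-- By the Baire property some `B`-orbit is open in a nonempty bad set. It consists of degenerate
forms, so near it a test function agrees on the bad set with a combination of functions attached to
orbits of a small group, whose zeta integrals are rational; the rest vanishes on the bad set. -/
theorem badSet_eq_empty : badSet dx = ∅ := by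
  by_contra hne
  have hne' : Nonempty (badSet dx) := (Set.nonempty_iff_ne_empty.2 hne).to_subtype
  have hcl : IsClosed (badSet dx) := isClosed_badSet
  have : LocallyCompactSpace (badSet dx) := hcl.isClosedEmbedding_subtypeVal.locallyCompactSpace
  -- by the Baire property, some `B`-orbit is open in the bad set
  let F : {σ : Equiv.Perm (Fin n) // ∀ i, σ (σ i) = i} × ℕ → Set (badSet dx) := fun t =>
    Subtype.val ⁻¹' ((fun b : P.B n => (b : P.G n) • P.permX t.1.1 t.1.2) ''
      compactCovering (P.B n) t.2)
  obtain ⟨⟨⟨σ, hσ⟩, j⟩, ⟨z, hz⟩, hzF⟩ := nonempty_interior_of_iUnion_of_closed (f := F)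
    (fun t => ((isCompact_compactCovering _ _).image
      (continuous_subtype_val.smul continuous_const)).isClosed.preimage continuous_subtype_val) (by
      refine Set.eq_univ_of_forall fun y => Set.mem_iUnion.2 ?_
      obtain ⟨b, hb, σ, hσ, h⟩ := exists_B_smul_eq_permX y.1
      obtain ⟨j, hj⟩ := Set.mem_iUnion.1 (by
        rw [iUnion_compactCovering]
        trivial : (⟨b, hb⟩⁻¹ : P.B n) ∈ ⋃ j, compactCovering (P.B n) j)
      refine ⟨⟨⟨σ, hσ⟩, j⟩, ⟨_, hj, ?_⟩⟩
      change b⁻¹ • P.permX σ hσ = y.1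
      rw [← h, inv_smul_smul])
  obtain ⟨U₀, hU₀, hU₀F⟩ := isOpen_induced_iff.1 (isOpen_interior (s := F (⟨σ, hσ⟩, j)))
  have hsub : ∀ y ∈ U₀, y ∈ badSet dx → ∃ b : P.B n, (b : P.G n) • P.permX σ hσ = y := by
    intro y hy hyb
    have h1 : (⟨y, hyb⟩ : badSet dx) ∈ Subtype.val ⁻¹' U₀ := hy
    rw [hU₀F] at h1
    obtain ⟨b, -, hb⟩ := interior_subset h1
    exact ⟨b, hb⟩
  have hzU₀ : z ∈ U₀ := by
    rw [← hU₀F] at hzF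
    exact hzF
  obtain ⟨b₀, hb₀⟩ := hsub z hzU₀ hz
  let U : Set (P.X n) := ⋃ b : P.B n, (fun y => (b : P.G n) • y) ⁻¹' U₀
  have hU : IsOpen U := isOpen_iUnion fun b => hU₀.preimage (continuous_const_smul _)
  have hU1 : ∀ b : P.B n, (b : P.G n) • z ∈ U := fun b => Set.mem_iUnion.2 ⟨b⁻¹, by
    rw [Set.mem_preimage, Subgroup.coe_inv, inv_smul_smul]
    exact hzU₀⟩
  have hU2 : ∀ y ∈ U, y ∈ badSet dx → ∃ b : P.B n, (b : P.G n) • z = y := by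
    intro y hy hyb
    obtain ⟨b, hb⟩ := Set.mem_iUnion.1 hy
    obtain ⟨b₁, hb₁⟩ := hsub _ hb (smul_mem_badSet b hyb)
    refine ⟨b⁻¹ * b₁ * b₀⁻¹, ?_⟩
    rw [← hb₀, Subgroup.coe_mul, Subgroup.coe_mul, mul_smul, mul_smul, Subgroup.coe_inv,
      Subgroup.coe_inv, inv_smul_smul, hb₁, inv_smul_smul]
  have hzd : ∃ i, P.d i z = 0 := by
    by_contra hcon
    push Not at hcon
    exact notMem_badSet_of_d_ne_zero hcon hz
  -- a neighbourhood of `z` is good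
  refine hz U hU (by simpa using hU1 1) fun Φ hΦ hsupp => ?_
  have hH := isOpen_fixer hΦ
  have hHc := isCompact_fixer hΦ
  set H := fixer Φ
  have hloc : ∀ x ∈ U, x ∈ badSet dx → ∃ Ψ, IsOrbitFun dx H x Ψ ∧ HasRatZeta dx Ψ := by
    intro x hx hxb
    obtain ⟨b, rfl⟩ := hU2 x hx hxb
    have hex : ∀ J : Subgroup (P.B n), IsOpen (J : Set (P.B n)) → IsCompact (J : Set (P.B n)) →
        ∃ Φ, IsOrbitFun dx J ((b : P.G n) • z) Φ := fun J hJ hJc =>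
      exists_isOrbitFun hxb hU (fun b' => by
        rw [← mul_smul, ← Subgroup.coe_mul]
        exact hU1 _) (fun y hy hyb => by
        obtain ⟨b', hb'⟩ := hU2 y hy hyb
        refine ⟨b' * b⁻¹, ?_⟩
        rw [Subgroup.coe_mul, mul_smul, Subgroup.coe_inv, inv_smul_smul, hb']) hJ hJc
    obtain ⟨Ψ, hΨ⟩ := hex H hH hHc
    refine ⟨Ψ, hΨ, hasRatZeta_of_isOrbitFun hH hHc (fun j hj => hj.1) ?_ hex hΨ⟩
    obtain ⟨i, hi⟩ := hzd
    refine ⟨i, norm_eq_zero.1 ?_⟩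
    rw [norm_d_smul, hi, norm_zero, mul_zero]
  obtain ⟨W, hW, hCW, hWr⟩ := hasRatZeta_of_local (dx := dx)
    (fun Ψ => IsTest Ψ ∧ ∀ b ∈ H, ∀ y ∈ badSet dx, Ψ ((b : P.G n) • y) = Ψ y)
    (fun W => IsClopen W ∧ ∀ b ∈ H, ∀ y ∈ badSet dx, (b : P.G n) • y ∈ W ↔ y ∈ W)
    (fun _ h => h.1) (fun _ h => h.1) ⟨isClopen_empty, fun _ _ _ _ => Iff.rfl⟩
    (fun W W' h h' => ⟨h.1.union h'.1, fun b hb y hy => or_congr (h.2 b hb y hy) (h'.2 b hb y hy)⟩)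
    (fun W h => ⟨h.1.compl, fun b hb y hy => not_congr (h.2 b hb y hy)⟩)
    (fun Ψ W h h' => ⟨h.1.ite h'.1, fun b hb y hy => by
      by_cases hyW : y ∈ W
      · rw [Set.indicator_of_mem hyW, Set.indicator_of_mem ((h'.2 b hb y hy).2 hyW), h.2 b hb y hy]
      · rw [Set.indicator_of_notMem hyW,
          Set.indicator_of_notMem fun h1 => hyW ((h'.2 b hb y hy).1 h1)]⟩)
    (hΦ.isCompact_support.inter_right hcl) fun x hx => by
      obtain ⟨Ψ, hΨ, hΨr⟩ := hloc x (hsupp hx.1) hx.2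
      have horb : ∀ y ∈ badSet dx, y ∈ Function.support Ψ ↔ ∃ j ∈ H, (j : P.G n) • x = y := by
        intro y hy
        constructor
        · intro h
          by_contra hcon
          push Not at hcon
          exact h (hΨ.2.2 y hy hcon)
        · rintro ⟨j, hj, rfl⟩
          rw [Function.mem_support, hΨ.2.1 j hj hy]
          exact one_ne_zero
      refine ⟨Function.support Ψ, ⟨hΨ.1.isClopen_support, fun b hb y hy => ?_⟩, ?_, ?_⟩
      · rw [horb _ (smul_mem_badSet b hy), horb _ hy]
        constructor
        · rintro ⟨j, hj, h⟩
          refine ⟨b⁻¹ * j, H.mul_mem (H.inv_mem hb) hj, ?_⟩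
          rw [Subgroup.coe_mul, mul_smul, h, Subgroup.coe_inv, inv_smul_smul]
        · rintro ⟨j, hj, rfl⟩
          exact ⟨b * j, H.mul_mem hb hj, by rw [Subgroup.coe_mul, mul_smul]⟩
      · exact (horb x hx.2).2 ⟨1, H.one_mem, one_smul _ _⟩
      · rintro Ψ' ⟨hΨ', hinv⟩ hs
        have h1 : HasRatZeta dx fun y => Ψ' x * Ψ y :=
          (IsRat.mul (IsRat.const (Ψ' x)) hΨr).congr fun s _ => zeta_const_mul _ _
        refine h1.congr_badSet (hΨ.1.const_mul _) hΨ' fun y hy => ?_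
        by_cases hyo : ∃ j ∈ H, (j : P.G n) • x = y
        · obtain ⟨j, hj, rfl⟩ := hyo
          rw [hinv j hj x hx.2, hΨ.2.1 j hj hy, mul_one]
        · have h2 : y ∉ Function.support Ψ := fun h => hyo ((horb y hy).1 h)
          rw [Function.notMem_support.1 fun h => h2 (hs h), Function.notMem_support.1 h2, mul_zero]
  refine HasRatZeta.of_ite hΦ hW.1 (hWr _ ⟨hΦ.ite hW.1, fun b hb y hy => ?_⟩ fun y hy => ?_)
    (hasRatZeta_of_vanish (hΦ.ite hW.1.compl) fun y hy => ?_)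
  · by_cases hyW : y ∈ W
    · rw [Set.indicator_of_mem hyW, Set.indicator_of_mem ((hW.2 b hb y hy).2 hyW), hb.2]
    · rw [Set.indicator_of_notMem hyW,
        Set.indicator_of_notMem fun h1 => hyW ((hW.2 b hb y hy).1 h1)]
  · rw [Set.support_indicator] at hy
    exact hy.1
  · by_cases hyW : y ∈ W
    · exact Set.indicator_of_notMem (not_not_intro hyW) _
    · by_contra h0
      exact hyW (hCW ⟨fun h1 => h0 (by
        rw [Set.indicator_of_mem (Set.mem_compl hyW), h1]), hy⟩)

/-- All zeta integrals of test functions are rational functions of `q^s`. -/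
theorem hasRatZeta {Φ : P.X n → ℂ} (hΦ : IsTest Φ) : HasRatZeta dx Φ :=
  hasRatZeta_of_vanish hΦ fun y hy => absurd hy (by rw [badSet_eq_empty]; simp)

end QuatData

/-! ### Spherical functions and the Fourier transform as finite sums -/

/-- A function which is constant on the members of a finite partition of its support. -/
theorem eq_sum_indicator_of_partition {α ι : Type*} {F : α → ℂ} {T : Finset ι} {A : ι → Set α}
    {c : ι → ℂ} (hval : ∀ t ∈ T, ∀ x ∈ A t, F x = c t)
    (hcov : ∀ x, F x ≠ 0 → ∃ t ∈ T, x ∈ A t)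
    (hdis : ∀ t ∈ T, ∀ t' ∈ T, ∀ x, x ∈ A t → x ∈ A t' → t = t') (x : α) :
    F x = ∑ t ∈ T, (A t).indicator (fun _ => c t) x := by
  by_cases hx : ∃ t ∈ T, x ∈ A t
  · obtain ⟨t, ht, hxt⟩ := hx
    rw [Finset.sum_eq_single_of_mem t ht, Set.indicator_of_mem hxt, hval t ht x hxt]
    exact fun t' ht' hne =>
      Set.indicator_of_notMem (fun h => hne (hdis t' ht' t ht x h hxt)) _
  · rw [Finset.sum_eq_zero]
    · by_contra h
      exact hx (hcov x h)
    · intro t ht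
      exact Set.indicator_of_notMem (fun h => hx ⟨t, ht, h⟩) _

theorem integral_of_eq_sum_indicator {α ι : Type*} [MeasurableSpace α] {μ : Measure α} {F : α → ℂ}
    {T : Finset ι} {A : ι → Set α} {c : ι → ℂ} (hm : ∀ t ∈ T, MeasurableSet (A t))
    (hfin : ∀ t ∈ T, μ (A t) ≠ ⊤) (hF : ∀ x, F x = ∑ t ∈ T, (A t).indicator (fun _ => c t) x) :
    Integrable F μ ∧ ∫ x, F x ∂μ = ∑ t ∈ T, (μ.real (A t) : ℂ) * c t := by
  have hi : ∀ t ∈ T, Integrable ((A t).indicator fun _ => c t) μ := fun t ht =>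
    (integrable_indicator_iff (hm t ht)).2 (integrableOn_const (hfin t ht))
  have hF' : F = fun x => ∑ t ∈ T, (A t).indicator (fun _ => c t) x := funext hF
  rw [hF']
  refine ⟨integrable_finsetSum _ hi, ?_⟩
  rw [integral_finsetSum _ hi]
  refine Finset.sum_congr rfl fun t ht => ?_
  rw [integral_indicator_const _ (hm t ht), Complex.real_smul]

namespace QuatData

variable {k : Type*} [NontriviallyNormedField k] [IsUltrametricDist k] {P : QuatData k} {n : ℕ}
  [LocallyCompactSpace k] [CompleteSpace k] [P.IsOddLocal]

instance : SecondCountableTopology (P.X n) :=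
  Topology.IsEmbedding.subtypeVal.secondCountableTopology

instance : SecondCountableTopology (P.K n) :=
  Topology.IsEmbedding.subtypeVal.secondCountableTopology

instance : SigmaCompactSpace (P.X n) :=
  (P.isClosed_X (n := n)).isClosedEmbedding_subtypeVal.sigmaCompactSpace

/-- A compact set is covered by finitely many `K`-orbits, with pairwise inequivalent
representatives. -/
theorem exists_finset_orbitK {C : Set (P.X n)} (hC : IsCompact C) :
    ∃ T : Finset (P.X n), (∀ x ∈ C, ∃ t ∈ T, x ∈ P.orbitK t) ∧
      ∀ t ∈ T, ∀ t' ∈ T, t' ∈ P.orbitK t → t' = t := by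
  classical
  obtain ⟨T₀, hT₀⟩ := hC.elim_finite_subcover (fun x : P.X n => P.orbitK x)
    (fun x => isOpen_orbitK x) fun x _ => Set.mem_iUnion.2 ⟨x, self_mem_orbitK x⟩
  let S : Setoid (P.X n) :=
    { r := fun x y => P.orbitK x = P.orbitK y
      iseqv := ⟨fun _ => rfl, fun h => h.symm, fun h h' => h.trans h'⟩ }
  have hout : ∀ x : P.X n, P.orbitK (Quotient.mk S x).out = P.orbitK x := fun x =>
    Quotient.exact (Quotient.out_eq (Quotient.mk S x))
  refine ⟨T₀.image fun x => (Quotient.mk S x).out, fun x hx => ?_, fun t ht t' ht' h => ?_⟩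
  · obtain ⟨y, hy, hxy⟩ := Set.mem_iUnion₂.1 (hT₀ hx)
    exact ⟨_, Finset.mem_image_of_mem _ hy, by rwa [hout]⟩
  · obtain ⟨x, -, rfl⟩ := Finset.mem_image.1 ht
    obtain ⟨x', -, rfl⟩ := Finset.mem_image.1 ht'
    congr 1
    have := orbitK_eq h
    rw [hout, hout] at this
    exact Quotient.sound this

theorem eq_sum_indicator {φ : P.X n → ℂ} (hφ : ∀ κ ∈ P.K n, ∀ x, φ (κ • x) = φ x)
    {T : Finset (P.X n)} (hT : ∀ x ∈ Function.support φ, ∃ t ∈ T, x ∈ P.orbitK t)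
    (hT' : ∀ t ∈ T, ∀ t' ∈ T, t' ∈ P.orbitK t → t' = t) (x : P.X n) :
    φ x = ∑ t ∈ T, (P.orbitK t).indicator (fun _ => φ t) x := by
  refine eq_sum_indicator_of_partition ?_ hT (fun t ht t' ht' x h h' => (hT' t ht t' ht' ?_).symm) x
  · rintro t - _ ⟨κ, hκ, rfl⟩
    exact hφ κ hκ t
  · rw [← orbitK_eq h, orbitK_eq h']
    exact self_mem_orbitK t'

/-- The integral of a `K`-invariant function of compact support as a sum over orbits. -/
theorem integral_eq_sum {dx : Measure (P.X n)} [IsFiniteMeasureOnCompacts dx] {φ : P.X n → ℂ}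
    (hφ : ∀ κ ∈ P.K n, ∀ x, φ (κ • x) = φ x)
    {T : Finset (P.X n)} (hT : ∀ x ∈ Function.support φ, ∃ t ∈ T, x ∈ P.orbitK t)
    (hT' : ∀ t ∈ T, ∀ t' ∈ T, t' ∈ P.orbitK t → t' = t) :
    ∫ x, φ x ∂dx = ∑ t ∈ T, (dx.real (P.orbitK t) : ℂ) * φ t :=
  (integral_of_eq_sum_indicator (fun t _ => (isOpen_orbitK t).measurableSet)
    (fun t _ => (isCompact_orbitK t).measure_lt_top.ne) (eq_sum_indicator hφ hT hT')).2

theorem isTest_of_mem_schwartz {φ : P.X n → ℂ} (h : φ ∈ P.schwartz n) : IsTest φ :=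
  ⟨isLocallyConstant_of_K_invariant h.1, h.2⟩

variable (dk : Measure (P.K n)) [dk.IsHaarMeasure] (hdk : dk Set.univ = 1)

theorem continuous_K_smul (x : P.X n) : Continuous fun κ : P.K n => (κ : P.G n) • x :=
  continuous_subtype_val.smul continuous_const

include hdk in
theorem integrable_absd_K (x : P.X n) {s : Fin n → ℂ} (hs : s ∈ region n) :
    Integrable (fun κ : P.K n => P.absd s ((κ : P.G n) • x)) dk := by
  have : IsProbabilityMeasure dk := ⟨hdk⟩
  obtain ⟨M, hM⟩ := exists_norm_absd_le hs (isCompact_orbitK x)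
  refine Integrable.of_bound
    ((measurable_absd s).comp (continuous_K_smul x).measurable).aestronglyMeasurable M ?_
  exact Filter.Eventually.of_forall fun κ => hM _ ⟨κ, κ.2, rfl⟩

include hdk in
theorem omegaInt_smul {κ' : P.G n} (hκ' : κ' ∈ P.K n) (x : P.X n) (s : Fin n → ℂ) :
    P.omegaInt dk (κ' • x) s = P.omegaInt dk x s := by
  have : IsProbabilityMeasure dk := ⟨hdk⟩
  let c : P.K n := ⟨κ', hκ'⟩
  have hm : Measurable fun κ : P.K n => κ * c := (continuous_mul_const c).measurable
  have : IsProbabilityMeasure (dk.map (· * c)) := Measure.isProbabilityMeasure_map hm.aemeasurable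
  have h := Measure.isHaarMeasure_eq_of_isProbabilityMeasure (dk.map (· * c)) dk
  unfold omegaInt
  conv_rhs => rw [← h]
  rw [integral_map (f := fun κ : P.K n => P.absd s ((κ : P.G n) • x)) hm.aemeasurable
    ((measurable_absd s).comp (continuous_K_smul x).measurable).aestronglyMeasurable]
  congr 1
  ext κ
  rw [Subgroup.coe_mul, mul_smul]

theorem orbitK_omegaInt {x y : P.X n} (h : y ∈ P.orbitK x) (hdk : dk Set.univ = 1)
    (s : Fin n → ℂ) : P.omegaInt dk y s = P.omegaInt dk x s := by
  obtain ⟨κ, hκ, rfl⟩ := h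
  exact omegaInt_smul dk hdk hκ x s

variable {dx : Measure (P.X n)} [SMulInvariantMeasure (P.G n) (P.X n) dx]
  [IsFiniteMeasureOnCompacts dx]

include hdk in
/-- Averaging over `K`: a `K`-equivariance of `τ` under the integral sign allows to replace
`|𝐝(τ x)|^s` by the spherical function. -/
theorem integral_omegaInt {φ : P.X n → ℂ} (hφ : IsTest φ) {τ : P.X n → P.X n} (hτ : Continuous τ)
    {s : Fin n → ℂ} (hs : s ∈ region n)
    (hinv : ∀ κ ∈ P.K n, ∫ x, φ x * P.absd s (κ • τ x) ∂dx = ∫ x, φ x * P.absd s (τ x) ∂dx) :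
    ∫ x, φ x * P.omegaInt dk (τ x) s ∂dx = ∫ x, φ x * P.absd s (τ x) ∂dx := by
  have : IsProbabilityMeasure dk := ⟨hdk⟩
  have hc : Continuous fun t : P.X n × P.K n => (t.2 : P.G n) • τ t.1 :=
    (continuous_subtype_val.comp continuous_snd).smul (hτ.comp continuous_fst)
  have hC : IsCompact (Function.support φ ×ˢ (Set.univ : Set (P.K n))) :=
    hφ.isCompact_support.prod isCompact_univ
  obtain ⟨M, hM⟩ := exists_norm_absd_le hs (hC.image hc)
  obtain ⟨M', hM'⟩ :=
    hφ.isCompact_support.exists_bound_of_continuousOn hφ.1.continuous.continuousOn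
  have hint : Integrable (Function.uncurry fun (x : P.X n) (κ : P.K n) =>
      φ x * P.absd s ((κ : P.G n) • τ x)) (dx.prod dk) := by
    rw [← integrableOn_iff_integrable_of_support_subset
      (s := Function.support φ ×ˢ (Set.univ : Set (P.K n)))
      fun t ht => ⟨fun h0 => ht (by simp only [Function.uncurry_def, h0, zero_mul]), trivial⟩]
    refine Measure.integrableOn_of_bounded (M := |M'| * |M|) hC.measure_lt_top.ne
      ((hφ.1.continuous.measurable.comp measurable_fst).mul
        ((measurable_absd s).comp hc.measurable)).aestronglyMeasurable ?_
    filter_upwards [ae_restrict_mem (hφ.isClopen_support.isOpen.measurableSet.prod .univ)] with t ht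
    rw [Function.uncurry_def, norm_mul]
    exact mul_le_mul ((hM' t.1 ht.1).trans (le_abs_self _))
      ((hM _ ⟨t, ht, rfl⟩).trans (le_abs_self _)) (norm_nonneg _) (abs_nonneg _)
  unfold omegaInt
  simp only [← integral_const_mul]
  rw [integral_integral_swap hint]
  simp only [fun κ : P.K n => hinv κ κ.2, integral_const, probReal_univ, one_smul]

include hdk in
theorem zeta_eq_integral_omegaInt {φ : P.X n → ℂ} (hφ : φ ∈ P.schwartz n) {s : Fin n → ℂ}
    (hs : s ∈ region n) : ∫ x, φ x * P.omegaInt dk x s ∂dx = zeta dx φ s := by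
  refine integral_omegaInt dk hdk (isTest_of_mem_schwartz hφ) continuous_id hs fun κ hκ => ?_
  rw [← integral_smul_eq_self (μ := dx) (fun x => φ x * P.absd s (id x)) (g := κ)]
  simp only [hφ.1 κ hκ, id]

theorem continuous_inv_X : Continuous fun x : P.X n => x⁻¹ :=
  Continuous.subtype_mk (continuous_inv.comp continuous_subtype_val) _

theorem smul_inv_eq (g : P.G n) (x : P.X n) : (g • x)⁻¹ = (star g)⁻¹ • x⁻¹ := by
  apply Subtype.ext
  change (g * x.1 * star g)⁻¹ = (star g)⁻¹ * x.1⁻¹ * star (star g)⁻¹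
  rw [star_inv, star_star]
  simp [mul_assoc]

theorem star_inv_mem_K {κ : P.G n} (hκ : κ ∈ P.K n) : (star κ)⁻¹ ∈ P.K n :=
  (P.K n).inv_mem (P.star_mem_K hκ)

theorem inv_mem_orbitK_iff {x y : P.X n} : x⁻¹ ∈ P.orbitK y⁻¹ ↔ x ∈ P.orbitK y := by
  have key : ∀ {x y : P.X n}, x ∈ P.orbitK y → x⁻¹ ∈ P.orbitK y⁻¹ := by
    rintro _ y ⟨κ, hκ, rfl⟩
    exact ⟨_, star_inv_mem_K hκ, (smul_inv_eq κ y).symm⟩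
  have hinv : ∀ x : P.X n, x⁻¹⁻¹ = x := fun x => Subtype.ext (inv_inv x.1)
  refine ⟨fun h => ?_, key⟩
  have := key h
  rwa [hinv, hinv] at this

include hdk in
/-- Unfolding the spherical function in the Fourier transform. -/
theorem fourierInt_eq {φ : P.X n → ℂ} (hφ : φ ∈ P.schwartz n) {s : Fin n → ℂ}
    (hs : s ∈ region n) : P.fourierInt dk dx φ s = ∫ x, φ x * P.absd s x⁻¹ ∂dx := by
  refine integral_omegaInt dk hdk (isTest_of_mem_schwartz hφ) continuous_inv_X hs fun κ hκ => ?_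
  rw [← integral_smul_eq_self (μ := dx) (fun x => φ x * P.absd s x⁻¹) (g := (star κ)⁻¹)]
  simp only [hφ.1 _ (star_inv_mem_K hκ), smul_inv_eq, star_inv, star_star, inv_inv]

variable (dx) in
theorem measure_orbitK_pos (hdx : dx ≠ 0) (x : P.X n) : 0 < dx.real (P.orbitK x) := by
  have hC : ∃ C, IsCompact C ∧ dx C ≠ 0 := by
    by_contra hcon
    push Not at hcon
    apply hdx
    rw [← Measure.measure_univ_eq_zero, ← iUnion_compactCovering (P.X n)]
    exact measure_iUnion_null fun j => hcon _ (isCompact_compactCovering _ _)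
  obtain ⟨C, hC, hC0⟩ := hC
  have h := measure_isOpen_pos_of_smulInvariant_of_compact_ne_zero (P.G n) hC hC0
    (isOpen_orbitK x) ⟨x, self_mem_orbitK x⟩
  exact ENNReal.toReal_pos h.ne' (isCompact_orbitK x).measure_lt_top.ne

theorem indicator_mem_schwartz (x : P.X n) :
    (P.orbitK x).indicator (fun _ => (1 : ℂ)) ∈ P.schwartz n := by
  refine ⟨fun κ hκ y => ?_, (IsTest.indicator_one (isCompact_orbitK x) (isOpen_orbitK x)).2⟩
  by_cases hy : y ∈ P.orbitK x
  · rw [Set.indicator_of_mem hy, Set.indicator_of_mem ((smul_mem_orbitK_iff hκ).2 hy)]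
  · rw [Set.indicator_of_notMem hy,
      Set.indicator_of_notMem fun h => hy ((smul_mem_orbitK_iff hκ).1 h)]

include hdk in
/-- The spherical function is a normalized zeta integral over an orbit. -/
theorem measure_mul_omegaInt (x : P.X n) {s : Fin n → ℂ} (hs : s ∈ region n) :
    (dx.real (P.orbitK x) : ℂ) * P.omegaInt dk x s =
      zeta dx ((P.orbitK x).indicator fun _ => 1) s := by
  rw [← zeta_eq_integral_omegaInt dk hdk (indicator_mem_schwartz x) hs,
    ← Complex.real_smul, ← integral_indicator_const _ (isOpen_orbitK x).measurableSet]
  congr 1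
  ext y
  by_cases hy : y ∈ P.orbitK x
  · rw [Set.indicator_of_mem hy, Set.indicator_of_mem hy, one_mul, orbitK_omegaInt dk hy hdk]
  · rw [Set.indicator_of_notMem hy, Set.indicator_of_notMem hy, zero_mul]

include hdk in
variable (dx) in
theorem isRat_omegaInt (hdx : dx ≠ 0) (x : P.X n) :
    IsRat (q k) (region n) (P.omegaInt dk x) := by
  have h := hasRatZeta (dx := dx) (isTest_of_mem_schwartz (indicator_mem_schwartz x))
  refine ((IsRat.const (dx.real (P.orbitK x) : ℂ)⁻¹).mul h).congr fun s hs => ?_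
  rw [← measure_mul_omegaInt dk hdk x hs, inv_mul_cancel_left₀]
  exact_mod_cast (measure_orbitK_pos dx hdx x).ne'

include hdk in
variable (dx) in
theorem represents_omega (hdx : dx ≠ 0) (x : P.X n) :
    Represents (q k) (region n) (P.omegaInt dk x) (P.omega dk x) :=
  (isRat_omegaInt dk hdk dx hdx x).represents

include hdk in
theorem omega_eq_of_mem_orbitK {x y : P.X n} (h : y ∈ P.orbitK x) :
    P.omega dk y = P.omega dk x := by
  unfold omega
  congr 1
  ext s
  exact orbitK_omegaInt dk h hdk s

include hdk in
theorem integrable_fourier {φ : P.X n → ℂ} (hφ : φ ∈ P.schwartz n) (s : Fin n → ℂ) :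
    Integrable (fun x => φ x * P.omegaInt dk x⁻¹ s) dx := by
  have h1 : IsLocallyConstant fun x : P.X n => φ x * P.omegaInt dk x⁻¹ s :=
    isLocallyConstant_of_K_invariant fun κ hκ x => by
      rw [hφ.1 κ hκ, smul_inv_eq, omegaInt_smul dk hdk (star_inv_mem_K hκ)]
  exact h1.continuous.integrable_of_hasCompactSupport hφ.2.mul_right

include hdk in
theorem fourierInt_eq_sum {φ : P.X n → ℂ} (hφ : φ ∈ P.schwartz n)
    {T : Finset (P.X n)} (hT : ∀ x ∈ Function.support φ, ∃ t ∈ T, x ∈ P.orbitK t)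
    (hT' : ∀ t ∈ T, ∀ t' ∈ T, t' ∈ P.orbitK t → t' = t) (s : Fin n → ℂ) :
    P.fourierInt dk dx φ s =
      ∑ t ∈ T, (dx.real (P.orbitK t) * φ t : ℂ) * P.omegaInt dk t⁻¹ s := by
  unfold fourierInt
  rw [integral_eq_sum (fun κ hκ x => by
      rw [hφ.1 κ hκ, smul_inv_eq, omegaInt_smul dk hdk (star_inv_mem_K hκ)])
    (fun x hx => hT x fun h => hx (by simp only [h, zero_mul])) hT']
  simp only [mul_assoc]

include hdk in
theorem represents_fourier_sum (hdx : dx ≠ 0) {φ : P.X n → ℂ} (hφ : φ ∈ P.schwartz n)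
    {T : Finset (P.X n)} (hT : ∀ x ∈ Function.support φ, ∃ t ∈ T, x ∈ P.orbitK t)
    (hT' : ∀ t ∈ T, ∀ t' ∈ T, t' ∈ P.orbitK t → t' = t) :
    Represents (q k) (region n) (P.fourierInt dk dx φ)
      (∑ t ∈ T, (dx.real (P.orbitK t) * φ t : ℂ) • P.omega dk t⁻¹) :=
  (Represents.sum T fun t _ => (represents_omega dk hdk dx hdx t⁻¹).smul _).congr
    fun s _ => fourierInt_eq_sum dk hdk hφ hT hT' s

include hdk in
theorem represents_F0 (hdx : dx ≠ 0) {φ : P.X n → ℂ} (hφ : φ ∈ P.schwartz n) :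
    Represents (q k) (region n) (P.fourierInt dk dx φ) (P.F0 dk dx φ) := by
  obtain ⟨T, hT, hT'⟩ := exists_finset_orbitK (isTest_of_mem_schwartz hφ).isCompact_support
  exact (represents_fourier_sum dk hdk hdx hφ hT hT').isRat.represents

include hdk in
theorem F0_eq_sum (hdx : dx ≠ 0) {φ : P.X n → ℂ} (hφ : φ ∈ P.schwartz n)
    {T : Finset (P.X n)} (hT : ∀ x ∈ Function.support φ, ∃ t ∈ T, x ∈ P.orbitK t)
    (hT' : ∀ t ∈ T, ∀ t' ∈ T, t' ∈ P.orbitK t → t' = t) :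
    P.F0 dk dx φ = ∑ t ∈ T, (dx.real (P.orbitK t) * φ t : ℂ) • P.omega dk t⁻¹ :=
  (represents_F0 dk hdk hdx hφ).unique P.two_le_q le_rfl
    (represents_fourier_sum dk hdk hdx hφ hT hT')

include hdk in
/-- Injectivity of the Fourier transform follows from the linear independence of the spherical
functions. -/
theorem injOn_F0 (hdx : dx ≠ 0)
    (hli : LinearIndependent ℂ fun α : Lam n => P.omega dk (P.piX α)) :
    Set.InjOn (P.F0 dk dx) (P.schwartz n : Set (P.X n → ℂ)) := by
  intro φ hφ φ' hφ' heq
  obtain ⟨T, hT, hT'⟩ := exists_finset_orbitK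
    ((isTest_of_mem_schwartz hφ).isCompact_support.union
      (isTest_of_mem_schwartz hφ').isCompact_support)
  have h1 := fun x hx => hT x (Or.inl hx)
  have h2 := fun x hx => hT x (Or.inr hx)
  choose κ hκ α hα using fun x : P.X n => exists_K_smul_eq_piX x
  have horb : ∀ x : P.X n, P.piX (α x) ∈ P.orbitK x := fun x => ⟨κ x, hκ x, hα x⟩
  have hω : ∀ t : P.X n, P.omega dk t⁻¹ = P.omega dk (P.piX (α t⁻¹)) := fun t =>
    (omega_eq_of_mem_orbitK dk hdk (horb t⁻¹)).symm
  have hinj : Set.InjOn (fun t : P.X n => α t⁻¹) T := by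
    intro t ht t' ht' h
    have h3 : α t⁻¹ = α t'⁻¹ := h
    refine (hT' t ht t' ht' (inv_mem_orbitK_iff.1 ?_)).symm
    rw [← orbitK_eq (horb t⁻¹), h3, orbitK_eq (horb t'⁻¹)]
    exact self_mem_orbitK _
  rw [F0_eq_sum dk hdk hdx hφ h1 hT', F0_eq_sum dk hdk hdx hφ' h2 hT', ← sub_eq_zero,
    ← Finset.sum_sub_distrib] at heq
  simp only [← sub_smul, ← mul_sub, hω] at heq
  have hli' := (hli.comp (fun t : T => α (t : P.X n)⁻¹) fun t t' h =>
    Subtype.ext (hinj t.2 t'.2 h))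
  rw [Fintype.linearIndependent_iff] at hli'
  have hzero : ∀ t ∈ T, φ t = φ' t := by
    intro t ht
    have h4 := hli' (fun t => (dx.real (P.orbitK (t : P.X n)) : ℂ) * (φ t - φ' t)) (by
      rw [← heq, ← Finset.sum_coe_sort T]
      rfl) ⟨t, ht⟩
    rcases mul_eq_zero.1 h4 with h5 | h5
    · exact absurd h5 (by exact_mod_cast (measure_orbitK_pos dx hdx t).ne')
    · exact sub_eq_zero.1 h5
  ext x
  rw [eq_sum_indicator hφ.1 h1 hT' x, eq_sum_indicator hφ'.1 h2 hT' x]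
  refine Finset.sum_congr rfl fun t ht => ?_
  rw [hzero t ht]

end QuatData

/-! ### The Hecke algebra -/

namespace QuatData

variable {k : Type*} [NontriviallyNormedField k] [IsUltrametricDist k] {P : QuatData k} {n : ℕ}

theorem hecke_mul_right {f : P.G n → ℂ} (hf : f ∈ P.hecke n) (g : P.G n) {κ : P.G n}
    (hκ : κ ∈ P.K n) : f (g * κ) = f g := by
  simpa using hf.1 1 (P.K n).one_mem κ hκ g

theorem hecke_mul_left {f : P.G n → ℂ} (hf : f ∈ P.hecke n) (g : P.G n) {κ : P.G n}
    (hκ : κ ∈ P.K n) : f (κ * g) = f g := by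
  simpa using hf.1 κ hκ 1 (P.K n).one_mem g

theorem hecke_isLocallyConstant {f : P.G n → ℂ} (hf : f ∈ P.hecke n) : IsLocallyConstant f := by
  rw [IsLocallyConstant.iff_exists_open]
  refine fun g => ⟨(fun h => g⁻¹ * h) ⁻¹' P.K n, P.isOpen_K.preimage (continuous_const_mul _), ?_,
    fun h hh => ?_⟩
  · rw [Set.mem_preimage, inv_mul_cancel]
    exact (P.K n).one_mem
  · rw [← hecke_mul_right hf g hh, mul_inv_cancel_left]

variable [LocallyCompactSpace k] [CompleteSpace k] [P.IsOddLocal]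

/-- Gelfand's trick: the conjugate transpose preserves the double cosets of `K`. -/
theorem hecke_star {f : P.G n → ℂ} (hf : f ∈ P.hecke n) (g : P.G n) : f (star g) = f g := by
  obtain ⟨κ, hκ, κ', hκ', h⟩ := P.exists_star_eq g
  rw [h, hf.1 κ hκ κ' hκ']

/-- Representatives of the right cosets of `B ∩ K` in the part of the support of `f` in `B`. -/
theorem exists_finset_cosets {f : P.G n → ℂ} (hf : f ∈ P.hecke n) : ∃ R : Finset (P.B n),
    (∀ p : P.B n, f p ≠ 0 → ∃ r ∈ R, (p : P.G n) * (r : P.G n)⁻¹ ∈ P.K n) ∧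
      ∀ r ∈ R, ∀ r' ∈ R, (r' : P.G n) * (r : P.G n)⁻¹ ∈ P.K n → r = r' := by
  classical
  have hcl : IsClopen (Function.support f) := ((hecke_isLocallyConstant hf).isClopen_fiber 0).compl
  have hc : IsCompact (Function.support f) := by
    have := hf.2.isCompact
    rwa [tsupport, hcl.isClosed.closure_eq] at this
  have hC : IsCompact {p : P.B n | f p ≠ 0} :=
    (P.isClosed_B n).isClosedEmbedding_subtypeVal.isCompact_preimage hc
  obtain ⟨R₀, hR₀⟩ := hC.elim_finite_subcover
    (fun r : P.B n => {p : P.B n | (p : P.G n) * (r : P.G n)⁻¹ ∈ P.K n})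
    (fun r => P.isOpen_K.preimage (continuous_subtype_val.mul continuous_const))
    fun p _ => Set.mem_iUnion.2 ⟨p, by
      change (p : P.G n) * (p : P.G n)⁻¹ ∈ P.K n
      rw [mul_inv_cancel]
      exact (P.K n).one_mem⟩
  let S : Setoid (P.B n) :=
    { r := fun p p' => (p : P.G n) * (p' : P.G n)⁻¹ ∈ P.K n
      iseqv := ⟨fun p => by
          rw [mul_inv_cancel]
          exact (P.K n).one_mem,
        fun {p p'} h => by
          have := (P.K n).inv_mem h
          rwa [mul_inv_rev, inv_inv] at this,
        fun {p p' p''} h h' => by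
          have := (P.K n).mul_mem h h'
          rwa [mul_assoc, inv_mul_cancel_left] at this⟩ }
  have hout : ∀ p : P.B n, S.r (Quotient.mk S p).out p := fun p =>
    Quotient.exact (Quotient.out_eq (Quotient.mk S p))
  refine ⟨R₀.image fun p => (Quotient.mk S p).out, fun p hp => ?_, fun r hr r' hr' h => ?_⟩
  · obtain ⟨r, hr, hpr⟩ := Set.mem_iUnion₂.1 (hR₀ hp)
    exact ⟨_, Finset.mem_image_of_mem _ hr, S.iseqv.trans hpr (S.iseqv.symm (hout r))⟩
  · obtain ⟨p, -, rfl⟩ := Finset.mem_image.1 hr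
    obtain ⟨p', -, rfl⟩ := Finset.mem_image.1 hr'
    congr 1
    exact (Quotient.sound (S.iseqv.trans (S.iseqv.symm (hout p'))
      (S.iseqv.trans h (hout p)))).symm

/-- Integration over `G` of right `K`-invariant functions, using the Iwasawa decomposition with
respect to the opposite of `B`. -/
theorem integral_hecke {dg : Measure (P.G n)} [dg.IsHaarMeasure]
    (hdg : dg (P.K n : Set (P.G n)) = 1) {f : P.G n → ℂ} (hf : f ∈ P.hecke n)
    {R : Finset (P.B n)}
    (hR : ∀ p : P.B n, f p ≠ 0 → ∃ r ∈ R, (p : P.G n) * (r : P.G n)⁻¹ ∈ P.K n)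
    (hR' : ∀ r ∈ R, ∀ r' ∈ R, (r' : P.G n) * (r : P.G n)⁻¹ ∈ P.K n → r = r')
    {H : P.G n → ℂ} (hH : ∀ g, ∀ κ ∈ P.K n, H (g * κ) = H g) :
    Integrable (fun g => f g * H g) dg ∧
      ∫ g, f g * H g ∂dg = ∑ r ∈ R, f r * H (star (r : P.G n)) := by
  let A : P.B n → Set (P.G n) := fun r => (fun g => (star (r : P.G n))⁻¹ * g) ⁻¹' P.K n
  have hμ : ∀ r, dg (A r) = 1 := fun r => by rw [measure_preimage_mul, hdg]
  have hA : ∀ r g, g ∈ A r → ∃ κ ∈ P.K n, g = star (r : P.G n) * κ := fun r g hg =>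
    ⟨_, hg, (mul_inv_cancel_left _ _).symm⟩
  have hsum := eq_sum_indicator_of_partition (F := fun g => f g * H g) (T := R) (A := A)
    (c := fun r => f r * H (star (r : P.G n))) (by
      intro r _ g hg
      obtain ⟨κ, hκ, rfl⟩ := hA r g hg
      rw [hH _ κ hκ, hecke_mul_right hf _ hκ, hecke_star hf]) (by
      intro g hg
      obtain ⟨κ, hκ, hb⟩ := P.exists_K_mul_mem_B (star g)
      have h0 : f (κ * star g) ≠ 0 := by
        rw [hecke_mul_left hf _ hκ, hecke_star hf]
        exact left_ne_zero_of_mul hg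
      obtain ⟨r, hr, hrK⟩ := hR ⟨_, hb⟩ h0
      refine ⟨r, hr, ?_⟩
      have h1 := P.star_mem_K ((P.K n).mul_mem ((P.K n).inv_mem hκ) hrK)
      have h2 : star (κ⁻¹ * (κ * star g * (r : P.G n)⁻¹)) = (star (r : P.G n))⁻¹ * g := by
        rw [mul_assoc κ, inv_mul_cancel_left, star_mul, star_star, star_inv]
      change (star (r : P.G n))⁻¹ * g ∈ P.K n
      rw [← h2]
      exact h1) (by
      intro r hr r' hr' g hg hg'
      refine hR' r hr r' hr' ?_
      have h1 := P.star_mem_K ((P.K n).mul_mem hg ((P.K n).inv_mem hg'))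
      have h2 : star ((star (r : P.G n))⁻¹ * g * ((star (r' : P.G n))⁻¹ * g)⁻¹) =
          (r' : P.G n) * (r : P.G n)⁻¹ := by
        simp [mul_assoc, star_inv]
      rw [← h2]
      exact h1)
  obtain ⟨h1, h2⟩ := integral_of_eq_sum_indicator (μ := dg) (fun r _ =>
      (P.isOpen_K.preimage (continuous_const_mul _)).measurableSet)
    (fun r _ => by rw [hμ]; exact ENNReal.one_ne_top) hsum
  refine ⟨h1, h2.trans (Finset.sum_congr rfl fun r _ => ?_)⟩
  rw [Measure.real, hμ]
  simp

section Lambda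

variable {dp : Measure (P.B n)} [dp.IsHaarMeasure]
  (hdp : dp {p : P.B n | (p : P.G n) ∈ P.K n} = 1)

instance : SecondCountableTopology (P.B n) :=
  Topology.IsEmbedding.subtypeVal.secondCountableTopology

theorem isOpen_B_inter_K : IsOpen {p : P.B n | (p : P.G n) ∈ P.K n} :=
  P.isOpen_K.preimage continuous_subtype_val

include hdp in
/-- The volume of a right coset of `B ∩ K`. -/
theorem measure_right_coset (r : P.B n) :
    dp {p : P.B n | (p : P.G n) * (r : P.G n)⁻¹ ∈ P.K n} =
      (Measure.modularCharacter r⁻¹ : NNReal) := by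
  have h := Measure.isMulLeftInvariant_eq_smul (dp.map (· * r⁻¹)) dp
  rw [← Measure.modularCharacterFun_eq_haarScalarFactor] at h
  have h2 : dp {p : P.B n | (p : P.G n) * (r : P.G n)⁻¹ ∈ P.K n} =
      dp.map (· * r⁻¹) {p : P.B n | (p : P.G n) ∈ P.K n} := by
    rw [Measure.map_apply (continuous_mul_const _).measurable isOpen_B_inter_K.measurableSet]
    rfl
  rw [h2, h, Measure.smul_apply, hdp]
  simp [ENNReal.smul_def, Measure.modularCharacter]

include hdp in
theorem modularCharacter_eq_one {m : P.B n} (hm : (m : P.G n) ∈ P.K n) :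
    Measure.modularCharacter m = 1 := by
  have h := measure_right_coset hdp m⁻¹
  rw [inv_inv] at h
  have h2 : {p : P.B n | (p : P.G n) * ((m⁻¹ : P.B n) : P.G n)⁻¹ ∈ P.K n} =
      {p : P.B n | (p : P.G n) ∈ P.K n} := by
    ext p
    rw [Set.mem_ofPred_eq, Set.mem_ofPred_eq, Subgroup.coe_inv, inv_inv]
    exact Subgroup.mul_mem_cancel_right _ hm
  rw [h2, hdp] at h
  exact_mod_cast h.symm

include hdp in
/-- The integral `λ_s(f)` as a finite sum. -/
theorem integral_lamIntegrand {f : P.G n → ℂ} (hf : f ∈ P.hecke n) {R : Finset (P.B n)}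
    (hR : ∀ p : P.B n, f p ≠ 0 → ∃ r ∈ R, (p : P.G n) * (r : P.G n)⁻¹ ∈ P.K n)
    (hR' : ∀ r ∈ R, ∀ r' ∈ R, (r' : P.G n) * (r : P.G n)⁻¹ ∈ P.K n → r = r') (s : Fin n → ℂ) :
    Integrable (P.lamIntegrand f s) dp ∧
      P.lamInt dp f s = ∑ r ∈ R, f r * ∏ i, ((‖P.psi i r‖ : ℝ) : ℂ) ^ (-s i) := by
  let A : P.B n → Set (P.B n) := fun r => {p : P.B n | (p : P.G n) * (r : P.G n)⁻¹ ∈ P.K n}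
  have hsum := eq_sum_indicator_of_partition (F := P.lamIntegrand f s) (T := R) (A := A)
    (c := fun r => P.lamIntegrand f s r) (by
      intro r _ p hp
      obtain ⟨m, hm, rfl⟩ : ∃ m : P.B n, (m : P.G n) ∈ P.K n ∧ p = m * r :=
        ⟨p * r⁻¹, hp, (inv_mul_cancel_right p r).symm⟩
      unfold lamIntegrand
      rw [map_mul, modularCharacter_eq_one hdp hm, one_mul, Subgroup.coe_mul,
        hecke_mul_left hf _ hm]
      simp only [psi_mul, norm_mul, norm_psi_eq_one _ hm, one_mul]) (by
      intro p hp
      exact hR p (left_ne_zero_of_mul (left_ne_zero_of_mul hp))) (by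
      intro r hr r' hr' p hp hp'
      refine hR' r hr r' hr' ?_
      have := (P.K n).mul_mem ((P.K n).inv_mem hp') hp
      rwa [mul_inv_rev, inv_inv, mul_assoc, inv_mul_cancel_left] at this)
  obtain ⟨h1, h2⟩ := integral_of_eq_sum_indicator (μ := dp) (fun r _ =>
      (P.isOpen_K.preimage (continuous_subtype_val.mul continuous_const)).measurableSet)
    (fun r _ => by
      change dp (A r) ≠ _
      rw [measure_right_coset hdp]
      exact ENNReal.coe_ne_top) hsum
  refine ⟨h1, h2.trans (Finset.sum_congr rfl fun r _ => ?_)⟩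
  have h3 : dp.real (A r) = ((Measure.modularCharacter r : NNReal) : ℝ)⁻¹ := by
    rw [Measure.real, measure_right_coset hdp, map_inv, ENNReal.coe_toReal, NNReal.coe_inv]
  have h4 : ((Measure.modularCharacter r : NNReal) : ℝ) ≠ 0 := by
    rw [NNReal.coe_ne_zero]
    intro h0
    have := map_mul (Measure.modularCharacter (G := P.B n)) r r⁻¹
    rw [mul_inv_cancel, map_one, h0, zero_mul] at this
    exact one_ne_zero this
  have h5 : (((Measure.modularCharacter r : NNReal) : ℝ) : ℂ) ≠ 0 := by exact_mod_cast h4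
  change (dp.real (A r) : ℂ) * P.lamIntegrand f s r = _
  rw [h3, lamIntegrand, Complex.ofReal_inv]
  field_simp

theorem prod_psi_inv (r : P.B n) (s : Fin n → ℂ) :
    ∏ i, ((‖P.psi i r⁻¹‖ : ℝ) : ℂ) ^ s i = ∏ i, ((‖P.psi i r‖ : ℝ) : ℂ) ^ (-s i) := by
  refine Finset.prod_congr rfl fun i _ => ?_
  rw [psi_inv, norm_inv, Complex.ofReal_inv, Complex.cpow_neg, Complex.inv_cpow]
  rw [Complex.arg_ofReal_of_nonneg (norm_nonneg _)]
  exact Real.pi_ne_zero.symm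

include hdp in
theorem represents_lam {f : P.G n → ℂ} (hf : f ∈ P.hecke n) :
    (∀ s, Integrable (P.lamIntegrand f s) dp) ∧
      Represents (q k) Set.univ (P.lamInt dp f) (P.lam dp f) := by
  obtain ⟨R, hR, hR'⟩ := exists_finset_cosets hf
  refine ⟨fun s => (integral_lamIntegrand hdp hf hR hR' s).1, IsRat.represents ?_⟩
  choose m hm using fun (r : P.B n) (i : Fin n) => exists_norm_psi_eq i r⁻¹
  refine (IsRat.sum R fun r _ => (IsRat.const (f r)).mul (isRat_qmon P.two_le_q (m r))).congr
    fun s _ => ?_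
  rw [(integral_lamIntegrand hdp hf hR hR' s).2]
  refine Finset.sum_congr rfl fun r _ => ?_
  rw [← prod_psi_inv, prod_eq_qmon P.two_le_q (hm r)]

variable {dg : Measure (P.G n)} [dg.IsHaarMeasure] (hdg : dg (P.K n : Set (P.G n)) = 1)
  (dk : Measure (P.K n)) [dk.IsHaarMeasure] (hdk : dk Set.univ = 1)
  {dx : Measure (P.X n)} [SMulInvariantMeasure (P.G n) (P.X n) dx] [IsFiniteMeasureOnCompacts dx]

theorem schwartz_inv_mul {φ : P.X n → ℂ} (hφ : φ ∈ P.schwartz n) (x : P.X n) (g : P.G n)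
    {κ : P.G n} (hκ : κ ∈ P.K n) : φ ((g * κ)⁻¹ • x) = φ (g⁻¹ • x) := by
  rw [mul_inv_rev, mul_smul, hφ.1 _ ((P.K n).inv_mem hκ)]

include hdg in
theorem heckeAct_mem_schwartz {f : P.G n → ℂ} (hf : f ∈ P.hecke n) {φ : P.X n → ℂ}
    (hφ : φ ∈ P.schwartz n) : P.heckeAct dg f φ ∈ P.schwartz n := by
  obtain ⟨R, hR, hR'⟩ := exists_finset_cosets hf
  refine ⟨fun κ hκ x => ?_, ?_⟩
  · unfold heckeAct
    rw [← integral_mul_left_eq_self _ κ]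
    simp only [hecke_mul_left hf _ hκ, mul_inv_rev, mul_smul, inv_smul_smul]
  · have h : P.heckeAct dg f φ = fun x => ∑ r ∈ R, f r * φ ((star (r : P.G n))⁻¹ • x) :=
      funext fun x => (integral_hecke hdg hf hR hR' fun g κ hκ => schwartz_inv_mul hφ x g hκ).2
    rw [h]
    exact (IsTest.sum R fun r : P.B n =>
      ((isTest_of_mem_schwartz hφ).smul (star (r : P.G n))⁻¹).const_mul (f r)).2

include hdg hdp hdk in
/-- The Fourier transform intertwines the action of `f` and the multiplication by `λ_s(f)`. -/
theorem fourierInt_heckeAct {f : P.G n → ℂ} (hf : f ∈ P.hecke n) {φ : P.X n → ℂ}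
    (hφ : φ ∈ P.schwartz n) {s : Fin n → ℂ} (hs : s ∈ region n) :
    P.fourierInt dk dx (P.heckeAct dg f φ) s = P.lamInt dp f s * P.fourierInt dk dx φ s := by
  obtain ⟨R, hR, hR'⟩ := exists_finset_cosets hf
  have h : ∀ x, P.heckeAct dg f φ x = ∑ r ∈ R, f r * φ ((star (r : P.G n))⁻¹ • x) :=
    fun x => (integral_hecke hdg hf hR hR' fun g κ hκ => schwartz_inv_mul hφ x g hκ).2
  rw [fourierInt_eq dk hdk (heckeAct_mem_schwartz hdg hf hφ) hs, fourierInt_eq dk hdk hφ hs,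
    (integral_lamIntegrand hdp hf hR hR' s).2, Finset.sum_mul]
  simp only [h, Finset.sum_mul]
  rw [integral_finsetSum R fun (r : P.B n) _ => (((isTest_of_mem_schwartz hφ).smul
    (star (r : P.G n))⁻¹).const_mul (f r)).integrable_comp hs continuous_inv_X dx]
  refine Finset.sum_congr rfl fun r _ => ?_
  rw [← integral_smul_eq_self (μ := dx) _ (g := star (r : P.G n)), ← integral_const_mul]
  congr 1
  ext x
  have h1 : (star (r : P.G n) • x)⁻¹ = ((r⁻¹ : P.B n) : P.G n) • x⁻¹ := by
    rw [smul_inv_eq, star_star]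
    rfl
  rw [inv_smul_smul, h1, absd_smul, prod_psi_inv]
  ring

end Lambda

end QuatData

namespace QuatData

/-! ### A bound for reduced norms -/

variable {k : Type*} [NontriviallyNormedField k] [IsUltrametricDist k] {P : QuatData k} {n m : ℕ}
  [LocallyCompactSpace k] [CompleteSpace k] [P.IsOddLocal]

theorem norm_nrd_eq_one {κ : P.G n} (hκ : κ ∈ P.K n) :
    ‖P.nrd (κ : Matrix (Fin n) (Fin n) P.D)‖ = 1 := by
  have hc : Continuous fun g : P.G n => ‖P.nrd (g : Matrix (Fin n) (Fin n) P.D)‖ :=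
    (continuous_nrd fun i j => Units.continuous_val.matrix_elem i j).norm
  obtain ⟨C, hC⟩ := (P.isCompact_K (n := n)).bddAbove_image hc.continuousOn
  -- `|N_rd|` is a character of the compact group `K`, so its powers are bounded
  have key : ∀ g ∈ P.K n, ‖P.nrd (g : Matrix (Fin n) (Fin n) P.D)‖ ≤ 1 := by
    intro g hg
    by_contra! h
    obtain ⟨N, hN⟩ := pow_unbounded_of_one_lt C h
    have hpow : ∀ N : ℕ, ‖P.nrd ((g ^ N : P.G n) : Matrix (Fin n) (Fin n) P.D)‖ =
        ‖P.nrd (g : Matrix (Fin n) (Fin n) P.D)‖ ^ N := by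
      intro N
      induction N with
      | zero => rw [pow_zero, pow_zero, Units.val_one, nrd_one, norm_one]
      | succ N ih => rw [pow_succ, pow_succ, Units.val_mul, nrd_mul, norm_mul, ih]
    exact absurd (hC ⟨g ^ N, (P.K n).pow_mem hg N, rfl⟩) (by
      change ¬ ‖P.nrd ((g ^ N : P.G n) : Matrix (Fin n) (Fin n) P.D)‖ ≤ C
      rw [hpow]
      exact not_le.2 hN)
  refine le_antisymm (key κ hκ) ?_
  have h := key _ ((P.K n).inv_mem hκ)
  have h1 : ‖P.nrd (κ : Matrix (Fin n) (Fin n) P.D)‖ *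
      ‖P.nrd ((κ⁻¹ : P.G n) : Matrix (Fin n) (Fin n) P.D)‖ = 1 := by
    rw [← norm_mul, ← nrd_mul, ← Units.val_mul, mul_inv_cancel, Units.val_one, nrd_one, norm_one]
  nlinarith [norm_nonneg (P.nrd (κ : Matrix (Fin n) (Fin n) P.D))]

theorem nrd_one_updateRow (w : Fin (m + 1) → P.D) :
    P.nrd ((1 : Matrix (Fin (m + 1)) (Fin (m + 1)) P.D).updateRow 0 w) = P.nm (w 0) := by
  rw [← nrd_star, nrd_lowerTri, Fin.prod_univ_succ, Finset.prod_eq_one, mul_one,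
    Matrix.star_apply, Matrix.updateRow_self, nm_star]
  · intro i _
    rw [Matrix.star_apply, Matrix.updateRow_ne (Fin.succ_ne_zero i), Matrix.one_apply_eq, nm_star,
      nm_one]
  · intro i j hij
    rw [Matrix.star_apply, Matrix.updateRow_ne (Fin.pos_iff_ne_zero.1 (lt_of_le_of_lt
      (Fin.zero_le i) hij)), Matrix.one_apply_ne hij.ne', star_zero]

/-- The absolute value of the reduced norm is ultrametric in the first row. -/
theorem norm_nrd_updateRow_add_le (A : Matrix (Fin (m + 1)) (Fin (m + 1)) P.D)
    (u v : Fin (m + 1) → P.D) {c : ℝ} (hu : ‖P.nrd (A.updateRow 0 u)‖ ≤ c)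
    (hv : ‖P.nrd (A.updateRow 0 v)‖ ≤ c) : ‖P.nrd (A.updateRow 0 (u + v))‖ ≤ c := by
  by_cases h0 : P.nrd (A.updateRow 0 (u + v)) = 0
  · rw [h0, norm_zero]
    exact (norm_nonneg _).trans hu
  obtain ⟨U, hU⟩ := isUnit_iff_nrd_ne_zero.2 h0
  let V : Matrix (Fin (m + 1)) (Fin (m + 1)) P.D := ((U⁻¹ : P.G (m + 1)) : Matrix _ _ P.D)
  have hVU : V * A.updateRow 0 (u + v) = 1 := by rw [← hU]; exact U.inv_mul
  have hUV : A.updateRow 0 (u + v) * V = 1 := by rw [← hU]; exact U.mul_inv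
  have key : ∀ w : Fin (m + 1) → P.D, ‖P.nrd (A.updateRow 0 w)‖ =
      P.dn ((w ᵥ* V) 0) * ‖P.nrd (A.updateRow 0 (u + v))‖ := by
    intro w
    have h1 : A.updateRow 0 w = (1 : Matrix (Fin (m + 1)) (Fin (m + 1)) P.D).updateRow 0
        (w ᵥ* V) * A.updateRow 0 (u + v) := by
      rw [Matrix.updateRow_mul, Matrix.vecMul_vecMul, hVU, Matrix.vecMul_one, Matrix.one_mul,
        Matrix.updateRow_idem]
    rw [h1, nrd_mul, norm_mul, nrd_one_updateRow]
    rfl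
  have h2 : ((u ᵥ* V) 0) + ((v ᵥ* V) 0) = 1 := by
    rw [← Pi.add_apply, ← Matrix.add_vecMul]
    have := congrFun (congrFun hUV 0) 0
    rw [Matrix.mul_apply_eq_vecMul, Matrix.one_apply_eq] at this
    rwa [Matrix.updateRow_self] at this
  have h3 := P.dn_add_le_max ((u ᵥ* V) 0) ((v ᵥ* V) 0)
  rw [h2, dn_one] at h3
  have h4 := norm_nonneg (P.nrd (A.updateRow 0 (u + v)))
  rw [key] at hu hv
  rcases le_max_iff.1 h3 with h | h
  · exact (le_mul_of_one_le_left h4 h).trans hu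
  · exact (le_mul_of_one_le_left h4 h).trans hv

/-- A column can be cleared outside the first place by row operations over `𝒪`. -/
theorem exists_K_clear_column_zero {ι : Type*} (A : Matrix (Fin (m + 1)) ι P.D) (c : ι) :
    ∃ κ ∈ P.K (m + 1), ∀ l : Fin m,
      ((κ : Matrix (Fin (m + 1)) (Fin (m + 1)) P.D) * A) l.succ c = 0 := by
  obtain ⟨κ, hκ, h, -, -⟩ := P.exists_K_clear_column A (Fin.last m) c
  refine ⟨P.permU Fin.revPerm * κ, (P.K _).mul_mem (P.permU_mem_K _) hκ, fun l => ?_⟩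
  rw [Units.val_mul, Matrix.mul_assoc, permU_mul_apply]
  refine h _ (Fin.lt_last_iff_ne_last.2 fun h => ?_)
  rw [Fin.revPerm_apply, Fin.rev_eq_iff, Fin.rev_last] at h
  exact Fin.succ_ne_zero l h

/-- If `A` is an integral `m × n`-matrix and the entries of the rows of the `n × m`-matrix `Z` are
bounded by an increasing sequence `r`, then `|N_rd(A Z)|` is bounded by the product of the `m`
largest members of `r`. For `m > n` it is zero. -/
theorem norm_nrd_mul_le (n : ℕ) : ∀ (m : ℕ) (A : Matrix (Fin m) (Fin n) P.D)
    (Z : Matrix (Fin n) (Fin m) P.D) (r : Fin n → ℝ), Monotone r → (∀ l, 0 ≤ r l) →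
    (∀ i l, P.dn (A i l) ≤ 1) → (∀ l j, P.dn (Z l j) ≤ r l) →
    (n < m → P.nrd (A * Z) = 0) ∧
      ∀ hm : m ≤ n, ‖P.nrd (A * Z)‖ ≤ ∏ j : Fin m, r (Fin.castLE hm j).rev := by
  induction n with
  | zero =>
    intro m A Z r hr hr0 hA hZ
    refine ⟨fun hm => ?_, fun hm => ?_⟩
    · obtain ⟨m, rfl⟩ := Nat.exists_eq_succ_of_ne_zero hm.ne'
      have h : A * Z = 0 := by ext1 i j; simp [Matrix.mul_apply]
      rw [h, nrd_succ _ fun _ => rfl, Matrix.zero_apply, nm_zero, zero_mul]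
    · obtain rfl := Nat.le_zero.1 hm
      rw [Subsingleton.elim (A * Z) 1, nrd_one, norm_one, Finset.univ_eq_empty,
        Finset.prod_empty]
  | succ n ih =>
    rintro (_ | m) A Z r hr hr0 hA hZ
    · refine ⟨fun hm => absurd hm (Nat.not_lt_zero _), fun hm => ?_⟩
      rw [Subsingleton.elim (A * Z) 1, nrd_one, norm_one, Finset.univ_eq_empty,
        Finset.prod_empty]
    -- make the first column of `A` and the first row of `Z` vanish outside the first place
    obtain ⟨κ, hκ, hκ0⟩ := exists_K_clear_column_zero A 0
    obtain ⟨κ', hκ', hκ0'⟩ := exists_K_clear_column_zero Zᴴ 0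
    set A₁ : Matrix (Fin (m + 1)) (Fin (n + 1)) P.D :=
      (κ : Matrix (Fin (m + 1)) (Fin (m + 1)) P.D) * A with hA₁
    set Z₁ : Matrix (Fin (n + 1)) (Fin (m + 1)) P.D :=
      Z * (κ' : Matrix (Fin (m + 1)) (Fin (m + 1)) P.D)ᴴ with hZ₁
    have hA1 : ∀ i l, P.dn (A₁ i l) ≤ 1 := fun i l => by
      rw [hA₁, Matrix.mul_apply]
      refine P.dn_sum_le _ zero_le_one fun j _ => ?_
      rw [dn_mul]
      exact mul_le_one₀ (P.mem_maxOrder_iff.1 (hκ.1 _ _)) (P.dn_nonneg _) (hA _ _)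
    have hZ1 : ∀ l j, P.dn (Z₁ l j) ≤ r l := fun l j => by
      rw [hZ₁, Matrix.mul_apply]
      refine P.dn_sum_le _ (hr0 l) fun i _ => ?_
      rw [dn_mul, Matrix.conjTranspose_apply, dn_star]
      exact (mul_le_of_le_one_right (P.dn_nonneg _) (P.mem_maxOrder_iff.1 (hκ'.1 _ _))).trans
        (hZ l i)
    have hZ0 : ∀ j : Fin m, Z₁ 0 j.succ = 0 := by
      intro j
      have h1 := hκ0' j
      have h2 : (κ' : Matrix (Fin (m + 1)) (Fin (m + 1)) P.D) * Zᴴ = Z₁ᴴ := by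
        rw [hZ₁, Matrix.conjTranspose_mul, Matrix.conjTranspose_conjTranspose]
      rw [h2, Matrix.conjTranspose_apply] at h1
      exact star_eq_zero.1 h1
    have hnorm : ‖P.nrd (A * Z)‖ = ‖P.nrd (A₁ * Z₁)‖ := by
      have h1 : A₁ * Z₁ = (κ : Matrix (Fin (m + 1)) (Fin (m + 1)) P.D) * (A * Z) *
          star (κ' : Matrix (Fin (m + 1)) (Fin (m + 1)) P.D) := by
        rw [hA₁, hZ₁, Matrix.mul_assoc, Matrix.mul_assoc, Matrix.mul_assoc]
        rfl
      rw [h1, nrd_mul, nrd_mul, nrd_star, norm_mul, norm_mul, norm_nrd_eq_one hκ,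
        norm_nrd_eq_one hκ', one_mul, mul_one]
    let A₂ : Matrix (Fin (m + 1)) (Fin n) P.D := A₁.submatrix id Fin.succ
    let Z₂ : Matrix (Fin n) (Fin (m + 1)) P.D := Z₁.submatrix Fin.succ id
    have hsplit : ∀ i j, (A₁ * Z₁) i j = A₁ i 0 * Z₁ 0 j + (A₂ * Z₂) i j := by
      intro i j
      rw [Matrix.mul_apply, Fin.sum_univ_succ]
      rfl
    let w : Fin (m + 1) → P.D := fun j => A₁ 0 0 * Z₁ 0 j
    have hrow : A₁ * Z₁ = (A₂ * Z₂).updateRow 0 ((A₂ * Z₂) 0 + w) := by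
      ext1 i j
      rw [hsplit]
      refine Fin.cases ?_ (fun i => ?_) i
      · rw [Matrix.updateRow_self, Pi.add_apply, add_comm]
      · rw [hκ0, zero_mul, zero_add, Matrix.updateRow_ne (Fin.succ_ne_zero i)]
    have h1 : (A₂ * Z₂).updateRow 0 ((A₂ * Z₂) 0) = A₂ * Z₂ := Matrix.updateRow_eq_self _ _
    have h2 : P.nrd ((A₂ * Z₂).updateRow 0 w) = P.nm (A₁ 0 0 * Z₁ 0 0) *
        P.nrd (A₂.submatrix Fin.succ id * Z₂.submatrix id Fin.succ) := by
      rw [nrd_succ, Matrix.updateRow_self]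
      · congr 2
      · intro j
        rw [Matrix.updateRow_self]
        change A₁ 0 0 * Z₁ 0 j.succ = 0
        rw [hZ0, mul_zero]
    have ih1 := ih (m + 1) A₂ Z₂ (fun l => r l.succ)
      (fun a b hab => hr (Fin.succ_le_succ_iff.2 hab)) (fun l => hr0 _) (fun i l => hA1 _ _)
      fun l j => hZ1 _ _
    have ih2 := ih m (A₂.submatrix Fin.succ id) (Z₂.submatrix id Fin.succ) (fun l => r l.succ)
      (fun a b hab => hr (Fin.succ_le_succ_iff.2 hab)) (fun l => hr0 _) (fun i l => hA1 _ _)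
      fun l j => hZ1 _ _
    have hle : ∀ c : ℝ, ‖P.nrd (A₂ * Z₂)‖ ≤ c →
        ‖P.nrd (A₂.submatrix Fin.succ id * Z₂.submatrix id Fin.succ)‖ * r 0 ≤ c →
        ‖P.nrd (A * Z)‖ ≤ c := by
      intro c hc hc'
      rw [hnorm, hrow]
      refine norm_nrd_updateRow_add_le _ _ _ (by rwa [h1]) ?_
      rw [h2, norm_mul, mul_comm]
      refine le_trans (mul_le_mul_of_nonneg_left ?_ (norm_nonneg _)) hc'
      change P.dn (A₁ 0 0 * Z₁ 0 0) ≤ r 0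
      rw [dn_mul]
      exact (mul_le_of_le_one_left (P.dn_nonneg _) (hA1 _ _)).trans (hZ1 _ _)
    have hrev : ∀ (m' : ℕ) (h : m' ≤ n) (h' : m' ≤ n + 1) (j : Fin m'),
        (Fin.castLE h j).rev.succ = (Fin.castLE h' j).rev := by
      intro m' h h' j
      ext
      simp only [Fin.val_succ, Fin.val_rev, Fin.val_castLE]
      omega
    refine ⟨fun hm => ?_, fun hm => ?_⟩
    · rw [← norm_le_zero_iff]
      refine hle 0 (by rw [ih1.1 (by omega), norm_zero]) ?_
      rw [ih2.1 (by omega), norm_zero, zero_mul]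
    · refine hle _ ?_ ?_
      · rcases Nat.lt_or_ge n (m + 1) with h | h
        · rw [ih1.1 h, norm_zero]
          exact Finset.prod_nonneg fun _ _ => hr0 _
        · refine (ih1.2 h).trans (le_of_eq (Finset.prod_congr rfl fun j _ => ?_))
          rw [hrev]
      · have hm' : m ≤ n := by omega
        rw [Fin.prod_univ_castSucc]
        refine mul_le_mul ((ih2.2 hm').trans (le_of_eq (Finset.prod_congr rfl fun j _ => ?_)))
          (hr (Fin.zero_le _)) (hr0 _) (Finset.prod_nonneg fun _ _ => hr0 _)
        rw [hrev m hm' (by omega)]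
        rfl

end QuatData

/-! ### The extremal exponents attached to an element of `Λₙ` -/

theorem prod_zpow_eq_zpow_sum {ι : Type*} {c : ℝ} (hc : c ≠ 0) (A : Finset ι) (f : ι → ℤ) :
    ∏ i ∈ A, c ^ f i = c ^ ∑ i ∈ A, f i := by
  classical
  induction A using Finset.induction_on with
  | empty => rw [Finset.prod_empty, Finset.sum_empty, zpow_zero]
  | insert a A ha ih => rw [Finset.prod_insert ha, Finset.sum_insert ha, ih, zpow_add₀ hc]

section Exponents

variable {n : ℕ} {α β : Fin n → ℤ}

/-- The place `i` is the second one of a pair of odd entries of `α ∈ Λₙ`. -/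
def IsSecond (α : Fin n → ℤ) (i : Fin n) : Prop := ¬ Even (α i) ∧ ¬ Even (rankBefore α i)

instance (α : Fin n → ℤ) : DecidablePred (IsSecond α) := fun _ => inferInstanceAs (Decidable (_ ∧ _))

/-- The exponents of a diagonal form attached to `α ∈ Λₙ`: half of the even entries, and `e`,
`e + 1` for a pair of odd entries `2e + 1`, `2e + 1`. -/
def halfExp (α : Fin n → ℤ) (i : Fin n) : ℤ := α i / 2 + if IsSecond α i then 1 else 0

/-- The sum of the last `m` of the exponents `halfExp α`. -/
def tailSum (α : Fin n → ℤ) (m : ℕ) (hm : m ≤ n) : ℤ :=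
  ∑ j : Fin m, halfExp α (Fin.castLE hm j).rev

theorem exists_isSecond_next (hα : α ∈ Lam n) {i : Fin n} (ho : ¬ Even (α i))
    (hs : ¬ IsSecond α i) : ∃ j : Fin n, j.val = i.val + 1 ∧ α j = α i ∧ IsSecond α j := by
  have hr : Even (rankBefore α i) := not_not.1 fun h => hs ⟨ho, h⟩
  obtain ⟨j, hj, h⟩ := exists_next hα ho hr
  refine ⟨j, hj, h, by rwa [h], ?_⟩
  rw [rankBefore_succ hj h, Nat.even_add_one, not_not]
  exact hr

theorem IsSecond.exists_prev (hα : α ∈ Lam n) {i : Fin n} (h : IsSecond α i) :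
    ∃ j : Fin n, i.val = j.val + 1 ∧ α i = α j ∧ ¬ IsSecond α j := by
  obtain ⟨j, hj, hij⟩ := QHerm.exists_prev hα h.2
  refine ⟨j, hj, hij, fun hs => ?_⟩
  have := h.2
  rw [rankBefore_succ hj hij, Nat.even_add_one, not_not] at this
  exact hs.2 this

theorem IsSecond.not_isSecond_prev (hα : α ∈ Lam n) {i j : Fin n} (h : IsSecond α i)
    (hij : i.val = j.val + 1) : ¬ IsSecond α j ∧ α i = α j := by
  obtain ⟨j', hj', h1, h2⟩ := h.exists_prev hα
  obtain rfl : j = j' := Fin.ext (by omega)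
  exact ⟨h2, h1⟩

theorem two_mul_halfExp_sub (α : Fin n → ℤ) (i : Fin n) : 2 * halfExp α i - α i =
    if Even (α i) then 0 else if IsSecond α i then 1 else -1 := by
  unfold halfExp
  by_cases he : Even (α i)
  · have hs : ¬ IsSecond α i := fun h => h.1 he
    obtain ⟨e, h⟩ := he
    rw [if_neg hs, if_pos ⟨e, h⟩]
    omega
  · rw [if_neg he]
    obtain ⟨e, h⟩ := Int.not_even_iff_odd.1 he
    split_ifs <;> omega

/-- The pairs of odd entries contribute nothing to the difference between `2 * tailSum` and the sum
of the last entries of `α`, unless the first member of a pair has been cut off. -/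
theorem sum_two_mul_halfExp_sub (hα : α ∈ Lam n) (m : ℕ) : ∀ hm : m < n,
    ∑ j : Fin (m + 1), (2 * halfExp α (Fin.castLE hm j).rev - α (Fin.castLE hm j).rev) =
      if IsSecond α (Fin.rev ⟨m, hm⟩) then 1 else 0 := by
  induction m with
  | zero =>
    intro hm
    rw [Fin.sum_univ_one, two_mul_halfExp_sub]
    change (if Even (α (Fin.rev ⟨0, hm⟩)) then (0 : ℤ) else if IsSecond α (Fin.rev ⟨0, hm⟩) then 1
      else -1) = _
    by_cases he : Even (α (Fin.rev ⟨0, hm⟩))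
    · rw [if_pos he, if_neg fun h => h.1 he]
    · rw [if_neg he]
      by_cases hs : IsSecond α (Fin.rev ⟨0, hm⟩)
      · rw [if_pos hs, if_pos hs]
      · obtain ⟨j, hj, -⟩ := exists_isSecond_next hα he hs
        rw [Fin.val_rev] at hj
        have := j.isLt
        simp only at hj
        omega
  | succ m ih =>
    intro hm
    have hm' : m < n := by omega
    rw [Fin.sum_univ_castSucc]
    have h1 := ih hm'
    have h2 : ∀ j : Fin (m + 1), Fin.castLE hm j.castSucc = Fin.castLE hm' j := fun j => rfl
    have h3 : (Fin.castLE hm (Fin.last (m + 1))).rev = Fin.rev ⟨m + 1, hm⟩ := rfl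
    simp only [h2, h3]
    rw [h1, two_mul_halfExp_sub]
    have hval : (Fin.rev ⟨m, hm'⟩ : Fin n).val = (Fin.rev ⟨m + 1, hm⟩ : Fin n).val + 1 := by
      rw [Fin.val_rev, Fin.val_rev]
      simp only
      omega
    set L : Fin n := Fin.rev ⟨m + 1, hm⟩
    set L' : Fin n := Fin.rev ⟨m, hm'⟩
    by_cases hs' : IsSecond α L'
    · obtain ⟨h4, h5⟩ := hs'.not_isSecond_prev hα hval
      rw [if_pos hs', if_neg h4, if_neg h4, if_neg (by rw [← h5]; exact hs'.1)]
      rfl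
    · rw [if_neg hs', zero_add]
      by_cases he : Even (α L)
      · rw [if_pos he, if_neg fun h => h.1 he]
      · rw [if_neg he]
        by_cases hs : IsSecond α L
        · rw [if_pos hs, if_pos hs]
        · obtain ⟨j, hj, -, h⟩ := exists_isSecond_next hα he hs
          exact absurd (by rwa [show j = L' from Fin.ext (by omega)] at h) hs'

theorem two_mul_tailSum_le (hα : α ∈ Lam n) (i : Fin n) : 2 * tailSum α (i.val + 1) i.isLt ≤
    (∑ j : Fin (i.val + 1), α (Fin.castLE i.isLt j).rev) + 1 := by
  have h := sum_two_mul_halfExp_sub hα i.val i.isLt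
  rw [Finset.sum_sub_distrib, ← Finset.mul_sum] at h
  unfold tailSum
  split_ifs at h <;> linarith

theorem halfExp_lt_iff (hα : α ∈ Lam n) {i j : Fin n} (hij : j.val = i.val + 1) :
    halfExp α i < halfExp α j ↔ IsSecond α j := by
  constructor
  · intro h
    by_contra hs
    have h1 : α j ≤ α i := hα.1 (Fin.le_def.2 (by omega))
    unfold halfExp at h
    rw [if_neg hs] at h
    split_ifs at h <;> omega
  · intro hs
    obtain ⟨h1, h2⟩ := hs.not_isSecond_prev hα hij
    unfold halfExp
    rw [if_pos hs, if_neg h1, h2]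
    omega

theorem isSecond_iff (hα : α ∈ Lam n) (j : Fin n) :
    IsSecond α j ↔ ∃ i : Fin n, j.val = i.val + 1 ∧ halfExp α i < halfExp α j := by
  constructor
  · intro hs
    obtain ⟨i, hi, -⟩ := hs.exists_prev hα
    exact ⟨i, hi, (halfExp_lt_iff hα hi).2 hs⟩
  · rintro ⟨i, hi, h⟩
    exact (halfExp_lt_iff hα hi).1 h

theorem not_even_iff_isSecond (hα : α ∈ Lam n) (i : Fin n) :
    ¬ Even (α i) ↔ IsSecond α i ∨ ∃ j : Fin n, j.val = i.val + 1 ∧ IsSecond α j := by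
  constructor
  · intro ho
    by_cases hs : IsSecond α i
    · exact Or.inl hs
    · obtain ⟨j, hj, -, h⟩ := exists_isSecond_next hα ho hs
      exact Or.inr ⟨j, hj, h⟩
  · rintro (h | ⟨j, hj, h⟩)
    · exact h.1
    · rw [← (h.not_isSecond_prev hα hj).2]
      exact h.1

theorem halfExp_injective (hα : α ∈ Lam n) (hβ : β ∈ Lam n) (h : halfExp α = halfExp β) :
    α = β := by
  have h1 : ∀ j, IsSecond α j ↔ IsSecond β j := fun j => by
    rw [isSecond_iff hα, isSecond_iff hβ, h]
  have h2 : ∀ i, Even (α i) ↔ Even (β i) := fun i => by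
    rw [← not_iff_not, not_even_iff_isSecond hα, not_even_iff_isSecond hβ]
    simp only [h1]
  ext i
  have h3 := two_mul_halfExp_sub α i
  have h4 := two_mul_halfExp_sub β i
  rw [h] at h3
  simp only [h1, h2] at h3
  linarith

/-- The differences of successive tail sums are the exponents `halfExp α`, and these determine `α`:
an increase between neighbours occurs exactly at a pair of odd entries. -/
theorem tailSum_injective (hα : α ∈ Lam n) (hβ : β ∈ Lam n)
    (h : ∀ i : Fin n, tailSum α (i.val + 1) i.isLt = tailSum β (i.val + 1) i.isLt) : α = β := by
  have h0 : ∀ m (hm : m ≤ n), tailSum α m hm = tailSum β m hm := by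
    rintro (_ | m) hm
    · rfl
    · exact h ⟨m, hm⟩
  refine halfExp_injective hα hβ (funext fun i => ?_)
  have h1 := h0 (i.rev.val + 1) i.rev.isLt
  have h2 := h0 i.rev.val i.rev.isLt.le
  unfold tailSum at h1 h2
  rw [Fin.sum_univ_castSucc, Fin.sum_univ_castSucc] at h1
  have h3 : (Fin.castLE i.rev.isLt (Fin.last i.rev.val)).rev = i := by
    ext
    simp only [Fin.val_rev, Fin.val_castLE, Fin.val_last]
    omega
  rw [h3] at h1
  exact add_left_cancel (a := ∑ j : Fin i.rev.val, halfExp α (Fin.castLE i.rev.isLt.le j).rev)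
    (h1.trans (congrArg (· + _) h2.symm))

/-- The partner of a place in the block structure of `π^α`. -/
theorem exists_partner (hα : α ∈ Lam n) : ∃ t : Fin n → Fin n, (∀ i, t (t i) = i) ∧ ∀ i,
    (Even (α i) ∧ t i = i) ∨
    (¬ Even (α i) ∧ ¬ IsSecond α i ∧ (t i).val = i.val + 1 ∧ α (t i) = α i ∧ IsSecond α (t i)) ∨
    (IsSecond α i ∧ i.val = (t i).val + 1 ∧ α (t i) = α i ∧ ¬ IsSecond α (t i)) := by
  have h : ∀ i, ∃ j : Fin n, (Even (α i) ∧ j = i) ∨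
      (¬ Even (α i) ∧ ¬ IsSecond α i ∧ j.val = i.val + 1 ∧ α j = α i ∧ IsSecond α j) ∨
      (IsSecond α i ∧ i.val = j.val + 1 ∧ α j = α i ∧ ¬ IsSecond α j) := by
    intro i
    by_cases he : Even (α i)
    · exact ⟨i, Or.inl ⟨he, rfl⟩⟩
    by_cases hs : IsSecond α i
    · obtain ⟨j, h1, h2, h3⟩ := hs.exists_prev hα
      exact ⟨j, Or.inr (Or.inr ⟨hs, h1, h2.symm, h3⟩)⟩
    · obtain ⟨j, h1, h2, h3⟩ := exists_isSecond_next hα he hs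
      exact ⟨j, Or.inr (Or.inl ⟨he, hs, h1, h2, h3⟩)⟩
  choose t ht using h
  refine ⟨t, fun i => ?_, ht⟩
  rcases ht i with ⟨_, h1⟩ | ⟨h0, _, h1, h2, h3⟩ | ⟨h0, h1, h2, h3⟩
  · rw [h1, h1]
  · rcases ht (t i) with ⟨h4, _⟩ | ⟨_, h4, _⟩ | ⟨_, h4, _⟩
    · exact absurd h4 h3.1
    · exact absurd h3 h4
    · exact Fin.ext (by omega)
  · rcases ht (t i) with ⟨h4, _⟩ | ⟨_, _, h4, _⟩ | ⟨h4, _⟩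
    · rw [h2] at h4
      exact absurd h4 h0.1
    · exact Fin.ext (by omega)
    · exact absurd h4 h3

end Exponents

namespace QuatData

variable {k : Type*} [NontriviallyNormedField k] [IsUltrametricDist k] {P : QuatData k} {n : ℕ}
  [LocallyCompactSpace k] [CompleteSpace k] [P.IsOddLocal]

theorem dn_piMatrix_le (α : Fin n → ℤ) (i j : Fin n) :
    P.dn (P.piMatrix α i j) ≤ ‖P.π‖ ^ α i := by
  have h0 : 0 ≤ ‖P.π‖ ^ α i := zpow_nonneg (norm_nonneg _) _
  have ho : ¬ Even (α i) → 2 * (α i / 2) + 1 = α i := fun h => by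
    have := Int.not_even_iff_odd.1 h
    obtain ⟨e, he⟩ := this
    omega
  unfold piMatrix
  rw [Matrix.of_apply]
  split_ifs with h1 h2 h3 h4 h5
  · rw [dn_piCoe, Int.mul_ediv_cancel' h1.two_dvd]
  · rwa [dn_zero]
  · rw [dn_piPrime, ho h1]
  · rwa [dn_zero]
  · rw [dn_neg, dn_piPrime, ho h1]
  · rwa [dn_zero]

/-- The maximal possible absolute value of `dᵢ` on the `K`-orbit of `π^α`. -/
theorem norm_d_smul_piX_le (α : Lam n) {κ : P.G n} (hκ : κ ∈ P.K n) (i : Fin n) :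
    ‖P.d i (κ • P.piX α)‖ ≤ ‖P.π‖ ^ tailSum α.1 (i.val + 1) i.isLt := by
  have hp := P.norm_pi_pos
  by_cases h0 : P.d i (κ • P.piX α) = 0
  · rw [h0, norm_zero]
    exact zpow_nonneg (norm_nonneg _) _
  obtain ⟨t, ht⟩ := P.norm_eq_zpow h0
  let A : Matrix (Fin (i.val + 1)) (Fin n) P.D :=
    (κ : Matrix (Fin n) (Fin n) P.D).submatrix (Fin.castLE i.isLt) id
  have hblock : P.block (P.toMatrix (κ • P.piX α)) i = A * (P.piMatrix α.1 * Aᴴ) := by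
    rw [toMatrix_smul, Matrix.mul_assoc]
    rfl
  have hA : ∀ a l, P.dn (A a l) ≤ 1 := fun a l => P.mem_maxOrder_iff.1 (hκ.1 _ _)
  have h1 := (norm_nrd_mul_le n (i.val + 1) A (P.piMatrix α.1 * Aᴴ) (fun l => ‖P.π‖ ^ α.1 l)
    (fun a b hab => zpow_le_zpow_right_of_le_one₀ hp P.norm_π_lt_one.le (α.2.1 hab))
    (fun l => zpow_nonneg (norm_nonneg _) _) hA fun l j => by
      rw [Matrix.mul_apply]
      refine P.dn_sum_le _ (zpow_nonneg (norm_nonneg _) _) fun a _ => ?_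
      rw [dn_mul, Matrix.conjTranspose_apply, dn_star]
      exact (mul_le_of_le_one_right (P.dn_nonneg _) (hA _ _)).trans (dn_piMatrix_le _ _ _)).2 i.isLt
  rw [← hblock, ← d_sq, norm_pow, ht, ← zpow_natCast, ← zpow_mul, prod_zpow_eq_zpow_sum hp.ne',
    zpow_le_zpow_iff_right_of_lt_one₀ hp P.norm_π_lt_one] at h1
  rw [ht, zpow_le_zpow_iff_right_of_lt_one₀ hp P.norm_π_lt_one]
  -- the sum of the entries of `α` is only half an integer off
  have h2 := two_mul_tailSum_le α.2 i
  push_cast at h1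
  omega

theorem of_mul_of_eq_zero {t : Fin n → Fin n} {S : Fin n → Prop} [DecidablePred S]
    (hS : ∀ i, S i → ¬ S (t i)) (v : P.D) :
    (Matrix.of fun i j => if j = t i then (if S i then v else 0) else 0 :
      Matrix (Fin n) (Fin n) P.D) *
      (Matrix.of fun i j => if j = t i then (if S i then v else 0) else 0) = 0 := by
  ext1 i j
  rw [Matrix.mul_apply, Matrix.zero_apply]
  refine Finset.sum_eq_zero fun l _ => ?_
  rw [Matrix.of_apply, Matrix.of_apply]
  by_cases hl : l = t i ∧ S i
  · have h1 : ¬ S l := by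
      rw [hl.1]
      exact hS i hl.2
    rw [if_neg h1, ite_self, mul_zero]
  · rw [← ite_and, if_neg hl, zero_mul]

variable (P) in
/-- The matrix `1 + v ∑ E_{i, t i}`, the sum being over the places `i ∈ S`. -/
def unipU (t : Fin n → Fin n) (S : Fin n → Prop) [DecidablePred S]
    (hS : ∀ i, S i → ¬ S (t i)) (v : P.D) : P.G n where
  val := 1 + Matrix.of fun i j => if j = t i then (if S i then v else 0) else 0
  inv := 1 - Matrix.of fun i j => if j = t i then (if S i then v else 0) else 0
  val_inv := by
    rw [add_mul, one_mul, mul_sub, of_mul_of_eq_zero hS]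
    simp
  inv_val := by
    rw [sub_mul, one_mul, mul_add, of_mul_of_eq_zero hS]
    simp

theorem unipU_apply {t : Fin n → Fin n} {S : Fin n → Prop} [DecidablePred S]
    (hS : ∀ i, S i → ¬ S (t i)) (v : P.D) (i j : Fin n) :
    ((P.unipU t S hS v : P.G n) : Matrix (Fin n) (Fin n) P.D) i j =
      (if j = i then 1 else 0) + if j = t i then (if S i then v else 0) else 0 := by
  change (1 : Matrix (Fin n) (Fin n) P.D) i j + _ = _
  rw [Matrix.one_apply]
  exact congrArg₂ _ (if_congr eq_comm rfl rfl) rfl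

theorem unipU_mem_K {t : Fin n → Fin n} {S : Fin n → Prop} [DecidablePred S]
    (hS : ∀ i, S i → ¬ S (t i)) {v : P.D} (hv : v ∈ P.maxOrder) : P.unipU t S hS v ∈ P.K n := by
  have h1 : ∀ i j, (1 : Matrix (Fin n) (Fin n) P.D) i j ∈ P.maxOrder := fun i j => by
    rw [Matrix.one_apply]
    split_ifs
    exacts [P.maxOrder.one_mem, P.maxOrder.zero_mem]
  have h2 : ∀ i j, (Matrix.of fun i j => if j = t i then (if S i then v else 0) else 0 :
      Matrix (Fin n) (Fin n) P.D) i j ∈ P.maxOrder := fun i j => by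
    rw [Matrix.of_apply]
    split_ifs
    exacts [hv, P.maxOrder.zero_mem, P.maxOrder.zero_mem]
  exact ⟨fun i j => P.maxOrder.add_mem (h1 i j) (h2 i j),
    fun i j => P.maxOrder.sub_mem (h1 i j) (h2 i j)⟩

/-- Transformation of a block matrix of `1 × 1`- and `2 × 2`-blocks by another one. -/
theorem mul_mul_star_apply {t : Fin n → Fin n} (ht : ∀ i, t (t i) = i)
    {x g : Matrix (Fin n) (Fin n) P.D} {xv a b : Fin n → P.D}
    (hx : ∀ i j, x i j = if j = t i then xv i else 0)
    (hg : ∀ i j, g i j = (if j = i then a i else 0) + if j = t i then b i else 0) (i l : Fin n) :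
    (g * x * star g) i l = a i * xv i * star (g l (t i)) + b i * xv (t i) * star (g l i) := by
  have h1 : ∀ j, (g * x) i j = (if j = t i then a i * xv i else 0) +
      if j = i then b i * xv (t i) else 0 := by
    intro j
    rw [Matrix.mul_apply]
    simp only [hg i, add_mul, ite_mul, zero_mul, Finset.sum_add_distrib, Finset.sum_ite_eq',
      Finset.mem_univ, if_true]
    simp only [hx, ht, mul_ite, mul_zero]
  rw [Matrix.mul_apply]
  simp only [h1, Matrix.star_apply, add_mul, ite_mul, zero_mul, Finset.sum_add_distrib,
    Finset.sum_ite_eq', Finset.mem_univ, if_true]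

/-- Over `K`, followed by a unipotent upper triangular matrix, the form `π^α` is equivalent to a
diagonal form with entries of the orders `halfExp α`. -/
theorem exists_K_smul_piX_eq_unipU_smul (α : Lam n) : ∃ κ ∈ P.K n, ∃ (u : P.G n) (τ : Fin n → k)
    (y : P.X n), (∀ i j, j < i → (u : Matrix (Fin n) (Fin n) P.D) i j = 0) ∧
      (∀ i, (u : Matrix (Fin n) (Fin n) P.D) i i = 1) ∧
      (∀ i, ‖τ i‖ = ‖P.π‖ ^ halfExp α.1 i) ∧
      P.toMatrix y = Matrix.diagonal (fun i => algebraMap k P.D (τ i)) ∧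
      κ • P.piX α = u • y := by
  obtain ⟨t, htt, ht⟩ := exists_partner α.2
  let v : P.D := P.piPrime 0
  obtain ⟨w, hw⟩ : ∃ w : k, 2 * w = 1 := ⟨2⁻¹, mul_inv_cancel₀ P.two_ne_zero'⟩
  let c : P.D := ⟨0, 0, w * P.π⁻¹, 0⟩
  have hπ := P.π_ne_zero
  -- multiplication of the `2 × 2`-blocks
  have e1 : ∀ e : ℤ, algebraMap k P.D w * P.piPrime e * star (-c) +
      -c * -P.piPrime e * star (algebraMap k P.D w) = algebraMap k P.D (w * P.π ^ e) := by
    intro e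
    ext <;> simp [c, piPrime, QuaternionAlgebra.algebraMap_eq]
    field_simp
    linear_combination w * hw
  have e2 : ∀ e : ℤ, algebraMap k P.D w * P.piPrime e * star 1 +
      -c * -P.piPrime e * star v = 0 := by
    intro e
    ext <;> simp [c, v, piPrime, QuaternionAlgebra.algebraMap_eq]
    field_simp
    ring
  have e3 : ∀ e : ℤ, 1 * -P.piPrime e * star v + v * P.piPrime e * star 1 =
      algebraMap k P.D (2 * P.π ^ (e + 1)) := by
    intro e
    ext <;> simp [v, piPrime, QuaternionAlgebra.algebraMap_eq]
    rw [zpow_add_one₀ hπ]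
    ring
  have e4 : ∀ e : ℤ, 1 * -P.piPrime e * star (algebraMap k P.D w) +
      v * P.piPrime e * star (-c) = 0 := by
    intro e
    ext <;> simp [c, v, piPrime, QuaternionAlgebra.algebraMap_eq]
    field_simp
    ring
  have hcv : c * v = algebraMap k P.D w := by
    ext <;> simp [c, v, piPrime, QuaternionAlgebra.algebraMap_eq]
    field_simp
  have h22 : algebraMap k P.D w + algebraMap k P.D w = 1 := by
    rw [← map_add, ← two_mul, hw, map_one]
  -- the places which are the first ones of a pair
  let F : Fin n → Prop := fun i => ¬ Even (α.1 i) ∧ ¬ IsSecond α.1 i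
  have hF : ∀ i, F i → ¬ F (t i) := by
    rintro i ⟨h1, h2⟩ ⟨-, h3⟩
    rcases ht i with h | h | h
    · exact h1 h.1
    · exact h3 h.2.2.2.2
    · exact h2 h.1
  have hS : ∀ i, IsSecond α.1 i → ¬ IsSecond α.1 (t i) := by
    intro i h1
    rcases ht i with h | h | h
    · exact absurd h.1 h1.1
    · exact absurd h1 h.2.1
    · exact h.2.2.2
  let xv : Fin n → P.D := fun i => if Even (α.1 i) then P.piCoe (α.1 i / 2) else
    if IsSecond α.1 i then -P.piPrime (α.1 i / 2) else P.piPrime (α.1 i / 2)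
  have hx : ∀ i j, P.piMatrix α.1 i j = if j = t i then xv i else 0 := by
    intro i j
    simp only [xv, piMatrix, Matrix.of_apply]
    rcases ht i with ⟨he, h⟩ | ⟨he, hs, h, -⟩ | ⟨hs, h, -⟩
    · rw [if_pos he, if_pos he, h]
    · rw [if_neg he, if_neg he, if_neg hs, if_pos (not_not.1 fun h' => hs ⟨he, h'⟩)]
      exact if_congr (by rw [← h, Fin.ext_iff]) rfl rfl
    · rw [if_neg hs.1, if_neg hs.1, if_pos hs, if_neg hs.2]
      refine if_congr ?_ rfl rfl
      rw [Fin.ext_iff]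
      omega
  let a : Fin n → P.D := fun i => if F i then algebraMap k P.D w else 1
  let b : Fin n → P.D := fun i => if F i then -c else if IsSecond α.1 i then v else 0
  let g : Matrix (Fin n) (Fin n) P.D :=
    Matrix.of fun i j => (if j = i then a i else 0) + if j = t i then b i else 0
  have hga : ∀ i j, g i j = (if j = i then a i else 0) + if j = t i then b i else 0 :=
    fun _ _ => rfl
  have h0 : ∀ {i j}, j ≠ i → j ≠ t i → g i j = 0 := fun h h' => by
    rw [hga, if_neg h, if_neg h', add_zero]
  have h1 : ∀ {i}, i ≠ t i → g i i = a i := fun h => by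
    rw [hga, if_pos rfl, if_neg h, add_zero]
  have h2 : ∀ {i}, i ≠ t i → g i (t i) = b i := fun h => by
    rw [hga, if_pos rfl, if_neg h.symm, zero_add]
  let τ : Fin n → k := fun i => if Even (α.1 i) then P.π ^ (α.1 i / 2) else
    if IsSecond α.1 i then 2 * P.π ^ (α.1 i / 2 + 1) else w * P.π ^ (α.1 i / 2)
  have hg : g * P.piMatrix α.1 * star g = Matrix.diagonal fun i => algebraMap k P.D (τ i) := by
    ext1 i l
    rw [mul_mul_star_apply htt hx hga, Matrix.diagonal_apply]
    by_cases hl : l ≠ i ∧ l ≠ t i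
    · rw [h0 (fun h => hl.2 h.symm) fun h => hl.1 (by rw [← htt l, ← h, htt]),
        h0 (fun h => hl.1 h.symm) fun h => hl.2 (by rw [h, htt]), star_zero, mul_zero, mul_zero,
        add_zero, if_neg fun h => hl.1 h.symm]
    rcases ht i with ⟨he, h⟩ | ⟨he, hs, h, hα, hs'⟩ | ⟨hs, h, hα, hs'⟩
    · obtain rfl : l = i := by
        by_contra h'
        exact hl ⟨h', by rwa [h]⟩
      have ha : a l = 1 := if_neg fun h => h.1 he
      have hb : b l = 0 := by
        simp only [b]
        rw [if_neg fun h => h.1 he, if_neg fun h => h.1 he]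
      rw [if_pos rfl, h, hga, if_pos rfl, if_pos h.symm, ha, hb]
      simp only [τ, xv, if_pos he]
      rw [algebraMap_zpow_eq_piCoe]
      simp
    · have hne : i ≠ t i := fun h' => by have := congrArg Fin.val h'; omega
      have hne' : t i ≠ t (t i) := by rw [htt]; exact hne.symm
      have h3 := h2 hne'
      have ho : ¬ Even (α.1 (t i)) := by rwa [hα]
      rw [htt] at h3
      have hF' : ¬ F (t i) := fun h => h.2 hs'
      have hF1 : F i := ⟨he, hs⟩
      have hxs : xv (t i) = -P.piPrime (α.1 i / 2) := by
        simp only [xv, if_neg ho, if_pos hs', hα]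
      have hxf : xv i = P.piPrime (α.1 i / 2) := by
        simp only [xv, if_neg he, if_neg hs]
      by_cases hl' : l = i
      · rw [hl', h2 hne, h1 hne, if_pos rfl, hxs, hxf]
        simp only [a, b, τ, if_pos hF1, if_neg he, if_neg hs]
        exact e1 _
      · obtain rfl : l = t i := by
          by_contra h'
          exact hl ⟨hl', h'⟩
        rw [h3, h1 hne', if_neg hne, hxs, hxf]
        simp only [a, b, if_pos hF1, if_neg hF', if_pos hs']
        exact e2 _
    · have hne : i ≠ t i := fun h' => by have := congrArg Fin.val h'; omega
      have hne' : t i ≠ t (t i) := by rw [htt]; exact hne.symm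
      have h3 := h2 hne'
      have ho : ¬ Even (α.1 (t i)) := by rw [hα]; exact hs.1
      rw [htt] at h3
      have hF' : F (t i) := ⟨ho, hs'⟩
      have hF1 : ¬ F i := fun h => h.2 hs
      have hxs : xv i = -P.piPrime (α.1 i / 2) := by
        simp only [xv, if_neg hs.1, if_pos hs]
      have hxf : xv (t i) = P.piPrime (α.1 i / 2) := by
        simp only [xv, if_neg ho, if_neg hs', hα]
      by_cases hl' : l = i
      · rw [hl', h2 hne, h1 hne, if_pos rfl, hxs, hxf]
        simp only [a, b, τ, if_pos hs, if_neg hF1, if_neg hs.1]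
        exact e3 _
      · obtain rfl : l = t i := by
          by_contra h'
          exact hl ⟨hl', h'⟩
        rw [h3, h1 hne', if_neg hne, hxs, hxf]
        simp only [a, b, if_pos hF', if_neg hF1, if_pos hs]
        exact e4 _
  have hug : ((P.unipU t F hF c : P.G n) : Matrix (Fin n) (Fin n) P.D) * g =
      (P.unipU t (IsSecond α.1) hS v : P.G n) := by
    ext1 i j
    have h3 : (((P.unipU t F hF c : P.G n) : Matrix (Fin n) (Fin n) P.D) * g) i j =
        g i j + (if F i then c else 0) * g (t i) j := by
      rw [Matrix.mul_apply]
      simp only [unipU_apply, add_mul, ite_mul, one_mul, zero_mul, Finset.sum_add_distrib,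
        Finset.sum_ite_eq', Finset.mem_univ, if_true]
    rw [h3, unipU_apply, hga]
    by_cases hFi : F i
    · have ha : a (t i) = 1 := if_neg (hF i hFi)
      have hb : b (t i) = v := by
        rcases ht i with h | h | h
        · exact absurd h.1 hFi.1
        · simp only [b]
          rw [if_neg (hF i hFi), if_pos h.2.2.2.2]
        · exact absurd h.1 hFi.2
      rw [hga, ha, hb, htt]
      simp only [a, b, if_pos hFi, if_neg hFi.2, mul_add, mul_ite, mul_one, mul_zero, hcv]
      split_ifs <;> simp only [add_zero, zero_add, add_assoc, neg_add_cancel_left,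
        neg_add_cancel, h22]
    · simp only [a, b, if_neg hFi, zero_mul, add_zero]
  have hw' : ‖w‖ = 1 := by
    have h3 := congrArg norm hw
    rwa [norm_mul, IsOddLocal.norm_two P, one_mul, norm_one] at h3
  have hτ : ∀ i, ‖τ i‖ = ‖P.π‖ ^ halfExp α.1 i := by
    intro i
    simp only [τ, halfExp]
    split_ifs with h3 h4 h4
    · exact absurd h3 h4.1
    · rw [norm_zpow, add_zero]
    · rw [norm_mul, norm_zpow, IsOddLocal.norm_two P, one_mul]
    · rw [norm_mul, norm_zpow, hw', one_mul, add_zero]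
  let y : P.X n := ⟨P.diagU (fun i => algebraMap k P.D (τ i)) (fun i h => by
      rw [map_eq_zero_iff _ (algebraMap k P.D).injective, ← norm_eq_zero, hτ] at h
      exact zpow_ne_zero _ P.norm_pi_pos.ne' h), Units.ext (by
    change star (Matrix.diagonal _) = Matrix.diagonal _
    rw [Matrix.star_eq_conjTranspose, Matrix.diagonal_conjTranspose]
    congr 1
    ext1 i
    exact star_algebraMap _ _)⟩
  refine ⟨P.unipU t (IsSecond α.1) hS v, unipU_mem_K hS ?_, P.unipU t F hF c, τ, y, ?_, ?_, hτ,
    rfl, ?_⟩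
  · rw [P.mem_maxOrder_iff, dn_piPrime]
    simpa using P.norm_π_lt_one.le
  · intro i j hij
    rw [unipU_apply, if_neg hij.ne, zero_add]
    split_ifs with h3 h4
    · rcases ht i with h | h | h
      · exact absurd h.1 h4.1
      · rw [h3, Fin.lt_def] at hij
        omega
      · exact absurd h.1 h4.2
    · rfl
    · rfl
  · intro i
    rw [unipU_apply, if_pos rfl]
    split_ifs with h3 h4
    · rcases ht i with h | h | h
      · exact absurd h.1 h4.1
      · have := congrArg Fin.val h3
        omega
      · exact absurd h.1 h4.2
    · rw [add_zero]
    · rw [add_zero]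
  · apply P.toMatrix_injective
    rw [toMatrix_smul, toMatrix_smul, ← hug]
    change _ * g * P.piMatrix α.1 * star (_ * g) = _ * Matrix.diagonal _ * star _
    rw [← hg, star_mul]
    simp only [Matrix.mul_assoc]

/-- The maximal absolute values of all `dᵢ` on the `K`-orbit of `π^α` are attained
simultaneously. -/
theorem exists_norm_d_smul_piX_eq (α : Lam n) : ∃ κ ∈ P.K n, ∀ i,
    ‖P.d i (κ • P.piX α)‖ = ‖P.π‖ ^ tailSum α.1 (i.val + 1) i.isLt := by
  obtain ⟨κ, hκ, u, τ, y, hu, hu1, hτ, hy, h⟩ := exists_K_smul_piX_eq_unipU_smul (P := P) α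
  let w : P.G n := P.permU Fin.revPerm
  have hw : w * w = 1 := Units.ext (by
    ext1 i j
    rw [Units.val_mul, permU_mul_apply, Units.val_one]
    simp [w, permU, Matrix.one_apply, eq_comm])
  have hb : ∀ i j, ((w * u * w : P.G n) : Matrix (Fin n) (Fin n) P.D) i j =
      (u : Matrix (Fin n) (Fin n) P.D) i.rev j.rev := by
    intro i j
    rw [Units.val_mul, mul_permU_apply, Units.val_mul, permU_mul_apply]
    rfl
  let b : P.B n := ⟨w * u * w, fun i j hij => by
    rw [hb]
    exact hu _ _ (Fin.rev_lt_rev.2 hij)⟩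
  refine ⟨w * κ, (P.K n).mul_mem (P.permU_mem_K _) hκ, fun i => ?_⟩
  have h1 : (w * κ) • P.piX α = (b : P.G n) • w • y := by
    rw [mul_smul, h, ← mul_smul, ← mul_smul]
    change (w * u) • y = (w * u * w * w) • y
    rw [mul_assoc (w * u), hw, mul_one]
  have h2 : P.psi i b = 1 := by
    rw [psi_eq_prod]
    refine Finset.prod_eq_one fun j _ => ?_
    change P.nm (((w * u * w : P.G n) : Matrix (Fin n) (Fin n) P.D) _ _) = 1
    rw [hb, hu1, nm_one]
  rw [h1, norm_d_smul, h2, norm_one, one_mul, norm_d, nrd_lowerTri, norm_prod]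
  · have h3 : ∀ j : Fin (i.val + 1), ‖P.nm (P.block (P.toMatrix (w • y)) i j j)‖ =
        (‖P.π‖ ^ halfExp α.1 (Fin.castLE i.isLt j).rev) ^ 2 := by
      intro j
      change ‖P.nm (P.toMatrix (w • y) (Fin.castLE i.isLt j) (Fin.castLE i.isLt j))‖ = _
      rw [toMatrix_permU_smul, hy, Matrix.diagonal_apply_eq, nm_algebraMap, norm_pow, hτ]
      rfl
    rw [Finset.prod_congr rfl fun j _ => h3 j, Finset.prod_pow, Real.sqrt_sq (Finset.prod_nonneg
      fun _ _ => zpow_nonneg (norm_nonneg _) _), prod_zpow_eq_zpow_sum P.norm_pi_pos.ne']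
    rfl
  · intro a c hac
    change P.toMatrix (w • y) (Fin.castLE i.isLt a) (Fin.castLE i.isLt c) = 0
    rw [toMatrix_permU_smul, hy, Matrix.diagonal_apply_ne]
    intro h
    rw [EmbeddingLike.apply_eq_iff_eq, Fin.castLE_inj] at h
    exact hac.ne h

end QuatData

/-! ### Linear independence of the spherical functions -/

theorem exists_pos_nat_eval_ne_zero {r : Polynomial ℤ} (hr : r ≠ 0) :
    ∃ T : ℕ, 0 < T ∧ r.eval (T : ℤ) ≠ 0 := by
  by_contra! h
  refine hr (Polynomial.eq_zero_of_infinite_isRoot r (Set.Infinite.mono ?_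
    ((Set.Ioi_infinite 0).image (f := fun T : ℕ => (T : ℤ)) Int.ofNat_injective.injOn)))
  rintro _ ⟨T, hT, rfl⟩
  exact h T hT

/-- Finitely many integral vectors are separated by a functional with positive coefficients, for
instance by `(1, T, T², …)` with a suitable `T`. -/
theorem exists_separating {n : ℕ} (W : Finset (Fin n → ℤ)) : ∃ N : Fin n → ℕ, (∀ i, 0 < N i) ∧
    Set.InjOn (fun v : Fin n → ℤ => ∑ i, v i * (N i : ℤ)) W := by
  classical
  obtain ⟨p, hp⟩ : ∃ p : (Fin n → ℤ) → Polynomial ℤ,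
      ∀ v, p v = ∑ i, Polynomial.C (v i) * Polynomial.X ^ i.val := ⟨_, fun _ => rfl⟩
  have hp0 : ∀ v, p v = 0 → v = 0 := by
    intro v hv
    ext i
    have h := congrArg (fun r => Polynomial.coeff r i.val) hv
    simp only [hp, Polynomial.finsetSum_coeff, Polynomial.coeff_C_mul, Polynomial.coeff_X_pow,
      Fin.val_inj, mul_ite, mul_one, mul_zero, Finset.sum_ite_eq, Finset.mem_univ, if_true,
      Polynomial.coeff_zero] at h
    exact h
  have hr : ∏ v ∈ W.offDiag, p (v.1 - v.2) ≠ 0 := Finset.prod_ne_zero_iff.2 fun v hv h =>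
    (Finset.mem_offDiag.1 hv).2.2 (sub_eq_zero.1 (hp0 _ h))
  obtain ⟨T, hT0, hT⟩ := exists_pos_nat_eval_ne_zero hr
  rw [Polynomial.eval_prod] at hT
  refine ⟨fun i => T ^ i.val, fun i => pow_pos hT0 _, fun v hv w hw hvw => ?_⟩
  by_contra hne
  refine Finset.prod_ne_zero_iff.1 hT (v, w) (Finset.mem_offDiag.2 ⟨hv, hw, hne⟩) ?_
  have h2 : ∑ i, v i * ((T ^ i.val : ℕ) : ℤ) = ∑ i, w i * ((T ^ i.val : ℕ) : ℤ) := hvw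
  simp only [hp, Polynomial.eval_finsetSum, Polynomial.eval_mul, Polynomial.eval_C,
    Polynomial.eval_pow, Polynomial.eval_X, Pi.sub_apply, sub_mul, Finset.sum_sub_distrib,
    sub_eq_zero]
  simpa only [Nat.cast_pow] using h2

/-- A sum of exponential functions with different bases and convergent coefficients is dominated by
one of its terms. -/
theorem eventually_sum_mul_zpow_pow_ne_zero {ι : Type*} {q : ℕ} (hq : 2 ≤ q) {A : Finset ι}
    (hA : A.Nonempty) {e : ι → ℤ} (he : Set.InjOn e A) {c : ι → ℕ → ℂ} {l : ι → ℂ}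
    (hc : ∀ a ∈ A, Filter.Tendsto (c a) Filter.atTop (nhds (l a))) (hl : ∀ a ∈ A, l a ≠ 0) :
    ∀ᶠ m in Filter.atTop, ∑ a ∈ A, c a m * ((q : ℂ) ^ e a) ^ m ≠ 0 := by
  classical
  obtain ⟨b, hb, hmax⟩ := A.exists_max_image e hA
  have hq0 : (q : ℂ) ≠ 0 := by exact_mod_cast (by omega : q ≠ 0)
  have hlim : Filter.Tendsto (fun m => ∑ a ∈ A, c a m * ((q : ℂ) ^ (e a - e b)) ^ m)
      Filter.atTop (nhds (∑ a ∈ A, if a = b then l a else 0)) := by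
    refine tendsto_finsetSum A fun a ha => ?_
    by_cases hab : a = b
    · rw [if_pos hab, hab]
      simpa using hc b hb
    · rw [if_neg hab, ← mul_zero (l a)]
      refine (hc a ha).mul (tendsto_pow_atTop_nhds_zero_of_norm_lt_one ?_)
      have h1 : e a < e b := lt_of_le_of_ne (hmax a ha) fun h => hab (he ha hb h)
      rw [norm_zpow, Complex.norm_natCast]
      exact zpow_lt_one_of_neg₀ (by exact_mod_cast (by omega : 1 < q)) (by omega)
  rw [Finset.sum_ite_eq' A b, if_pos hb] at hlim
  filter_upwards [hlim.eventually_ne (hl b hb)] with m hm h0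
  refine hm ?_
  have h2 : ∑ a ∈ A, c a m * ((q : ℂ) ^ (e a - e b)) ^ m =
      (∑ a ∈ A, c a m * ((q : ℂ) ^ e a) ^ m) * (((q : ℂ) ^ e b) ^ m)⁻¹ := by
    rw [Finset.sum_mul]
    refine Finset.sum_congr rfl fun a _ => ?_
    rw [zpow_sub₀ hq0, div_pow, div_eq_mul_inv, mul_assoc]
  rw [h2, h0, zero_mul]

namespace QuatData

variable {k : Type*} [NontriviallyNormedField k] [IsUltrametricDist k] {P : QuatData k} {n : ℕ}
  [LocallyCompactSpace k] [CompleteSpace k] [P.IsOddLocal]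

theorem absd_natCast {m : ℕ} (hm : m ≠ 0) {N : Fin n → ℕ} (hN : ∀ i, 0 < N i) (x : P.X n) :
    P.absd (fun i => ((m * N i : ℕ) : ℂ)) x = (((∏ i, ‖P.d i x‖ ^ N i) ^ m : ℝ) : ℂ) := by
  unfold absd
  split_ifs with h
  · push_cast
    rw [← Finset.prod_pow]
    refine Finset.prod_congr rfl fun i _ => ?_
    rw [← Nat.cast_mul, Complex.cpow_natCast, ← pow_mul, mul_comm]
  · push Not at h
    obtain ⟨i, hi⟩ := h
    rw [Finset.prod_eq_zero (Finset.mem_univ i), zero_pow hm, Complex.ofReal_zero]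
    rw [hi, norm_zero, zero_pow (hN i).ne']

variable (dk : Measure (P.K n)) [dk.IsHaarMeasure] (hdk : dk Set.univ = 1)

include hdk in
/-- The growth of a spherical function in a positive direction is governed by the maximal value of
the relative invariants on the `K`-orbit. -/
theorem exists_tendsto_omegaInt {x : P.X n} {N : Fin n → ℕ} (hN : ∀ i, 0 < N i) {r : Fin n → ℝ}
    (hr : ∀ i, 0 < r i) (hle : ∀ κ ∈ P.K n, ∀ i, ‖P.d i (κ • x)‖ ≤ r i)
    (hex : ∃ κ ∈ P.K n, ∀ i, ‖P.d i (κ • x)‖ = r i) : ∃ c : ℂ, c ≠ 0 ∧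
      Filter.Tendsto (fun m : ℕ => P.omegaInt dk x (fun i => ((m * N i : ℕ) : ℂ)) *
        ((((∏ i, r i ^ N i) ^ m)⁻¹ : ℝ) : ℂ)) Filter.atTop (nhds c) := by
  have : IsProbabilityMeasure dk := ⟨hdk⟩
  let ρ : ℝ := ∏ i, r i ^ N i
  have hρ : 0 < ρ := Finset.prod_pos fun i _ => pow_pos (hr i) _
  let f : P.K n → ℝ := fun κ => (∏ i, ‖P.d i ((κ : P.G n) • x)‖ ^ N i) / ρ
  have hf : Continuous f := (continuous_finsetProd _ fun i _ =>
    ((continuous_norm_d i).comp (continuous_K_smul x)).pow _).div_const _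
  have hf0 : ∀ κ, 0 ≤ f κ := fun κ => div_nonneg (Finset.prod_nonneg fun _ _ => by positivity) hρ.le
  have hf1 : ∀ κ, f κ ≤ 1 := fun κ => div_le_one_of_le₀
    (Finset.prod_le_prod (fun _ _ => by positivity) fun i _ =>
      pow_le_pow_left₀ (norm_nonneg _) (hle _ κ.2 i) _) hρ.le
  let E : Set (P.K n) := {κ | f κ = 1}
  have hE : MeasurableSet E := (isClosed_eq hf continuous_const).measurableSet
  obtain ⟨κ₀, hκ₀, h0⟩ := hex
  have hEpos : 0 < dk E := by
    refine Measure.measure_pos_of_mem_nhds dk (x := (⟨κ₀, hκ₀⟩ : P.K n)) ?_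
    have h1 : ∀ i, ∀ᶠ κ : P.K n in nhds ⟨κ₀, hκ₀⟩, ‖P.d i ((κ : P.G n) • x)‖ = r i := by
      intro i
      have h2 : P.d i (κ₀ • x) ≠ 0 := by
        rw [← norm_ne_zero_iff, h0]
        exact (hr i).ne'
      have h3 := ((continuous_K_smul x).tendsto ⟨κ₀, hκ₀⟩).eventually (eventually_norm_d_eq i h2)
      filter_upwards [h3] with κ hκ
      rw [hκ, h0]
    filter_upwards [Filter.eventually_all.2 h1] with κ hκ
    change (∏ i, ‖P.d i ((κ : P.G n) • x)‖ ^ N i) / ρ = 1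
    simp only [hκ]
    exact div_self hρ.ne'
  have hlim : Filter.Tendsto (fun m : ℕ => ∫ κ, f κ ^ m ∂dk) Filter.atTop
      (nhds (∫ κ, E.indicator (fun _ => (1 : ℝ)) κ ∂dk)) := by
    refine tendsto_integral_of_dominated_convergence (fun _ => 1)
      (fun m => (hf.pow m).aestronglyMeasurable) (integrable_const 1) (fun m => ?_) ?_
    · refine Filter.Eventually.of_forall fun κ => ?_
      rw [Real.norm_eq_abs, abs_of_nonneg (pow_nonneg (hf0 κ) m)]
      exact pow_le_one₀ (hf0 κ) (hf1 κ)
    · refine Filter.Eventually.of_forall fun κ => ?_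
      by_cases hκ : κ ∈ E
      · have h1 : f κ = 1 := hκ
        simp only [Set.indicator_of_mem hκ, h1, one_pow]
        exact tendsto_const_nhds
      · rw [Set.indicator_of_notMem hκ]
        exact tendsto_pow_atTop_nhds_zero_of_lt_one (hf0 κ) (lt_of_le_of_ne (hf1 κ) hκ)
  rw [integral_indicator_const _ hE, smul_eq_mul, mul_one] at hlim
  refine ⟨(dk.real E : ℂ), ?_, ?_⟩
  · exact_mod_cast (ENNReal.toReal_pos hEpos.ne' (measure_ne_top _ _)).ne'
  · refine ((Complex.continuous_ofReal.tendsto _).comp hlim).congr' ?_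
    filter_upwards [Filter.eventually_ne_atTop 0] with m hm
    change ((∫ κ, f κ ^ m ∂dk : ℝ) : ℂ) = _
    rw [omegaInt, ← integral_complex_ofReal, ← integral_mul_const]
    congr 1
    ext κ
    rw [absd_natCast hm hN, ← Complex.ofReal_mul, ← div_eq_mul_inv, ← div_pow]

variable {dx : Measure (P.X n)} [SMulInvariantMeasure (P.G n) (P.X n) dx]
  [IsFiniteMeasureOnCompacts dx]

include hdk in
variable (dx) in
/-- The spherical functions at the forms `π^α` are linearly independent: in a generic positive
direction they grow at different rates. -/
theorem linearIndependent_omega (hdx : dx ≠ 0) :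
    LinearIndependent ℂ fun α : Lam n => P.omega dk (P.piX α) := by
  classical
  have hq := P.two_le_q
  have hq0 : (q k : ℂ) ≠ 0 := by exact_mod_cast (by omega : q k ≠ 0)
  rw [linearIndependent_iff']
  intro T c hsum
  by_contra! hne
  obtain ⟨α₀, hα₀, hα₀'⟩ := hne
  let A := T.filter fun α => c α ≠ 0
  have hA : A.Nonempty := ⟨α₀, Finset.mem_filter.2 ⟨hα₀, hα₀'⟩⟩
  have hrep := Represents.sum T fun α _ => (represents_omega dk hdk dx hdx (P.piX α)).smul (c α)
  rw [hsum] at hrep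
  obtain ⟨R, M, hM, hR, heval⟩ := hrep
  obtain rfl : R = 0 := by
    have h1 := (div_eq_zero_iff.1 hR.symm).resolve_right (algebraMap_ne_zero hM)
    exact (map_eq_zero_iff _ (IsFractionRing.injective _ _)).1 h1
  let μ : Lam n → Fin n → ℤ := fun α i => -tailSum α.1 (i.val + 1) i.isLt
  let ν : (Fin n →₀ ℕ) → Fin n → ℤ := fun m i => (m i : ℤ)
  have hμ : Function.Injective μ := fun α β h => Subtype.ext
    (tailSum_injective α.2 β.2 fun i => neg_injective (congrFun h i))
  have hν : Function.Injective ν := fun a b h => Finsupp.ext fun i =>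
    Int.ofNat_injective (congrFun h i)
  obtain ⟨N, hN, hinj⟩ := exists_separating (A.image μ ∪ M.support.image ν)
  let e : (Fin n → ℤ) → ℤ := fun v => ∑ i, v i * (N i : ℤ)
  have hprod : ∀ v : Fin n → ℤ, ∏ i, ((q k : ℝ) ^ v i) ^ N i = (q k : ℝ) ^ e v := by
    intro v
    rw [← prod_zpow_eq_zpow_sum (by exact_mod_cast (by omega : q k ≠ 0))]
    exact Finset.prod_congr rfl fun i _ => by rw [← zpow_natCast, ← zpow_mul]
  have h1 := fun α : Lam n => exists_tendsto_omegaInt dk hdk hN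
    (r := fun i => (q k : ℝ) ^ μ α i) (fun i => zpow_pos (by exact_mod_cast (by omega)) _)
    (fun κ hκ i => by
      have h2 := norm_d_smul_piX_le α hκ i
      rwa [IsOddLocal.norm_pi, inv_zpow'] at h2) (by
      obtain ⟨κ, hκ, h2⟩ := exists_norm_d_smul_piX_eq (P := P) α
      refine ⟨κ, hκ, fun i => ?_⟩
      rw [h2, IsOddLocal.norm_pi, inv_zpow'])
  choose l hl0 hl using h1
  have hF := eventually_sum_mul_zpow_pow_ne_zero hq hA (e := fun α => e (μ α))
    (fun α hα β hβ h => hμ (hinj (Finset.mem_union_left _ (Finset.mem_image_of_mem _ hα))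
      (Finset.mem_union_left _ (Finset.mem_image_of_mem _ hβ)) h))
    (fun α _ => (hl α).const_mul (c α)) fun α hα =>
      mul_ne_zero (Finset.mem_filter.1 hα).2 (hl0 α)
  have hG := eventually_sum_mul_zpow_pow_ne_zero hq (A := M.support)
    (MvPolynomial.support_nonempty.2 hM) (e := fun m => e (ν m))
    (fun a ha b hb h => hν (hinj (Finset.mem_union_right _ (Finset.mem_image_of_mem _ ha))
      (Finset.mem_union_right _ (Finset.mem_image_of_mem _ hb)) h))
    (c := fun m _ => M.coeff m) (fun m _ => tendsto_const_nhds)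
    fun m hm => MvPolynomial.mem_support_iff.1 hm
  obtain ⟨m, hm1, hm2⟩ := (hF.and hG).exists
  have h3 := heval (fun i => ((m * N i : ℕ) : ℂ)) fun i _ => by
    rw [Complex.natCast_re]
    exact Nat.cast_nonneg _
  rw [map_zero, mul_eq_zero] at h3
  rcases h3 with h3 | h3
  · refine hm2 ?_
    rw [← h3, MvPolynomial.eval_eq']
    refine Finset.sum_congr rfl fun a _ => ?_
    congr 1
    have h4 : (q k : ℂ) ^ e (ν a) = (q k : ℂ) ^ ∑ i, a i * N i := by
      rw [← zpow_natCast]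
      push_cast
      rfl
    rw [h4, ← pow_mul, Finset.sum_mul, ← Finset.prod_pow_eq_pow_sum]
    refine Finset.prod_congr rfl fun i _ => ?_
    rw [Complex.cpow_natCast, ← pow_mul]
    congr 1
    ring
  · refine hm1 ?_
    have h4 : ∑ α ∈ T, c α * P.omegaInt dk (P.piX α) (fun i => ((m * N i : ℕ) : ℂ)) = 0 := h3
    rw [← Finset.sum_filter_of_ne (p := fun α => c α ≠ 0) fun α _ h => left_ne_zero_of_mul h] at h4
    rw [← h4]
    refine Finset.sum_congr rfl fun α _ => ?_
    have h5 : (q k : ℂ) ^ e (μ α) ≠ 0 := zpow_ne_zero _ hq0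
    rw [hprod]
    push_cast
    rw [mul_assoc, mul_assoc, inv_mul_cancel₀ (pow_ne_zero _ h5), mul_one]

end QuatData

namespace QuatData

variable {k : Type*} [NontriviallyNormedField k] [IsUltrametricDist k]

theorem isOddLocal (hodd : ringChar (ResidueField k) ≠ 2) (P : QuatData k)
    (hnorm : ‖P.π‖ = (q k : ℝ)⁻¹) : P.IsOddLocal where
  norm_two := by
    have h2 : ‖(2 : k)‖ ≤ 1 := by
      exact_mod_cast IsUltrametricDist.norm_natCast_le_one k 2
    refine le_antisymm h2 (not_lt.1 fun h => hodd ?_)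
    have h0 : ((2 : ℕ) : ResidueField k) = 0 := by
      have h1 := (residue_eq_zero_iff (a := (2 : integers k))).2 h
      rw [map_ofNat] at h1
      exact_mod_cast h1
    exact ((Nat.dvd_prime Nat.prime_two).1 ((ringChar.spec _ 2).1 h0)).resolve_left
      (CharP.ringChar_ne_one (R := ResidueField k))
  norm_pi := hnorm

end QuatData

end QHerm

end

theorem proposition2p8 {k : Type*} [NontriviallyNormedField k] [IsUltrametricDist k]
    [LocallyCompactSpace k] [CharZero k]
    -- the residual characteristic is odd
    (hodd : ringChar (QHerm.ResidueField k) ≠ 2)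
    (P : QHerm.QuatData k)
    -- the absolute value of `k` is the normalized one
    (hnorm : ‖P.π‖ = (QHerm.q k : ℝ)⁻¹)
    (n : ℕ) (hn : 1 ≤ n)
    -- normalized Haar measures on `G` and `K`, and the left Haar measure on `B`
    (dg : Measure (P.G n)) [dg.IsHaarMeasure] (hdg : dg (P.K n : Set (P.G n)) = 1)
    (dk : Measure (P.K n)) [dk.IsHaarMeasure] (hdk : dk Set.univ = 1)
    (dp : Measure (P.B n)) [dp.IsHaarMeasure]
    (hdp : dp {p : P.B n | (p : P.G n) ∈ P.K n} = 1)
    -- a nonzero `G`-invariant measure on `X`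
    (dx : Measure (P.X n)) [SMulInvariantMeasure (P.G n) (P.X n) dx]
    [IsFiniteMeasureOnCompacts dx] (hdx : dx ≠ 0) :
    -- `ω(x; s)` is absolutely convergent in the region, and continued to a rational function
    (∀ x : P.X n,
      (∀ s ∈ QHerm.region n, Integrable (fun κ : P.K n => P.absd s ((κ : P.G n) • x)) dk) ∧
      QHerm.Represents (QHerm.q k) (QHerm.region n) (P.omegaInt dk x) (P.omega dk x)) ∧
    -- `F₀` is a well-defined map `𝒮(K\X) → ℂ(q^{s₁}, …, q^{sₙ})`
    (∀ φ ∈ P.schwartz n,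
      (∀ s ∈ QHerm.region n, Integrable (fun x : P.X n => φ x * P.omegaInt dk x⁻¹ s) dx) ∧
      QHerm.Represents (QHerm.q k) (QHerm.region n) (P.fourierInt dk dx φ) (P.F0 dk dx φ)) ∧
    -- `λ_s` is a well-defined map `ℋ(G, K) → ℂ(q^{s₁}, …, q^{sₙ})`
    (∀ f ∈ P.hecke n,
      (∀ s : Fin n → ℂ, Integrable (P.lamIntegrand f s) dp) ∧
      QHerm.Represents (QHerm.q k) Set.univ (P.lamInt dp f) (P.lam dp f)) ∧
    -- `F₀` is compatible with the action of the Hecke algebra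
    (∀ f ∈ P.hecke n, ∀ φ ∈ P.schwartz n,
      (∀ x : P.X n, Integrable (fun g : P.G n => f g * φ (g⁻¹ • x)) dg) ∧
      P.heckeAct dg f φ ∈ P.schwartz n ∧
      P.F0 dk dx (P.heckeAct dg f φ) = P.lam dp f * P.F0 dk dx φ) ∧
    -- `F₀` is injective
    Set.InjOn (P.F0 dk dx) (P.schwartz n : Set (P.X n → ℂ)) ∧
    -- the functions `ω(π^α; s)`, `α ∈ Λₙ`, are linearly independent
    LinearIndependent ℂ (fun α : QHerm.Lam n => P.omega dk (P.piX α)) := by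
  have : ProperSpace k := ProperSpace.of_locallyCompactSpace k
  have : P.IsOddLocal := QHerm.QuatData.isOddLocal hodd P hnorm
  have hF := fun φ (hφ : φ ∈ P.schwartz n) =>
    QHerm.QuatData.represents_F0 (dx := dx) dk hdk hdx hφ
  have hli := QHerm.QuatData.linearIndependent_omega dk hdk dx hdx
  refine ⟨fun x => ⟨fun s hs => QHerm.QuatData.integrable_absd_K dk hdk x hs,
      QHerm.QuatData.represents_omega dk hdk dx hdx x⟩,
    fun φ hφ => ⟨fun s _ => QHerm.QuatData.integrable_fourier dk hdk hφ s, hF φ hφ⟩,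
    fun f hf => QHerm.QuatData.represents_lam hdp hf, fun f hf φ hφ => ?_,
    QHerm.QuatData.injOn_F0 dk hdk hdx hli, hli⟩
  have hfφ := QHerm.QuatData.heckeAct_mem_schwartz hdg hf hφ
  obtain ⟨R, hR, hR'⟩ := QHerm.QuatData.exists_finset_cosets hf
  refine ⟨fun x => (QHerm.QuatData.integral_hecke hdg hf hR hR' fun g κ hκ =>
    QHerm.QuatData.schwartz_inv_mul hφ x g hκ).1, hfφ, ?_⟩
  exact (hF _ hfφ).unique P.two_le_q le_rfl
    (((QHerm.QuatData.represents_lam hdp hf).2.mul (Set.subset_univ _) (hF φ hφ)).congr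
      fun s hs => QHerm.QuatData.fourierInt_heckeAct hdp hdg dk hdk hf hφ hs)
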